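/- Let $n\ge 1$. Manifolds are smooth; they may be empty or disconnected. **Embeddings.** $\mathbf{Emb}_n$ is the category of compact $n$-manifolds, maybe with boundary. Its morphisms are classes of tame embeddings: a smooth embedding $f:W_1\to W_2$ is tame if, for some union $N$ of components of $\partial W_1$, it extends to an embedding of $W_1\cup_N(N\times[0,1])$ with $f^{-1}(\partial W_2)=\partial W_1\setminus N$; two are identified if an ambient diffeotopy of $W_2$ fixing $\partial W_2$ takes one to the other (classes are taken for the congruence generated by this). A closed $(n-1)$-manifold $M$ is regarded as the object $M\times[0,1]$ of $\mathbf{Emb}_n$. A *sheaf* is a functor $\mathcal S:\mathbf{Emb}_n^{op}\to\mathbf{Cat}$ such that, for every finite cover of $X$ by tamely embedded compact $n$-manifolds whose pairwise intersections are tamely embedded compact $n$-manifolds, every compatible family of objects (and of morphisms between two given objects of $\mathcal S(X)$) glues uniquely; in particular $\mathcal S(\emptyset)$ is a terminal category. The category $\mathbf{Emb}_n^{\mathcal S}$ of $\mathcal S$-embeddings has as objects the pairs $(W,s)$, $s\in\mathcal S(W)$, and as morphisms $(W_1,s_1)\to(W_2,s_2)$ the pairs $(f,\alpha)$ with $f:W_1\to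 W_2$ in $\mathbf{Emb}_n$ and $\alpha:s_1\to\mathcal S(f)(s_2)$. **Bordisms.** The 2-category (bicategory) $\mathbf{Bd}_n^{\mathcal S}$ has as objects the pairs $(M,s)$ with $M$ a closed $(n-1)$-manifold and $s\in\mathcal S(M\times[0,1])$. A 1-morphism $(M_1,s_1)\to(M_2,s_2)$ is a compact $n$-manifold $W$ with tame collars $i_1:M_1\times[0,1]\to W$, $i_2:M_2\times[0,1]\to W$ such that $\partial W=i_1(M_1\times\{0\})\sqcup i_2(M_2\times\{1\})$, and an object $s\in\mathcal S(W)$ with $\mathcal S(i_k)(s)=s_k$. The two collars are disjoint, except that whole fibres $\{x\}\times[0,1]$ of them may coincide; so $M\times[0,1]$ with both collars the identity is a bordism $M\to M$, the identity of $M$. A 2-cell $W\Rightarrow W'$ is a collar-preserving diffeomorphism $W\to W'$, up to diffeotopy fixing the collars, together with a morphism $(f,\alpha)$ of $\mathcal S$-embeddings over it with $\alpha$ the identity on the collars. Composition is gluing along the collar $M_2\times[0,1]$; the monoidal structure is disjoint union, with unit $\emptyset$. **Spans.** For a category $\mathcal C$ with pullbacks and a final object, $\mathbf{Span}(\mathcal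 C)$ is the 2-category (bicategory) with the objects of $\mathcal C$, with spans $a\leftarrow d\to b$ as 1-morphisms, composed by pullback, and with maps $d'\to d$ commuting with the legs as 2-morphisms from $(a\leftarrow d\to b)$ to $(a\leftarrow d'\to b)$. Its monoidal structure is given by products in $\mathcal C$, with the final object as unit. **Seifert–van Kampen property.** A functor $F:(\mathbf{Emb}_n^{\mathcal S})^{op}\to\mathcal C$ has this property if it sends $\emptyset$ to a final object, and if it sends to a pullback square every gluing square $(M\times[0,1],o)\rightrightarrows(A,s),(B,t)\rightrightarrows(X,x)$, in which $X$ is the union of the tamely embedded $A$ and $B$, with $A\cap B=M\times[0,1]$ a common collar of the closed $(n-1)$-manifold $M$ with $M\times\{1\}\subseteq\partial A$ and $M\times\{0\}\subseteq\partial B$, and in which $o,s,t$ are the restrictions of $x$. **Proposition.** Let $\mathcal S$ be a sheaf, $\mathcal C$ a category with final object and pullbacks, and $F:(\mathbf{Emb}_n^{\mathcal S})^{op}\to\mathcal C$ a functor with the Seifert–van Kampen property. Then there is a monoidal 2-functor (pseudofunctor) $\mathcal F:\mathbf{Bd}_n^{\mathcal S}\to\mathbf{Span}(\mathcal C)$ which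 sends $(M,s)$ to $F(M,s)=F(M\times[0,1],s)$, a bordism $(W,s):(M_1,s_1)\to(M_2,s_2)$ to the span $$F(M_1,s_1)\xleftarrow{F(i_1)}F(W,s)\xrightarrow{F(i_2)}F(M_2,s_2),$$ and a 2-cell $(f,\alpha)$ to the map $F(f,\alpha)$. Here *monoidal* means that there are an equivalence $\star\simeq\mathcal F(\emptyset)$ and a pseudonatural transformation $\mathcal F(-)\times\mathcal F(-)\Rightarrow\mathcal F(-\sqcup-)$ all of whose components are equivalences; moreover the component at $(M,N)$ can be taken to be the span $F(M)\times F(N)\leftarrow F(M\sqcup N)\xrightarrow{=}F(M\sqcup N)$ given by the canonical map. -/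

import Mathlib

set_option linter.unusedSectionVars false

namespace FieldTheory

open CategoryTheory Set Function Topology
open scoped Manifold ContDiff

section Gluing

variable {E H : Type} [NormedAddCommGroup E] [NormedSpace ℝ E] [TopologicalSpace H]

theorem isManifold_of_transitions (I : ModelWithCorners ℝ E H) (X : Type) [TopologicalSpace X]
    [ChartedSpace H X]
    (h : ∀ e ∈ atlas H X, ∀ e' ∈ atlas H X, ∀ p ∈ (e.symm ≫ₕ e').source,
      ContMDiffAt I I ∞ (e.symm ≫ₕ e') p) : IsManifold I ∞ X := by
  apply isManifold_of_contDiffOn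
  rintro e e' he he' y ⟨hy, p, rfl⟩
  have hp : p ∈ (e.symm ≫ₕ e').source := by simpa using hy
  have h1 := (contMDiffAt_iff.1 (h e he e' he' p hp)).2
  simp only [mfld_simps] at h1
  refine (h1.mono inter_subset_right).congr_of_eventuallyEq ?_ ?_
  · exact Filter.Eventually.of_forall fun z => rfl
  · rfl

variable {X A B : Type} [TopologicalSpace X] [TopologicalSpace A] [TopologicalSpace B]

/-- The homeomorphism of `U` onto its image, for a map `j` that is injective, continuous and open
on the open set `U`. -/
noncomputable def pieceHomeo (j : A → X) (U : Set A) (hU : IsOpen U) (hinj : InjOn j U)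
    (hc : Continuous j) (ho : ∀ V ⊆ U, IsOpen V → IsOpen (j '' V)) (a : A) :
    OpenPartialHomeomorph A X :=
  haveI : Nonempty A := ⟨a⟩
  OpenPartialHomeomorph.ofContinuousOpenRestrict (hinj.toPartialEquiv j U) hc.continuousOn
    (by
      intro V hV
      obtain ⟨V', hV', rfl⟩ := isOpen_induced_iff.1 hV
      have : (U.domRestrict j) '' (Subtype.val ⁻¹' V') = j '' (U ∩ V') := by
        ext x; constructor
        · rintro ⟨⟨y, hy⟩, hy', rfl⟩; exact ⟨y, ⟨hy, hy'⟩, rfl⟩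
        · rintro ⟨y, ⟨hy, hy'⟩, rfl⟩; exact ⟨⟨y, hy⟩, hy', rfl⟩
      exact this ▸ ho _ inter_subset_left (hU.inter hV')) hU

theorem transition_contMDiffAt [ChartedSpace H A] [ChartedSpace H B] {I : ModelWithCorners ℝ E H}
    [IsManifold I ∞ A] [IsManifold I ∞ B]
    (eA : OpenPartialHomeomorph A X) (eB : OpenPartialHomeomorph B X)
    (h : ∀ a ∈ eA.source, eA a ∈ eB.target → ContMDiffAt I I ∞ (eB.symm ∘ eA) a) (a : A) (b : B)
    (p : H) (hp : p ∈ ((eA.symm ≫ₕ chartAt H a).symm ≫ₕ (eB.symm ≫ₕ chartAt H b)).source) :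
    ContMDiffAt I I ∞ ((eA.symm ≫ₕ chartAt H a).symm ≫ₕ (eB.symm ≫ₕ chartAt H b)) p := by
  simp only [mfld_simps] at hp
  obtain ⟨⟨h1, h2⟩, h3, h4⟩ := hp
  have k1 : ContMDiffAt I I ∞ (chartAt H a).symm p :=
    (contMDiffOn_chart_symm (I := I) (n := ∞)).contMDiffAt ((chartAt H a).open_target.mem_nhds h1)
  have k2 := h _ h2 h3
  have k3 : ContMDiffAt I I ∞ (chartAt H b) (eB.symm (eA ((chartAt H a).symm p))) :=
    (contMDiffOn_chart (I := I) (n := ∞)).contMDiffAt ((chartAt H b).open_source.mem_nhds h4)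
  exact (ContMDiffAt.comp (g := chartAt H b) p k3 (ContMDiffAt.comp (g := eB.symm ∘ eA) p k2 k1) :)

/-- Two manifolds `A` and `B` with injections of a third one, `O`, which are local diffeomorphisms
away from the disjoint closed sets `K₀` and `K₁` respectively. -/
structure GlueDatum (I : ModelWithCorners ℝ E H) (O A B : Type)
    [TopologicalSpace O] [ChartedSpace H O] [TopologicalSpace A] [ChartedSpace H A]
    [TopologicalSpace B] [ChartedSpace H B] where
  f : O → A
  g : O → B
  K₀ : Set O
  K₁ : Set O
  closed₀ : IsClosed K₀
  closed₁ : IsClosed K₁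
  disj : ∀ o ∈ K₀, o ∉ K₁
  f_inj : Injective f
  g_inj : Injective g
  f_cont : Continuous f
  g_cont : Continuous g
  f_loc : ∀ o, o ∉ K₀ → IsLocalDiffeomorphAt I I ∞ f o
  g_loc : ∀ o, o ∉ K₁ → IsLocalDiffeomorphAt I I ∞ g o

namespace GlueDatum

variable {I : ModelWithCorners ℝ E H} {O A B : Type}
  [TopologicalSpace O] [ChartedSpace H O] [TopologicalSpace A] [ChartedSpace H A]
  [TopologicalSpace B] [ChartedSpace H B] (D : GlueDatum I O A B)

/-- The datum with the two sides exchanged. -/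
def swap : GlueDatum I O B A where
  f := D.g
  g := D.f
  K₀ := D.K₁
  K₁ := D.K₀
  closed₀ := D.closed₁
  closed₁ := D.closed₀
  disj o h h' := D.disj o h' h
  f_inj := D.g_inj
  g_inj := D.f_inj
  f_cont := D.g_cont
  g_cont := D.f_cont
  f_loc := D.g_loc
  g_loc := D.f_loc

/-- The relation identifying `f o` with `g o`. -/
def Rel : A ⊕ B → A ⊕ B → Prop
  | .inl a, .inl a' => a = a'
  | .inr b, .inr b' => b = b'
  | .inl a, .inr b => ∃ o, D.f o = a ∧ D.g o = b
  | .inr b, .inl a => ∃ o, D.f o = a ∧ D.g o = b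

/-- The relation identifying `f o` with `g o`, as an equivalence relation. -/
def setoid : Setoid (A ⊕ B) where
  r := D.Rel
  iseqv :=
    { refl := by rintro (a | b) <;> simp [Rel]
      symm := by rintro (a | b) (a' | b') h <;> simp_all [Rel]
      trans := by
        rintro (a | b) (a' | b') (a'' | b'') h h' <;> simp only [Rel] at *
        · exact h.trans h'
        · subst h; exact h'
        · obtain ⟨o, rfl, rfl⟩ := h
          obtain ⟨o', rfl, h2⟩ := h'
          rw [D.g_inj h2]
        · subst h'; exact h
        · subst h'; exact h
        · obtain ⟨o, rfl, rfl⟩ := h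
          obtain ⟨o', h2, rfl⟩ := h'
          rw [D.f_inj h2]
        · subst h; exact h'
        · exact h.trans h' }

/-- The space obtained from `A` and `B` by identifying `f o` with `g o`. -/
def Glue : Type := Quotient D.setoid

instance : TopologicalSpace D.Glue := inferInstanceAs (TopologicalSpace (Quotient D.setoid))

def inl (a : A) : D.Glue := Quotient.mk D.setoid (.inl a)
def inr (b : B) : D.Glue := Quotient.mk D.setoid (.inr b)

theorem inl_eq_inr {a : A} {b : B} : D.inl a = D.inr b ↔ ∃ o, D.f o = a ∧ D.g o = b :=
  Quotient.eq (r := D.setoid)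
theorem inr_eq_inl {a : A} {b : B} : D.inr b = D.inl a ↔ ∃ o, D.f o = a ∧ D.g o = b :=
  Quotient.eq (r := D.setoid)
theorem inl_injective : Injective D.inl := fun _ _ h => Quotient.exact (s := D.setoid) h
theorem inr_injective : Injective D.inr := fun _ _ h => Quotient.exact (s := D.setoid) h
theorem glue_condition (o : O) : D.inl (D.f o) = D.inr (D.g o) := D.inl_eq_inr.2 ⟨o, rfl, rfl⟩
theorem exists_rep (x : D.Glue) : (∃ a, D.inl a = x) ∨ ∃ b, D.inr b = x := by
  induction x using Quotient.inductionOn with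
  | h x => rcases x with a | b
           · exact .inl ⟨a, rfl⟩
           · exact .inr ⟨b, rfl⟩
theorem inl_continuous : Continuous D.inl := continuous_quot_mk.comp continuous_inl
theorem inr_continuous : Continuous D.inr := continuous_quot_mk.comp continuous_inr

theorem isOpen_iff {V : Set D.Glue} : IsOpen V ↔ IsOpen (D.inl ⁻¹' V) ∧ IsOpen (D.inr ⁻¹' V) := by
  exact (isQuotientMap_quot_mk (X := A ⊕ B) (r := D.setoid.r)).isOpen_preimage.symm.trans
    isOpen_sum_iff

theorem isClosed_iff {V : Set D.Glue} :
    IsClosed V ↔ IsClosed (D.inl ⁻¹' V) ∧ IsClosed (D.inr ⁻¹' V) := by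
  simp only [← isOpen_compl_iff, isOpen_iff, preimage_compl]

/-- The map out of the glued space defined by compatible maps. -/
def desc {Y : Type*} (u : A → Y) (v : B → Y) (h : ∀ o, u (D.f o) = v (D.g o)) : D.Glue → Y :=
  Quotient.lift (Sum.elim u v) (by
    rintro (a | b) (a' | b') (r : D.Rel _ _) <;> simp only [Rel] at r
    · rw [r]
    · obtain ⟨o, rfl, rfl⟩ := r; exact h o
    · obtain ⟨o, rfl, rfl⟩ := r; exact (h o).symm
    · rw [r])

@[simp] theorem desc_inl {Y : Type*} (u : A → Y) (v : B → Y) (h) (a : A) :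
    D.desc u v h (D.inl a) = u a := rfl
@[simp] theorem desc_inr {Y : Type*} (u : A → Y) (v : B → Y) (h) (b : B) :
    D.desc u v h (D.inr b) = v b := rfl

instance [CompactSpace A] [CompactSpace B] : CompactSpace D.Glue :=
  inferInstanceAs (CompactSpace (Quotient D.setoid))

/-- The glued space with the two sides exchanged. -/
def swapHomeo : D.Glue ≃ₜ D.swap.Glue where
  toFun := D.desc D.swap.inr D.swap.inl fun o => (D.swap.glue_condition o).symm
  invFun := D.swap.desc D.inr D.inl fun o => (D.glue_condition o).symm
  left_inv x := by rcases D.exists_rep x with ⟨a, rfl⟩ | ⟨a, rfl⟩ <;> rfl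
  right_inv x := by rcases D.swap.exists_rep x with ⟨a, rfl⟩ | ⟨a, rfl⟩ <;> rfl
  continuous_toFun := by
    refine continuous_def.2 fun V hV => D.isOpen_iff.2 ?_
    exact ⟨hV.preimage D.swap.inr_continuous, hV.preimage D.swap.inl_continuous⟩
  continuous_invFun := by
    refine continuous_def.2 fun V hV => D.swap.isOpen_iff.2 ?_
    exact ⟨hV.preimage D.inr_continuous, hV.preimage D.inl_continuous⟩

/-- The part of `A` that is open in the glued space. -/
def U : Set A := (D.f '' D.K₁)ᶜ

theorem isOpen_U [CompactSpace O] [T2Space A] : IsOpen D.U :=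
  (D.closed₁.isCompact.image D.f_cont).isClosed.isOpen_compl

theorem isOpen_image_g {V : Set O} (hV : IsOpen V) (h : ∀ o ∈ V, o ∉ D.K₁) :
    IsOpen (D.g '' V) := by
  rw [isOpen_iff_mem_nhds]
  rintro _ ⟨o, ho, rfl⟩
  obtain ⟨Φ, h1, h2⟩ := D.g_loc o (h o ho)
  have := Φ.toOpenPartialHomeomorph.image_mem_nhds h1 (hV.mem_nhds ho)
  have h3 := Φ.toOpenPartialHomeomorph.image_mem_nhds h1
    (Filter.inter_mem (hV.mem_nhds ho) (Φ.open_source.mem_nhds h1))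
  rw [show D.g o = Φ.toOpenPartialHomeomorph o from h2 h1]
  refine Filter.mem_of_superset h3 ?_
  rintro _ ⟨o', ⟨h4, h5⟩, rfl⟩
  exact ⟨o', h4, h2 h5⟩

theorem isOpen_image_inl {V : Set A} (hV : V ⊆ D.U) (h : IsOpen V) : IsOpen (D.inl '' V) := by
  rw [isOpen_iff, preimage_image_eq _ D.inl_injective]
  refine ⟨h, ?_⟩
  have : D.inr ⁻¹' (D.inl '' V) = D.g '' (D.f ⁻¹' V) := by
    ext b
    simp only [mem_preimage, mem_image, inl_eq_inr]
    constructor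
    · rintro ⟨_, ha, o, rfl, rfl⟩; exact ⟨o, ha, rfl⟩
    · rintro ⟨o, ha, rfl⟩; exact ⟨_, ha, o, rfl, rfl⟩
  rw [this]
  exact D.isOpen_image_g (h.preimage D.f_cont) fun o ho h' => hV ho ⟨o, h', rfl⟩

theorem isOpen_image_inr {V : Set B} (hV : V ⊆ D.swap.U) (h : IsOpen V) : IsOpen (D.inr '' V) := by
  have := (D.swap.isOpen_image_inl hV h).preimage D.swapHomeo.continuous
  have h2 : D.swapHomeo ⁻¹' (D.swap.inl '' V) = D.inr '' V := by
    rw [← D.swapHomeo.image_symm, image_image]; rfl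
  rwa [h2] at this

theorem mem_cover (x : D.Glue) : (∃ a ∈ D.U, D.inl a = x) ∨ ∃ b ∈ D.swap.U, D.inr b = x := by
  rcases D.exists_rep x with ⟨a, rfl⟩ | ⟨b, rfl⟩
  · by_cases ha : a ∈ D.U
    · exact .inl ⟨a, ha, rfl⟩
    · obtain ⟨o, ho, rfl⟩ := not_not.1 ha
      refine .inr ⟨D.g o, ?_, (D.glue_condition o).symm⟩
      rintro ⟨o', ho', h⟩
      obtain rfl := D.g_inj h
      exact D.disj _ ho' ho
  · by_cases hb : b ∈ D.swap.U
    · exact .inr ⟨b, hb, rfl⟩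
    · obtain ⟨o, ho, rfl⟩ := not_not.1 hb
      refine .inl ⟨D.f o, ?_, D.glue_condition o⟩
      rintro ⟨o', ho', h⟩
      obtain rfl := D.f_inj h
      exact D.disj _ ho ho'

theorem isClosed_image_inl [CompactSpace O] [CompactSpace A] [T2Space A] [T2Space B] {V : Set A}
    (hV : IsClosed V) : IsClosed (D.inl '' V) := by
  rw [isClosed_iff, preimage_image_eq _ D.inl_injective]
  refine ⟨hV, ?_⟩
  have : D.inr ⁻¹' (D.inl '' V) = D.g '' (D.f ⁻¹' V) := by
    ext b
    simp only [mem_preimage, mem_image, inl_eq_inr]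
    constructor
    · rintro ⟨_, ha, o, rfl, rfl⟩; exact ⟨o, ha, rfl⟩
    · rintro ⟨o, ha, rfl⟩; exact ⟨_, ha, o, rfl, rfl⟩
  rw [this]
  exact ((hV.preimage D.f_cont).isCompact.image D.g_cont).isClosed

theorem isClosed_image_inr [CompactSpace O] [CompactSpace B] [T2Space A] [T2Space B] {V : Set B}
    (hV : IsClosed V) : IsClosed (D.inr '' V) := by
  have := (D.swap.isClosed_image_inl hV).preimage D.swapHomeo.continuous
  have h2 : D.swapHomeo ⁻¹' (D.swap.inl '' V) = D.inr '' V := by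
    rw [← D.swapHomeo.image_symm, image_image]; rfl
  rwa [h2] at this

variable [CompactSpace O] [CompactSpace A] [CompactSpace B] [T2Space A] [T2Space B]

instance : T2Space D.Glue where
  t2 x y hxy := by
    let π : A ⊕ B → D.Glue := Quotient.mk D.setoid
    have hπ : Continuous π := continuous_quot_mk
    have hcl : ∀ V : Set (A ⊕ B), IsClosed V → IsClosed (π '' V) := by
      intro V hV
      have : π '' V = D.inl '' (Sum.inl ⁻¹' V) ∪ D.inr '' (Sum.inr ⁻¹' V) := by
        ext z
        simp only [mem_image, mem_union, mem_preimage]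
        constructor
        · rintro ⟨a | b, h, rfl⟩
          · exact .inl ⟨a, h, rfl⟩
          · exact .inr ⟨b, h, rfl⟩
        · rintro (⟨a, h, rfl⟩ | ⟨b, h, rfl⟩)
          · exact ⟨_, h, rfl⟩
          · exact ⟨_, h, rfl⟩
      rw [this]
      exact (D.isClosed_image_inl (hV.preimage continuous_inl)).union
        (D.isClosed_image_inr (hV.preimage continuous_inr))
    have hsing : ∀ z : D.Glue, IsClosed ({z} : Set D.Glue) := by
      intro z
      obtain ⟨w, rfl⟩ : ∃ w, π w = z := Quotient.exists_rep z
      simpa using hcl {w} isClosed_singleton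
    obtain ⟨V, W, hV, hW, hxV, hyW, hVW⟩ := normal_separation ((hsing x).preimage hπ)
      ((hsing y).preimage hπ) ((disjoint_singleton.2 hxy).preimage π)
    refine ⟨(π '' Vᶜ)ᶜ, (π '' Wᶜ)ᶜ, (hcl _ hV.isClosed_compl).isOpen_compl,
      (hcl _ hW.isClosed_compl).isOpen_compl, ?_, ?_, ?_⟩
    · rintro ⟨w, hw, rfl⟩; exact hw (hxV rfl)
    · rintro ⟨w, hw, rfl⟩; exact hw (hyW rfl)
    · rw [Set.disjoint_left]
      intro z hz hz'
      obtain ⟨w, rfl⟩ : ∃ w, π w = z := Quotient.exists_rep z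
      have h1 : w ∈ V := by_contra fun h => hz ⟨w, h, rfl⟩
      have h2 : w ∈ W := by_contra fun h => hz' ⟨w, h, rfl⟩
      exact Set.disjoint_left.1 hVW h1 h2

/-- `A` as an open piece of the glued space. -/
noncomputable def homeoL (a : A) : OpenPartialHomeomorph A D.Glue :=
  pieceHomeo D.inl D.U D.isOpen_U D.inl_injective.injOn D.inl_continuous
    (fun _ hV h => D.isOpen_image_inl hV h) a

/-- `B` as an open piece of the glued space. -/
noncomputable def homeoR (b : B) : OpenPartialHomeomorph B D.Glue :=
  pieceHomeo D.inr D.swap.U D.swap.isOpen_U D.inr_injective.injOn D.inr_continuous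
    (fun _ hV h => D.isOpen_image_inr hV h) b

noncomputable instance : ChartedSpace H D.Glue where
  atlas := {e | (∃ a, e = (D.homeoL a).symm ≫ₕ chartAt H a) ∨
    ∃ b, e = (D.homeoR b).symm ≫ₕ chartAt H b}
  chartAt x :=
    open Classical in
    if h : ∃ a ∈ D.U, D.inl a = x then (D.homeoL h.choose).symm ≫ₕ chartAt H h.choose
    else (D.homeoR ((D.mem_cover x).resolve_left h).choose).symm ≫ₕ
      chartAt H ((D.mem_cover x).resolve_left h).choose
  mem_chart_source x := by
    split_ifs with h
    · have h2 := h.choose_spec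
      set a := h.choose
      rw [← h2.2]
      simp only [mfld_simps]
      refine ⟨(D.homeoL a).map_source h2.1, ?_⟩
      rw [show (D.homeoL a).symm (D.inl a) = a from (D.homeoL a).left_inv h2.1]
      exact mem_chart_source H a
    · have h2 := ((D.mem_cover x).resolve_left h).choose_spec
      set a := ((D.mem_cover x).resolve_left h).choose
      rw [← h2.2]
      simp only [mfld_simps]
      refine ⟨(D.homeoR a).map_source h2.1, ?_⟩
      rw [show (D.homeoR a).symm (D.inr a) = a from (D.homeoR a).left_inv h2.1]
      exact mem_chart_source H a
  chart_mem_atlas x := by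
    split_ifs with h
    · exact .inl ⟨_, rfl⟩
    · exact .inr ⟨_, rfl⟩

theorem homeoL_symm_homeoL (a a' : A) (p : A) (hp : p ∈ D.U) :
    ContMDiffAt I I ∞ ((D.homeoL a').symm ∘ D.homeoL a) p := by
  refine contMDiffAt_id.congr_of_eventuallyEq ?_
  filter_upwards [D.isOpen_U.mem_nhds hp] with q hq
  exact (D.homeoL a').left_inv hq

theorem homeoR_symm_homeoR (a a' : B) (p : B) (hp : p ∈ D.swap.U) :
    ContMDiffAt I I ∞ ((D.homeoR a').symm ∘ D.homeoR a) p := by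
  refine contMDiffAt_id.congr_of_eventuallyEq ?_
  filter_upwards [D.swap.isOpen_U.mem_nhds hp] with q hq
  exact (D.homeoR a').left_inv hq

theorem homeoR_symm_homeoL (a : A) (b : B) (p : A) (hp : p ∈ D.U)
    (hp' : D.homeoL a p ∈ (D.homeoR b).target) :
    ContMDiffAt I I ∞ ((D.homeoR b).symm ∘ D.homeoL a) p := by
  obtain ⟨q, hq, hqp⟩ : ∃ q ∈ D.swap.U, D.inr q = D.inl p :=
    ⟨_, (D.homeoR b).map_target hp', (D.homeoR b).right_inv hp'⟩
  obtain ⟨o, rfl, rfl⟩ := D.inr_eq_inl.1 hqp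
  have ho₁ : o ∉ D.K₁ := fun h => hp ⟨o, h, rfl⟩
  have ho₀ : o ∉ D.K₀ := fun h => hq ⟨o, h, rfl⟩
  have hf := D.f_loc o ho₀
  have hg := D.g_loc o ho₁
  have key : ContMDiffAt I I ∞ (D.g ∘ hf.localInverse) (D.f o) := by
    refine ContMDiffAt.comp (g := D.g) _ ?_ hf.localInverse_contMDiffAt
    rw [show hf.localInverse (D.f o) = o from hf.localInverse_left_inv hf.localInverse_mem_target]
    exact hg.contMDiffAt
  refine key.congr_of_eventuallyEq ?_
  have hcont : ContinuousAt hf.localInverse (D.f o) := hf.localInverse_contMDiffAt.continuousAt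
  have hN : D.K₀ᶜ ∈ 𝓝 (hf.localInverse (D.f o)) := by
    rw [show hf.localInverse (D.f o) = o from hf.localInverse_left_inv hf.localInverse_mem_target]
    exact D.closed₀.isOpen_compl.mem_nhds ho₀
  filter_upwards [hcont hN, hf.localInverse_open_source.mem_nhds hf.localInverse_mem_source]
    with z hz hz'
  have e1 : D.f (hf.localInverse z) = z := hf.localInverse_right_inv hz'
  have e2 : D.homeoL a z = D.homeoR b (D.g (hf.localInverse z)) := by
    conv_lhs => rw [← e1]
    exact D.glue_condition _
  rw [comp_apply, e2]
  refine (D.homeoR b).left_inv ?_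
  rintro ⟨o', ho', h⟩
  exact hz (D.g_inj h ▸ ho')

theorem homeoL_symm_homeoR (a : A) (b : B) (p : B) (hp : p ∈ D.swap.U)
    (hp' : D.homeoR b p ∈ (D.homeoL a).target) :
    ContMDiffAt I I ∞ ((D.homeoL a).symm ∘ D.homeoR b) p := by
  obtain ⟨q, hq, hqp⟩ : ∃ q ∈ D.U, D.inl q = D.inr p :=
    ⟨_, (D.homeoL a).map_target hp', (D.homeoL a).right_inv hp'⟩
  obtain ⟨o, rfl, rfl⟩ := D.inl_eq_inr.1 hqp
  have ho₀ : o ∉ D.K₀ := fun h => hp ⟨o, h, rfl⟩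
  have ho₁ : o ∉ D.K₁ := fun h => hq ⟨o, h, rfl⟩
  have hf := D.f_loc o ho₀
  have hg := D.g_loc o ho₁
  have key : ContMDiffAt I I ∞ (D.f ∘ hg.localInverse) (D.g o) := by
    refine ContMDiffAt.comp (g := D.f) _ ?_ hg.localInverse_contMDiffAt
    rw [show hg.localInverse (D.g o) = o from hg.localInverse_left_inv hg.localInverse_mem_target]
    exact hf.contMDiffAt
  refine key.congr_of_eventuallyEq ?_
  have hcont : ContinuousAt hg.localInverse (D.g o) := hg.localInverse_contMDiffAt.continuousAt
  have hN : D.K₁ᶜ ∈ 𝓝 (hg.localInverse (D.g o)) := by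
    rw [show hg.localInverse (D.g o) = o from hg.localInverse_left_inv hg.localInverse_mem_target]
    exact D.closed₁.isOpen_compl.mem_nhds ho₁
  filter_upwards [hcont hN, hg.localInverse_open_source.mem_nhds hg.localInverse_mem_source]
    with z hz hz'
  have e1 : D.g (hg.localInverse z) = z := hg.localInverse_right_inv hz'
  have e2 : D.homeoR b z = D.homeoL a (D.f (hg.localInverse z)) := by
    conv_lhs => rw [← e1]
    exact (D.glue_condition _).symm
  rw [comp_apply, e2]
  refine (D.homeoL a).left_inv ?_
  rintro ⟨o', ho', h⟩
  exact hz (D.f_inj h ▸ ho')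

variable [IsManifold I ∞ A] [IsManifold I ∞ B]

instance : IsManifold I ∞ D.Glue := by
  refine isManifold_of_transitions I _ ?_
  rintro e (⟨a, rfl⟩ | ⟨b, rfl⟩) e' (⟨a', rfl⟩ | ⟨b', rfl⟩) p hp
  · exact transition_contMDiffAt _ _ (fun x hx _ => D.homeoL_symm_homeoL a a' x hx) _ _ p hp
  · exact transition_contMDiffAt _ _ (fun x hx h => D.homeoR_symm_homeoL a b' x hx h) _ _ p hp
  · exact transition_contMDiffAt _ _ (fun x hx h => D.homeoL_symm_homeoR a' b x hx h) _ _ p hp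
  · exact transition_contMDiffAt _ _ (fun x hx _ => D.homeoR_symm_homeoR b b' x hx) _ _ p hp

theorem piece_isLocalDiffeomorphAt {P : Type} [TopologicalSpace P] [ChartedSpace H P]
    [IsManifold I ∞ P] (e : OpenPartialHomeomorph P D.Glue)
    (he : ∀ p, e.symm ≫ₕ chartAt H p ∈ atlas H D.Glue) (p : P) (hp : p ∈ e.source) :
    IsLocalDiffeomorphAt I I ∞ e p := by
  refine ⟨⟨e.toPartialEquiv, e.open_source, e.open_target, ?_, ?_⟩, hp, fun _ _ => rfl⟩
  · intro q hq
    refine ContMDiffAt.contMDiffWithinAt ?_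
    set c := e.symm ≫ₕ chartAt H q
    have hc := contMDiffOn_symm_of_mem_maximalAtlas (I := I) (n := ∞)
      (StructureGroupoid.subset_maximalAtlas _ (he q))
    have hq' : e q ∈ c.source := by simp [c, mfld_simps, hq]
    have h1 : ContMDiffAt I I ∞ (c.symm ∘ chartAt H q) q := by
      refine ContMDiffAt.comp (g := c.symm) q ?_ (contMDiffAt_of_mem_maximalAtlas
        (IsManifold.chart_mem_maximalAtlas q) (mem_chart_source H q))
      refine hc.contMDiffAt (c.open_target.mem_nhds ?_)
      have := c.map_source hq'
      simpa [c, e.left_inv hq] using this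
    refine h1.congr_of_eventuallyEq ?_
    filter_upwards [(chartAt H q).open_source.mem_nhds (mem_chart_source H q)] with z hz
    simp [c, (chartAt H q).left_inv hz]
  · intro x hx
    refine ContMDiffAt.contMDiffWithinAt ?_
    obtain ⟨q, hq, rfl⟩ : ∃ q ∈ e.source, e q = x := ⟨_, e.map_target hx, e.right_inv hx⟩
    set c := e.symm ≫ₕ chartAt H q
    have hq' : e q ∈ c.source := by simp [c, mfld_simps, hq]
    have hc : ContMDiffAt I I ∞ c (e q) := contMDiffAt_of_mem_maximalAtlas
      (StructureGroupoid.subset_maximalAtlas _ (he q)) hq'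
    have h1 : ContMDiffAt I I ∞ ((chartAt H q).symm ∘ c) (e q) := by
      refine ContMDiffAt.comp (g := (chartAt H q).symm) (e q) ?_ hc
      refine (contMDiffOn_chart_symm (I := I) (n := ∞)).contMDiffAt
        ((chartAt H q).open_target.mem_nhds ?_)
      simp [c, e.left_inv hq]
    refine h1.congr_of_eventuallyEq ?_
    filter_upwards [c.open_source.mem_nhds hq'] with z hz
    simp only [c, mfld_simps] at hz
    simp [c, (chartAt H q).left_inv hz.2]

theorem inl_isLocalDiffeomorphAt (a : A) (ha : a ∈ D.U) : IsLocalDiffeomorphAt I I ∞ D.inl a :=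
  D.piece_isLocalDiffeomorphAt (D.homeoL a) (fun p => .inl ⟨p, rfl⟩) a ha

theorem inr_isLocalDiffeomorphAt (b : B) (hb : b ∈ D.swap.U) : IsLocalDiffeomorphAt I I ∞ D.inr b :=
  D.piece_isLocalDiffeomorphAt (D.homeoR b) (fun p => .inr ⟨p, rfl⟩) b hb

end GlueDatum
end Gluing
end FieldTheory

namespace FieldTheory

open CategoryTheory Set Function Topology
open scoped Manifold ContDiff

noncomputable section

/-- The half-space `ℝᵐ × [0, ∞)`, on which manifolds of dimension `m + 1` with boundary are
modelled. -/
abbrev HalfSpace (m : ℕ) : Type := ModelProd (EuclideanSpace ℝ (Fin m)) (EuclideanHalfSpace 1)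

/-- The model with corners of manifolds of dimension `m + 1` with boundary. -/
abbrev mdl (m : ℕ) : ModelWithCorners ℝ
    (EuclideanSpace ℝ (Fin m) × EuclideanSpace ℝ (Fin 1)) (HalfSpace m) :=
  (𝓡 m).prod (𝓡∂ 1)

/-- A compact smooth manifold of dimension `m + 1`, maybe with boundary, maybe empty. -/
structure Mfd (m : ℕ) where
  carrier : Type
  [top : TopologicalSpace carrier]
  [charted : ChartedSpace (HalfSpace m) carrier]
  [smooth : IsManifold (mdl m) ∞ carrier]
  [compact : CompactSpace carrier]
  [hausdorff : T2Space carrier]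

instance (m : ℕ) : CoeSort (Mfd m) Type := ⟨Mfd.carrier⟩

attribute [instance] Mfd.top Mfd.charted Mfd.smooth Mfd.compact Mfd.hausdorff

variable {m : ℕ}

/-- The boundary of a manifold. -/
abbrev Mfd.bd (M : Mfd m) : Set M := (mdl m).boundary M

/-- A closed smooth manifold of dimension `m`, maybe empty. -/
structure ClosedMfd (m : ℕ) where
  carrier : Type
  [top : TopologicalSpace carrier]
  [charted : ChartedSpace (EuclideanSpace ℝ (Fin m)) carrier]
  [smooth : IsManifold (𝓡 m) ∞ carrier]
  [compact : CompactSpace carrier]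
  [hausdorff : T2Space carrier]

instance (m : ℕ) : CoeSort (ClosedMfd m) Type := ⟨ClosedMfd.carrier⟩

attribute [instance] ClosedMfd.top ClosedMfd.charted ClosedMfd.smooth ClosedMfd.compact
  ClosedMfd.hausdorff

/-- The cylinder `M × [0, 1]`. -/
def ClosedMfd.cyl (M : ClosedMfd m) : Mfd m where
  carrier := M × unitInterval

theorem ClosedMfd.mem_bd_cyl (M : ClosedMfd m) (p : M × unitInterval) :
    (p : M.cyl) ∈ M.cyl.bd ↔ p.2 = 0 ∨ p.2 = 1 := by
  have := (𝓡∂ 1).boundary_of_boundaryless_left (I := 𝓡 m) (M := M) (N := unitInterval)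
  have h2 := boundary_Icc (x := (0 : ℝ)) (y := 1)
  change p ∈ ((𝓡 m).prod (𝓡∂ 1)).boundary (M × unitInterval) ↔ _
  rw [this, h2]
  exact ⟨fun h => h.2, fun h => ⟨trivial, h⟩⟩

/-- A tame embedding of compact manifolds of the same dimension: an injective immersion `f` such
that, for some union `N` of connected components of `∂M₁`, `f` maps `N` to the interior of `M₂` and
`f⁻¹(∂M₂) = ∂M₁ - N`.  Necessarily `N` is the set of boundary points whose image is interior; its
complement in `∂M₁` is closed, so that `N` is a union of components as soon as `N` is closed.  That
`f` is a local diffeomorphism away from `N` is automatic by the inverse function theorem; at `N`,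
it is an immersion into the interior of `M₂`, and so extends to a small outer collar of `N`. -/
structure IsTame {M₁ M₂ : Mfd m} (f : M₁ → M₂) : Prop where
  smooth : ContMDiff (mdl m) (mdl m) ∞ f
  injective : Injective f
  immersion : ∀ x, Injective (mfderiv (mdl m) (mdl m) f x)
  closed : IsClosed {x | x ∈ M₁.bd ∧ f x ∉ M₂.bd}
  locDiffeo : ∀ x, ¬ (x ∈ M₁.bd ∧ f x ∉ M₂.bd) → IsLocalDiffeomorphAt (mdl m) (mdl m) ∞ f x

theorem IsTame.mem_bd {M₁ M₂ : Mfd m} {f : M₁ → M₂} (hf : IsTame f) {x : M₁} (hx : f x ∈ M₂.bd) :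
    x ∈ M₁.bd :=
  ((hf.locDiffeo x fun h => h.2 hx).isBoundaryPoint_iff (by simp)).2 hx

theorem IsTame.id (M : Mfd m) : IsTame (id : M → M) where
  smooth := contMDiff_id
  injective := injective_id
  immersion x := by rw [mfderiv_id]; exact injective_id
  closed := by
    convert isClosed_empty
    ext x; simp
  locDiffeo x _ := (Diffeomorph.refl (mdl m) M ∞).isLocalDiffeomorph x

theorem IsTame.comp {M₁ M₂ M₃ : Mfd m} {g : M₂ → M₃} {f : M₁ → M₂} (hg : IsTame g)
    (hf : IsTame f) : IsTame (g ∘ f) where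
  smooth := hg.smooth.comp hf.smooth
  injective := hg.injective.comp hf.injective
  immersion x := by
    rw [mfderiv_comp x ((hg.smooth.mdifferentiable (by simp)) _)
      ((hf.smooth.mdifferentiable (by simp)) _)]
    exact (hg.immersion _).comp (hf.immersion x)
  closed := by
    have : {x | x ∈ M₁.bd ∧ (g ∘ f) x ∉ M₃.bd} =
        {x | x ∈ M₁.bd ∧ f x ∉ M₂.bd} ∪ f ⁻¹' {y | y ∈ M₂.bd ∧ g y ∉ M₃.bd} := by
      ext x
      simp only [mem_ofPred_eq, mem_union, mem_preimage, comp_apply]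
      constructor
      · rintro ⟨h1, h2⟩
        by_cases h : f x ∈ M₂.bd
        · exact .inr ⟨h, h2⟩
        · exact .inl ⟨h1, h⟩
      · rintro (⟨h1, h2⟩ | ⟨h1, h2⟩)
        · exact ⟨h1, fun h => h2 (hg.mem_bd h)⟩
        · exact ⟨hf.mem_bd h1, h2⟩
    rw [this]
    exact hf.closed.union (hg.closed.preimage hf.smooth.continuous)
  locDiffeo x hx := by
    exact (hf.locDiffeo x fun h => hx ⟨h.1, fun h' => h.2 (hg.mem_bd h')⟩).comp (mdl m) _
      (hg.locDiffeo _ fun h => hx ⟨hf.mem_bd h.1, h.2⟩)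

theorem IsTame.of_diffeo {M₁ M₂ : Mfd m} (f : M₁ ≃ₘ⟮mdl m, mdl m⟯ M₂) : IsTame f where
  smooth := f.contMDiff
  injective := f.injective
  immersion x := (f.mfderivToContinuousLinearEquiv (by simp) x).injective
  closed := by
    convert isClosed_empty
    ext x
    simp only [mem_ofPred_eq, mem_empty_iff_false, iff_false, not_and, not_not]
    exact fun h => ((f.isLocalDiffeomorph x).isBoundaryPoint_iff (by simp)).1 h
  locDiffeo x _ := f.isLocalDiffeomorph x

/-- The tame embeddings between two manifolds. -/
@[ext] structure TEmb (M₁ M₂ : Mfd m) where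
  toFun : M₁ → M₂
  tame : IsTame toFun

instance (M₁ M₂ : Mfd m) : CoeFun (TEmb M₁ M₂) (fun _ => M₁ → M₂) := ⟨TEmb.toFun⟩

/-- The category of compact manifolds and tame embeddings, before passing to classes. -/
instance : Category (Mfd m) where
  Hom := TEmb
  id M := ⟨id, IsTame.id M⟩
  comp f g := ⟨g.toFun ∘ f.toFun, g.tame.comp f.tame⟩

@[ext] theorem temb_ext {M₁ M₂ : Mfd m} {f g : M₁ ⟶ M₂} (h : ∀ x, f.toFun x = g.toFun x) : f = g :=
  TEmb.ext (funext h)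
@[simp] theorem id_toFun (M : Mfd m) (x : M) : (𝟙 M : M ⟶ M).toFun x = x := rfl
@[simp] theorem comp_toFun {M₁ M₂ M₃ : Mfd m} (f : M₁ ⟶ M₂) (g : M₂ ⟶ M₃) (x : M₁) :
    (f ≫ g).toFun x = g.toFun (f.toFun x) := rfl

/-- A diffeomorphism as a tame embedding. -/
def ofDiffeo {M₁ M₂ : Mfd m} (f : M₁ ≃ₘ⟮mdl m, mdl m⟯ M₂) : M₁ ⟶ M₂ := ⟨f, IsTame.of_diffeo f⟩

@[simp] theorem ofDiffeo_toFun {M₁ M₂ : Mfd m} (f : M₁ ≃ₘ⟮mdl m, mdl m⟯ M₂) (x : M₁) :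
    (ofDiffeo f).toFun x = f x := rfl

/-- `h` is a smooth family `h_t`, `t ∈ [0, 1]`, of diffeomorphisms of `M` with `h_0 = id` which fix
the set `K` pointwise. -/
structure IsDiffeotopy {M : Mfd m} (K : Set M) (h : M × unitInterval → M) : Prop where
  smooth : ContMDiff ((mdl m).prod (𝓡∂ 1)) (mdl m) ∞ h
  diffeo : ∀ t, ∃ φ : M ≃ₘ⟮mdl m, mdl m⟯ M, ∀ x, h (x, t) = φ x
  zero : ∀ x, h (x, 0) = x
  fixed : ∀ x ∈ K, ∀ t, h (x, t) = x

/-- Two tame embeddings into `M₂` are equivalent if there is an ambient diffeotopy between them,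
fixing the boundary of `M₂`. -/
def Diffeotopic : HomRel (Mfd m) := fun _ M₂ f f' =>
  ∃ h : M₂ × unitInterval → M₂, IsDiffeotopy M₂.bd h ∧ ∀ x, h (f.toFun x, 1) = f'.toFun x

/-- The category of compact manifolds of dimension `m + 1` and classes of tame embeddings. -/
abbrev Emb (m : ℕ) := CategoryTheory.Quotient (Diffeotopic (m := m))

/-- A manifold as an object of the category of embeddings. -/
abbrev emb (M : Mfd m) : Emb m := (Quotient.functor Diffeotopic).obj M

/-- The class of a tame embedding. -/
abbrev cls {M₁ M₂ : Mfd m} (f : M₁ ⟶ M₂) : emb M₁ ⟶ emb M₂ := (Quotient.functor Diffeotopic).map f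

theorem cls_comp {M₁ M₂ M₃ : Mfd m} (f : M₁ ⟶ M₂) (g : M₂ ⟶ M₃) : cls (f ≫ g) = cls f ≫ cls g :=
  (Quotient.functor Diffeotopic).map_comp f g

theorem cls_id (M : Mfd m) : cls (𝟙 M) = 𝟙 (emb M) := (Quotient.functor Diffeotopic).map_id M

end

end FieldTheory

namespace FieldTheory

open CategoryTheory Set Function Topology
open scoped Manifold ContDiff

noncomputable section
variable {m : ℕ}

section LocalLemmas

variable {E H : Type} [NormedAddCommGroup E] [NormedSpace ℝ E] [TopologicalSpace H]
  {I : ModelWithCorners ℝ E H}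
  {E' H' : Type} [NormedAddCommGroup E'] [NormedSpace ℝ E'] [TopologicalSpace H']
  {I' : ModelWithCorners ℝ E' H'}
  {E'' H'' : Type} [NormedAddCommGroup E''] [NormedSpace ℝ E''] [TopologicalSpace H'']
  {I'' : ModelWithCorners ℝ E'' H''}
  {A X Y T : Type} [TopologicalSpace A] [ChartedSpace H A] [TopologicalSpace X] [ChartedSpace H X]
  [TopologicalSpace Y] [ChartedSpace H' Y] [TopologicalSpace T] [ChartedSpace H'' T]

theorem contMDiffAt_of_comp_localDiffeo {j : A → X} {a : A} (hj : IsLocalDiffeomorphAt I I ∞ j a)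
    {k : X → Y} (hk : ContMDiffAt I I' ∞ (k ∘ j) a) : ContMDiffAt I I' ∞ k (j a) := by
  have e : hj.localInverse (j a) = a := hj.localInverse_left_inv hj.localInverse_mem_target
  have h1 : ContMDiffAt I I' ∞ ((k ∘ j) ∘ hj.localInverse) (j a) :=
    ContMDiffAt.comp (g := k ∘ j) _ (by rw [e]; exact hk) hj.localInverse_contMDiffAt
  refine h1.congr_of_eventuallyEq ?_
  filter_upwards [hj.localInverse_open_source.mem_nhds hj.localInverse_mem_source] with z hz
  simp only [comp_apply, hj.localInverse_right_inv hz]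

theorem contMDiffAt_of_comp_localDiffeo_prod {j : A → X} {a : A}
    (hj : IsLocalDiffeomorphAt I I ∞ j a) {k : X × T → Y} {t : T}
    (hk : ContMDiffAt (I.prod I'') I' ∞ (fun p : A × T => k (j p.1, p.2)) (a, t)) :
    ContMDiffAt (I.prod I'') I' ∞ k (j a, t) := by
  have e : hj.localInverse (j a) = a := hj.localInverse_left_inv hj.localInverse_mem_target
  have h0 : ContMDiffAt (I.prod I'') (I.prod I'') ∞
      (fun p : X × T => (hj.localInverse p.1, p.2)) (j a, t) :=
    (ContMDiffAt.comp (g := hj.localInverse) (j a, t) hj.localInverse_contMDiffAt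
      contMDiffAt_fst).prodMk contMDiffAt_snd
  have h1 : ContMDiffAt (I.prod I'') I' ∞
      ((fun p : A × T => k (j p.1, p.2)) ∘ fun p : X × T => (hj.localInverse p.1, p.2)) (j a, t) :=
    ContMDiffAt.comp (g := fun p : A × T => k (j p.1, p.2)) _ (by rw [e]; exact hk) h0
  refine h1.congr_of_eventuallyEq ?_
  filter_upwards [(hj.localInverse_open_source.preimage continuous_fst).mem_nhds
    (show (j a, t) ∈ Prod.fst ⁻¹' _ from hj.localInverse_mem_source)] with z hz
  simp only [comp_apply, hj.localInverse_right_inv hz]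

theorem isLocalDiffeomorphAt_of_comp {j : A → X} {f : T → A} [ChartedSpace H T] {o : T}
    (hf : IsLocalDiffeomorphAt I I ∞ f o) (h : IsLocalDiffeomorphAt I I ∞ (j ∘ f) o) :
    IsLocalDiffeomorphAt I I ∞ j (f o) := by
  have e : hf.localInverse (f o) = o := hf.localInverse_left_inv hf.localInverse_mem_target
  have h1 : IsLocalDiffeomorphAt I I ∞ ((j ∘ f) ∘ hf.localInverse) (f o) :=
    IsLocalDiffeomorphAt.comp _ _ hf.localInverse_isLocalDiffeomorphAt (by rw [e]; exact h)
  obtain ⟨Φ, hΦ, hΦ'⟩ := h1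
  obtain ⟨Ψ, hΨ, hΨ'⟩ := hf.localInverse_isLocalDiffeomorphAt
  refine ⟨⟨Φ.toPartialEquiv.restr hf.localInverse.source, ?_, ?_, ?_, ?_⟩, ⟨hΦ, ?_⟩, ?_⟩
  · exact Φ.open_source.inter hf.localInverse_open_source
  · exact Φ.toOpenPartialHomeomorph.symm.isOpen_inter_preimage hf.localInverse_open_source
  · exact Φ.contMDiffOn.mono inter_subset_left
  · exact Φ.contMDiffOn_invFun.mono inter_subset_left
  · exact hf.localInverse_mem_source
  · intro z hz
    have := hΦ' hz.1
    simp only [comp_apply, hf.localInverse_right_inv hz.2] at this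
    exact this

end LocalLemmas

theorem isTame_inclusion {O A B X : Mfd m} {f : O → A} {g : O → B} {j : A → X} {j' : B → X}
    (K : Set O) (hK : IsClosed K) (hf : IsTame f) (hg : IsTame g)
    (comm : ∀ o, j (f o) = j' (g o)) (hj : Injective j)
    (hjl : ∀ a, a ∉ f '' K → IsLocalDiffeomorphAt (mdl m) (mdl m) ∞ j a)
    (hj' : ∀ o ∈ K, IsLocalDiffeomorphAt (mdl m) (mdl m) ∞ j' (g o))
    (hfl : ∀ o ∈ K, IsLocalDiffeomorphAt (mdl m) (mdl m) ∞ f o)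
    (hfb : ∀ o ∈ K, f o ∈ A.bd) : IsTame j := by
  have comm' : j ∘ f = j' ∘ g := funext comm
  have hjf : ∀ o ∈ K, ContMDiffAt (mdl m) (mdl m) ∞ (j ∘ f) o := by
    intro o ho
    rw [comm']
    exact (hj' o ho).contMDiffAt.comp o (hg.smooth o)
  have hsm : ContMDiff (mdl m) (mdl m) ∞ j := by
    intro a
    by_cases ha : a ∈ f '' K
    · obtain ⟨o, ho, rfl⟩ := ha
      exact contMDiffAt_of_comp_localDiffeo (hfl o ho) (hjf o ho)
    · exact (hjl a ha).contMDiffAt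
  have hbd : ∀ a, a ∈ A.bd ∧ j a ∉ X.bd ↔ a ∈ f '' (K ∩ {o | o ∈ O.bd ∧ g o ∉ B.bd}) := by
    intro a
    constructor
    · rintro ⟨h1, h2⟩
      by_cases ha : a ∈ f '' K
      · obtain ⟨o, ho, rfl⟩ := ha
        refine ⟨o, ⟨ho, hf.mem_bd h1, fun h => h2 ?_⟩, rfl⟩
        rw [comm]
        exact ((hj' o ho).isBoundaryPoint_iff (by simp)).1 h
      · exact absurd (((hjl a ha).isBoundaryPoint_iff (by simp)).1 h1) h2
    · rintro ⟨o, ⟨ho, h1, h2⟩, rfl⟩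
      refine ⟨hfb o ho, fun h => h2 ?_⟩
      rw [comm] at h
      exact ((hj' o ho).isBoundaryPoint_iff (by simp)).2 h
  refine ⟨hsm, hj, ?_, ?_, ?_⟩
  · intro a
    by_cases ha : a ∈ f '' K
    · obtain ⟨o, ho, rfl⟩ := ha
      have h1 := mfderiv_comp o (hsm.mdifferentiable (by simp) (f o))
        (hf.smooth.mdifferentiable (by simp) o)
      have h2 := mfderiv_comp o ((hj' o ho).mdifferentiableAt (by simp))
        (hg.smooth.mdifferentiable (by simp) o)
      rw [comm', h2] at h1
      have h3 : Injective (mfderiv (mdl m) (mdl m) j' (g o)) :=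
        ((hj' o ho).mfderivToContinuousLinearEquiv (by simp)).injective
      have h4 : Surjective (mfderiv (mdl m) (mdl m) f o) :=
        ((hfl o ho).mfderivToContinuousLinearEquiv (by simp)).surjective
      have h5 : Injective (mfderiv (mdl m) (mdl m) j (f o) ∘ mfderiv (mdl m) (mdl m) f o) := by
        have := h3.comp (hg.immersion o)
        intro v w hvw
        apply this
        have e1 := DFunLike.congr_fun h1 v
        have e2 := DFunLike.congr_fun h1 w
        exact e1.trans (Eq.trans hvw e2.symm)
      intro v w hvw
      obtain ⟨v, rfl⟩ := h4 v
      obtain ⟨w, rfl⟩ := h4 w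
      rw [h5 hvw]
    · exact ((hjl a ha).mfderivToContinuousLinearEquiv (by simp)).injective
  · have : {x | x ∈ A.bd ∧ j x ∉ X.bd} = f '' (K ∩ {o | o ∈ O.bd ∧ g o ∉ B.bd}) := Set.ext hbd
    rw [this]
    exact ((hK.inter hg.closed).isCompact.image hf.smooth.continuous).isClosed
  · intro a ha
    by_cases ha' : a ∈ f '' K
    · obtain ⟨o, ho, rfl⟩ := ha'
      refine isLocalDiffeomorphAt_of_comp (hfl o ho) ?_
      rw [comm']
      refine IsLocalDiffeomorphAt.comp _ _ (hg.locDiffeo o fun h => ha ((hbd _).2 ?_)) (hj' o ho)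
      exact ⟨o, ⟨ho, h⟩, rfl⟩
    · exact hjl a ha'

/-- The point `(x, t)` of the cylinder. -/
def ClosedMfd.pt {M : ClosedMfd m} (x : M) (t : unitInterval) : M.cyl := (x, t)

open ClosedMfd (pt)

theorem cyl_cases {M : ClosedMfd m} (p : M.cyl) : ∃ x t, p = pt x t := ⟨p.1, p.2, rfl⟩
theorem pt_inj {M : ClosedMfd m} {x y : M} {t u : unitInterval} :
    pt x t = pt y u ↔ x = y ∧ t = u := Prod.ext_iff
theorem pt_mem_bd {M : ClosedMfd m} {x : M} {t : unitInterval} :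
    pt x t ∈ M.cyl.bd ↔ t = 0 ∨ t = 1 := M.mem_bd_cyl (x, t)

/-- A bordism from `M₁` to `M₂`: a compact manifold `W` with embedded cylinders, or collars,
`i₁ : M₁ × [0, 1] → W` and `i₂ : M₂ × [0, 1] → W`, such that the boundary of `W` is the disjoint
union of `M₁ × {0}` and `M₂ × {1}`. The two collars are disjoint, except that a fibre of the first
may coincide with a fibre of the second; in this way, `M × [0, 1]` with both collars equal to the
identity, that is, `M` itself up to thickening, is a bordism from `M` to `M`. -/
structure Bordism (M₁ M₂ : ClosedMfd m) where
  W : Mfd m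
  i₁ : M₁.cyl ⟶ W
  i₂ : M₂.cyl ⟶ W
  boundary : ∀ w, w ∈ W.bd ↔ (∃ x, i₁.toFun (pt x 0) = w) ∨ ∃ y, i₂.toFun (pt y 1) = w
  meet : ∀ x y t u, i₁.toFun (pt x t) = i₂.toFun (pt y u) →
    t = u ∧ ∀ v, i₁.toFun (pt x v) = i₂.toFun (pt y v)

namespace Bordism

variable {M₁ M₂ M₃ M₄ : ClosedMfd m}

/-- `M` as a bordism from `M` to itself. -/
abbrev one (M : ClosedMfd m) : Bordism M M where
  W := M.cyl
  i₁ := 𝟙 _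
  i₂ := 𝟙 _
  boundary w := by
    obtain ⟨x, t, rfl⟩ := cyl_cases w
    simp only [id_toFun, pt_mem_bd, pt_inj]
    constructor
    · rintro (rfl | rfl)
      · exact .inl ⟨x, rfl, rfl⟩
      · exact .inr ⟨x, rfl, rfl⟩
    · rintro (⟨_, -, h⟩ | ⟨_, -, h⟩)
      · exact .inl h.symm
      · exact .inr h.symm
  meet x y t u h := by
    simp only [id_toFun, pt_inj] at h ⊢
    exact ⟨h.2, fun v => ⟨h.1, trivial⟩⟩

/-- The data for gluing `W` and `W'` along their collars `M₂ × [0, 1]`. -/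
def datum (W : Bordism M₁ M₂) (W' : Bordism M₂ M₃) : GlueDatum (mdl m) M₂.cyl W.W W'.W where
  f := W.i₂.toFun
  g := W'.i₁.toFun
  K₀ := {p | p.2 = 0}
  K₁ := {p | p.2 = 1}
  closed₀ := isClosed_eq continuous_snd continuous_const
  closed₁ := isClosed_eq continuous_snd continuous_const
  disj o h h' := zero_ne_one (h.symm.trans h')
  f_inj := W.i₂.tame.injective
  g_inj := W'.i₁.tame.injective
  f_cont := W.i₂.tame.smooth.continuous
  g_cont := W'.i₁.tame.smooth.continuous
  f_loc o ho := by
    refine W.i₂.tame.locDiffeo o fun h => h.2 ?_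
    obtain ⟨x, t, rfl⟩ := cyl_cases o
    obtain rfl := (pt_mem_bd.1 h.1).resolve_left ho
    exact (W.boundary _).2 (.inr ⟨x, rfl⟩)
  g_loc o ho := by
    refine W'.i₁.tame.locDiffeo o fun h => h.2 ?_
    obtain ⟨x, t, rfl⟩ := cyl_cases o
    obtain rfl := (pt_mem_bd.1 h.1).resolve_right ho
    exact (W'.boundary _).2 (.inl ⟨x, rfl⟩)

variable (W : Bordism M₁ M₂) (W' : Bordism M₂ M₃)

/-- The manifold obtained by gluing `W` and `W'` along their collars `M₂ × [0, 1]`. -/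
def glue : Mfd m where
  carrier := (datum W W').Glue

/-- The inclusion of `W` in the glued manifold. -/
def jL : W.W ⟶ glue W W' where
  toFun := (datum W W').inl
  tame := by
    refine isTame_inclusion (X := glue W W') (j' := (datum W W').inr) (datum W W').K₁
      (datum W W').closed₁ W.i₂.tame W'.i₁.tame (datum W W').glue_condition
      (datum W W').inl_injective (fun a ha => (datum W W').inl_isLocalDiffeomorphAt a ha) ?_ ?_ ?_
    · intro o ho
      refine (datum W W').inr_isLocalDiffeomorphAt _ ?_
      rintro ⟨o', ho', h⟩
      obtain rfl := (datum W W').g_inj h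
      exact (datum W W').disj _ ho' ho
    · intro o ho
      exact (datum W W').f_loc o fun h => (datum W W').disj _ h ho
    · intro o ho
      obtain ⟨x, t, rfl⟩ := cyl_cases o
      obtain rfl : t = 1 := ho
      exact (W.boundary _).2 (.inr ⟨x, rfl⟩)

/-- The inclusion of `W'` in the glued manifold. -/
def jR : W'.W ⟶ glue W W' where
  toFun := (datum W W').inr
  tame := by
    refine isTame_inclusion (X := glue W W') (j' := (datum W W').inl) (datum W W').K₀
      (datum W W').closed₀ W'.i₁.tame W.i₂.tame (fun o => ((datum W W').glue_condition o).symm)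
      (datum W W').inr_injective (fun a ha => (datum W W').inr_isLocalDiffeomorphAt a ha) ?_ ?_ ?_
    · intro o ho
      refine (datum W W').inl_isLocalDiffeomorphAt _ ?_
      rintro ⟨o', ho', h⟩
      obtain rfl := (datum W W').f_inj h
      exact (datum W W').disj _ ho ho'
    · intro o ho
      exact (datum W W').g_loc o fun h => (datum W W').disj _ ho h
    · intro o ho
      obtain ⟨x, t, rfl⟩ := cyl_cases o
      obtain rfl : t = 0 := ho
      exact (W'.boundary _).2 (.inl ⟨x, rfl⟩)

theorem glue_comm : W.i₂ ≫ jL W W' = W'.i₁ ≫ jR W W' := temb_ext (datum W W').glue_condition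

theorem glue_comm_apply (o : M₂.cyl) :
    (jL W W').toFun (W.i₂.toFun o) = (jR W W').toFun (W'.i₁.toFun o) :=
  (datum W W').glue_condition o

theorem glue_cover (x : glue W W') :
    (∃ a, (jL W W').toFun a = x) ∨ ∃ b, (jR W W').toFun b = x := (datum W W').exists_rep x

theorem glue_inter {a : W.W} {b : W'.W} (h : (jL W W').toFun a = (jR W W').toFun b) :
    ∃ o, W.i₂.toFun o = a ∧ W'.i₁.toFun o = b := (datum W W').inl_eq_inr.1 h

/-- The composition of bordisms: gluing along `M₂`. -/
abbrev comp : Bordism M₁ M₃ where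
  W := glue W W'
  i₁ := W.i₁ ≫ jL W W'
  i₂ := W'.i₂ ≫ jR W W'
  boundary := by
    have hU : ∀ x, W.i₁.toFun (pt x 0) ∈ (datum W W').U := by
      rintro x ⟨o, ho, h⟩
      obtain ⟨y, t, rfl⟩ := cyl_cases o
      obtain rfl : t = 1 := ho
      exact zero_ne_one (W.meet _ _ _ _ h.symm).1
    have hV : ∀ x, W'.i₂.toFun (pt x 1) ∈ (datum W W').swap.U := by
      rintro x ⟨o, ho, h⟩
      obtain ⟨y, t, rfl⟩ := cyl_cases o
      obtain rfl : t = 0 := ho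
      exact zero_ne_one (W'.meet _ _ _ _ h).1
    intro w
    constructor
    · intro hw
      rcases (datum W W').mem_cover w with ⟨a, ha, rfl⟩ | ⟨b, hb, rfl⟩
      · have h1 : a ∈ W.W.bd := (((datum W W').inl_isLocalDiffeomorphAt a ha).isBoundaryPoint_iff
          (by simp)).2 hw
        rcases (W.boundary _).1 h1 with ⟨x, rfl⟩ | ⟨y, rfl⟩
        · exact .inl ⟨x, rfl⟩
        · exact absurd ⟨pt y 1, rfl, rfl⟩ ha
      · have h1 : b ∈ W'.W.bd := (((datum W W').inr_isLocalDiffeomorphAt b hb).isBoundaryPoint_iff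
          (by simp)).2 hw
        rcases (W'.boundary _).1 h1 with ⟨x, rfl⟩ | ⟨y, rfl⟩
        · exact absurd ⟨pt x 0, rfl, rfl⟩ hb
        · exact .inr ⟨y, rfl⟩
    · rintro (⟨x, rfl⟩ | ⟨y, rfl⟩)
      · exact (((datum W W').inl_isLocalDiffeomorphAt _ (hU x)).isBoundaryPoint_iff (by simp)).1
          ((W.boundary _).2 (.inl ⟨x, rfl⟩))
      · exact (((datum W W').inr_isLocalDiffeomorphAt _ (hV y)).isBoundaryPoint_iff (by simp)).1
          ((W'.boundary _).2 (.inr ⟨y, rfl⟩))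
  meet x y t u h := by
    obtain ⟨o, h1, h2⟩ := glue_inter W W' h
    obtain ⟨z, s, rfl⟩ := cyl_cases o
    obtain ⟨rfl, h3⟩ := W.meet _ _ _ _ h1.symm
    obtain ⟨rfl, h4⟩ := W'.meet _ _ _ _ h2
    refine ⟨rfl, fun v => ?_⟩
    simp only [comp_toFun]
    rw [h3, ← h4, glue_comm_apply]

end Bordism

end

end FieldTheory

namespace FieldTheory

open CategoryTheory Set Function Topology
open scoped Manifold ContDiff

noncomputable section
variable {m : ℕ}

open ClosedMfd (pt)

/-- A diffeomorphism between bordisms which preserves the collars. -/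
structure CollarDiffeo {M₁ M₂ : ClosedMfd m} (W V : Bordism M₁ M₂) where
  diffeo : W.W ≃ₘ⟮mdl m, mdl m⟯ V.W
  collar₁ : ∀ p, diffeo (W.i₁.toFun p) = V.i₁.toFun p
  collar₂ : ∀ p, diffeo (W.i₂.toFun p) = V.i₂.toFun p

namespace Bordism

variable {M₁ M₂ M₃ M₄ M₅ : ClosedMfd m}

theorem glue_contMDiff (W : Bordism M₁ M₂) (W' : Bordism M₂ M₃) {Y : Mfd m} {k : glue W W' → Y}
    (h : ContMDiff (mdl m) (mdl m) ∞ fun a => k ((jL W W').toFun a))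
    (h' : ContMDiff (mdl m) (mdl m) ∞ fun b => k ((jR W W').toFun b)) :
    ContMDiff (mdl m) (mdl m) ∞ k := by
  intro x
  rcases (datum W W').mem_cover x with ⟨a, ha, rfl⟩ | ⟨b, hb, rfl⟩
  · exact contMDiffAt_of_comp_localDiffeo ((datum W W').inl_isLocalDiffeomorphAt a ha) (h a)
  · exact contMDiffAt_of_comp_localDiffeo ((datum W W').inr_isLocalDiffeomorphAt b hb) (h' b)

theorem glue_contMDiff_prod (W : Bordism M₁ M₂) (W' : Bordism M₂ M₃) {Y : Mfd m}
    {k : glue W W' × unitInterval → Y}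
    (h : ContMDiff ((mdl m).prod (𝓡∂ 1)) (mdl m) ∞
      fun p : W.W × unitInterval => k ((jL W W').toFun p.1, p.2))
    (h' : ContMDiff ((mdl m).prod (𝓡∂ 1)) (mdl m) ∞
      fun p : W'.W × unitInterval => k ((jR W W').toFun p.1, p.2)) :
    ContMDiff ((mdl m).prod (𝓡∂ 1)) (mdl m) ∞ k := by
  rintro ⟨x, t⟩
  rcases (datum W W').mem_cover x with ⟨a, ha, rfl⟩ | ⟨b, hb, rfl⟩
  · exact contMDiffAt_of_comp_localDiffeo_prod
      ((datum W W').inl_isLocalDiffeomorphAt a ha) (h (a, t))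
  · exact contMDiffAt_of_comp_localDiffeo_prod
      ((datum W W').inr_isLocalDiffeomorphAt b hb) (h' (b, t))

/-- The map out of the glued manifold defined by compatible maps. -/
def desc (W : Bordism M₁ M₂) (W' : Bordism M₂ M₃) {Y : Type*} (u : W.W → Y) (v : W'.W → Y)
    (h : ∀ o, u (W.i₂.toFun o) = v (W'.i₁.toFun o)) : glue W W' → Y := (datum W W').desc u v h

@[simp] theorem desc_jL (W : Bordism M₁ M₂) (W' : Bordism M₂ M₃) {Y : Type*} (u : W.W → Y)
    (v : W'.W → Y) (h) (a : W.W) : desc W W' u v h ((jL W W').toFun a) = u a := rfl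
@[simp] theorem desc_jR (W : Bordism M₁ M₂) (W' : Bordism M₂ M₃) {Y : Type*} (u : W.W → Y)
    (v : W'.W → Y) (h) (a : W'.W) : desc W W' u v h ((jR W W').toFun a) = v a := rfl

theorem glue_ind (W : Bordism M₁ M₂) (W' : Bordism M₂ M₃) {p : glue W W' → Prop}
    (h : ∀ a, p ((jL W W').toFun a)) (h' : ∀ b, p ((jR W W').toFun b)) (x : glue W W') : p x := by
  rcases glue_cover W W' x with ⟨a, rfl⟩ | ⟨b, rfl⟩
  · exact h a
  · exact h' b

end Bordism

open Bordism

namespace CollarDiffeo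

variable {M₁ M₂ M₃ M₄ M₅ : ClosedMfd m}

@[ext] theorem ext' {W V : Bordism M₁ M₂} {φ ψ : CollarDiffeo W V}
    (h : ∀ x, φ.diffeo x = ψ.diffeo x) : φ = ψ := by
  obtain ⟨φ, _, _⟩ := φ
  obtain ⟨ψ, _, _⟩ := ψ
  obtain rfl : φ = ψ := Diffeomorph.ext h
  rfl

/-- The identity. -/
def refl (W : Bordism M₁ M₂) : CollarDiffeo W W := ⟨.refl _ _ _, fun _ => rfl, fun _ => rfl⟩

/-- Composition. -/
def trans {W V U : Bordism M₁ M₂} (φ : CollarDiffeo W V) (ψ : CollarDiffeo V U) :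
    CollarDiffeo W U where
  diffeo := φ.diffeo.trans ψ.diffeo
  collar₁ p := by simp [φ.collar₁, ψ.collar₁]
  collar₂ p := by simp [φ.collar₂, ψ.collar₂]

/-- The inverse. -/
def symm {W V : Bordism M₁ M₂} (φ : CollarDiffeo W V) : CollarDiffeo V W where
  diffeo := φ.diffeo.symm
  collar₁ p := by rw [← φ.collar₁, φ.diffeo.symm_apply_apply]
  collar₂ p := by rw [← φ.collar₂, φ.diffeo.symm_apply_apply]

@[simp] theorem refl_apply (W : Bordism M₁ M₂) (x : W.W) : (refl W).diffeo x = x := rfl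
@[simp] theorem trans_apply {W V U : Bordism M₁ M₂} (φ : CollarDiffeo W V) (ψ : CollarDiffeo V U)
    (x : W.W) : (φ.trans ψ).diffeo x = ψ.diffeo (φ.diffeo x) := rfl

/-- The diffeomorphism of glued bordisms which is `φ` on the first piece and `ψ` on the second. -/
def glue {W V : Bordism M₁ M₂} {W' V' : Bordism M₂ M₃} (φ : CollarDiffeo W V)
    (ψ : CollarDiffeo W' V') : CollarDiffeo (W.comp W') (V.comp V') where
  diffeo :=
    { toFun := Bordism.desc W W' (fun a => (jL V V').toFun (φ.diffeo a))
        (fun b => (jR V V').toFun (ψ.diffeo b)) fun o => by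
          rw [φ.collar₂, ψ.collar₁, glue_comm_apply]
      invFun := Bordism.desc V V' (fun a => (jL W W').toFun (φ.diffeo.symm a))
        (fun b => (jR W W').toFun (ψ.diffeo.symm b)) fun o => by
          rw [← φ.collar₂, ← ψ.collar₁, φ.diffeo.symm_apply_apply, ψ.diffeo.symm_apply_apply,
            glue_comm_apply]
      left_inv := glue_ind _ _
        (fun a => congrArg (jL W W').toFun (φ.diffeo.symm_apply_apply a))
        (fun b => congrArg (jR W W').toFun (ψ.diffeo.symm_apply_apply b))
      right_inv := glue_ind _ _
        (fun a => congrArg (jL V V').toFun (φ.diffeo.apply_symm_apply a))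
        (fun b => congrArg (jR V V').toFun (ψ.diffeo.apply_symm_apply b))
      contMDiff_toFun := glue_contMDiff W W' ((jL V V').tame.smooth.comp φ.diffeo.contMDiff)
        ((jR V V').tame.smooth.comp ψ.diffeo.contMDiff)
      contMDiff_invFun := glue_contMDiff V V' ((jL W W').tame.smooth.comp φ.diffeo.symm.contMDiff)
        ((jR W W').tame.smooth.comp ψ.diffeo.symm.contMDiff) }
  collar₁ p := congrArg (jL V V').toFun (φ.collar₁ p)
  collar₂ p := congrArg (jR V V').toFun (ψ.collar₂ p)

@[simp] theorem glue_jL {W V : Bordism M₁ M₂} {W' V' : Bordism M₂ M₃} (φ : CollarDiffeo W V)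
    (ψ : CollarDiffeo W' V') (a : W.W) :
    (φ.glue ψ).diffeo ((jL W W').toFun a) = (jL V V').toFun (φ.diffeo a) := rfl
@[simp] theorem glue_jR {W V : Bordism M₁ M₂} {W' V' : Bordism M₂ M₃} (φ : CollarDiffeo W V)
    (ψ : CollarDiffeo W' V') (b : W'.W) :
    (φ.glue ψ).diffeo ((jR W W').toFun b) = (jR V V').toFun (ψ.diffeo b) := rfl

/-- The rebracketing of a triple gluing. -/
def assoc (A : Bordism M₁ M₂) (B : Bordism M₂ M₃) (C : Bordism M₃ M₄) :
    CollarDiffeo ((A.comp B).comp C) (A.comp (B.comp C)) where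
  diffeo :=
    { toFun := Bordism.desc (A.comp B) C
        (Bordism.desc A B (jL A (B.comp C)).toFun
          (fun b => (jR A (B.comp C)).toFun ((jL B C).toFun b)) fun o =>
            glue_comm_apply A (B.comp C) o)
        (fun c => (jR A (B.comp C)).toFun ((jR B C).toFun c)) fun o =>
          congrArg (jR A (B.comp C)).toFun (glue_comm_apply B C o)
      invFun := Bordism.desc A (B.comp C)
        (fun a => (jL (A.comp B) C).toFun ((jL A B).toFun a))
        (Bordism.desc B C (fun b => (jL (A.comp B) C).toFun ((jR A B).toFun b))
          (jR (A.comp B) C).toFun fun o => glue_comm_apply (A.comp B) C o) fun o =>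
          congrArg (jL (A.comp B) C).toFun (glue_comm_apply A B o)
      left_inv := glue_ind _ _ (glue_ind _ _ (fun _ => rfl) fun _ => rfl) fun _ => rfl
      right_inv := glue_ind _ _ (fun _ => rfl) (glue_ind _ _ (fun _ => rfl) fun _ => rfl)
      contMDiff_toFun := glue_contMDiff (A.comp B) C
        (glue_contMDiff A B (jL A (B.comp C)).tame.smooth
          ((jR A (B.comp C)).tame.smooth.comp (jL B C).tame.smooth))
        ((jR A (B.comp C)).tame.smooth.comp (jR B C).tame.smooth)
      contMDiff_invFun := glue_contMDiff A (B.comp C)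
        ((jL (A.comp B) C).tame.smooth.comp (jL A B).tame.smooth)
        (glue_contMDiff B C ((jL (A.comp B) C).tame.smooth.comp (jR A B).tame.smooth)
          (jR (A.comp B) C).tame.smooth) }
  collar₁ _ := rfl
  collar₂ _ := rfl

/-- Gluing a cylinder on the left does not change a bordism. -/
def leftUnit (W : Bordism M₁ M₂) : CollarDiffeo ((one M₁).comp W) W where
  diffeo :=
    { toFun := Bordism.desc (one M₁) W W.i₁.toFun id fun _ => rfl
      invFun := (jR (one M₁) W).toFun
      left_inv := glue_ind _ _ (fun o => (glue_comm_apply (one M₁) W o).symm) fun _ => rfl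
      right_inv _ := rfl
      contMDiff_toFun := glue_contMDiff (one M₁) W W.i₁.tame.smooth contMDiff_id
      contMDiff_invFun := (jR (one M₁) W).tame.smooth }
  collar₁ _ := rfl
  collar₂ _ := rfl

/-- Gluing a cylinder on the right does not change a bordism. -/
def rightUnit (W : Bordism M₁ M₂) : CollarDiffeo (W.comp (one M₂)) W where
  diffeo :=
    { toFun := Bordism.desc W (one M₂) id W.i₂.toFun fun _ => rfl
      invFun := (jL W (one M₂)).toFun
      left_inv := glue_ind _ _ (fun _ => rfl) fun o => glue_comm_apply W (one M₂) o
      right_inv _ := rfl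
      contMDiff_toFun := glue_contMDiff W (one M₂) contMDiff_id W.i₂.tame.smooth
      contMDiff_invFun := (jL W (one M₂)).tame.smooth }
  collar₁ _ := rfl
  collar₂ _ := rfl

/-- Two diffeomorphisms of bordisms are equivalent if there is an ambient diffeotopy between them
which fixes the collars. -/
def Isotopic {W V : Bordism M₁ M₂} (φ φ' : CollarDiffeo W V) : Prop :=
  ∃ h : V.W × unitInterval → V.W, IsDiffeotopy (range V.i₁.toFun ∪ range V.i₂.toFun) h ∧
    ∀ x, h (φ.diffeo x, 1) = φ'.diffeo x

theorem Isotopic.trans_left {W V U : Bordism M₁ M₂} {φ φ' : CollarDiffeo W V} (h : Isotopic φ φ')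
    (ψ : CollarDiffeo V U) : Isotopic (φ.trans ψ) (φ'.trans ψ) := by
  obtain ⟨h, hh, h1⟩ := h
  refine ⟨fun p => ψ.diffeo (h (ψ.diffeo.symm p.1, p.2)), ⟨?_, fun t => ?_, fun x => ?_, ?_⟩, ?_⟩
  · exact ψ.diffeo.contMDiff.comp (hh.smooth.comp
      ((ψ.diffeo.symm.contMDiff.comp contMDiff_fst).prodMk contMDiff_snd))
  · obtain ⟨χ, hχ⟩ := hh.diffeo t
    exact ⟨(ψ.diffeo.symm.trans χ).trans ψ.diffeo, fun x => by simp [hχ]⟩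
  · simp [hh.zero]
  · rintro x (⟨p, rfl⟩ | ⟨p, rfl⟩) t
    · simp only [← ψ.collar₁, Diffeomorph.symm_apply_apply]
      rw [hh.fixed _ (.inl ⟨p, rfl⟩)]
    · simp only [← ψ.collar₂, Diffeomorph.symm_apply_apply]
      rw [hh.fixed _ (.inr ⟨p, rfl⟩)]
  · intro x; simp [h1]

theorem Isotopic.trans_right {W V U : Bordism M₁ M₂} {ψ ψ' : CollarDiffeo V U} (h : Isotopic ψ ψ')
    (φ : CollarDiffeo W V) : Isotopic (φ.trans ψ) (φ.trans ψ') := by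
  obtain ⟨h, hh, h1⟩ := h
  exact ⟨h, hh, fun x => h1 _⟩

theorem Isotopic.glue_left {W V : Bordism M₁ M₂} {W' V' : Bordism M₂ M₃} {φ φ' : CollarDiffeo W V}
    (h : Isotopic φ φ') (ψ : CollarDiffeo W' V') : Isotopic (φ.glue ψ) (φ'.glue ψ) := by
  obtain ⟨h, hh, h1⟩ := h
  have key : ∀ t o, (jL V V').toFun (h (V.i₂.toFun o, t)) = (jR V V').toFun (V'.i₁.toFun o) := by
    intro t o
    rw [hh.fixed _ (.inr ⟨o, rfl⟩), glue_comm_apply]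
  refine ⟨fun p => Bordism.desc V V' (fun a => (jL V V').toFun (h (a, p.2)))
    (fun b => (jR V V').toFun b) (key p.2) p.1, ⟨?_, fun t => ?_, ?_, ?_⟩, ?_⟩
  · exact glue_contMDiff_prod V V' ((jL V V').tame.smooth.comp hh.smooth)
      ((jR V V').tame.smooth.comp contMDiff_fst)
  · obtain ⟨χ, hχ⟩ := hh.diffeo t
    refine ⟨(glue (V' := V') (W' := V') (V := V) (W := V) ⟨χ, fun p => ?_, fun p => ?_⟩
      (refl V')).diffeo, glue_ind V V' (fun a => ?_) (fun b => rfl)⟩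
    · rw [← hχ, hh.fixed _ (.inl ⟨p, rfl⟩)]
    · rw [← hχ, hh.fixed _ (.inr ⟨p, rfl⟩)]
    · exact congrArg (jL V V').toFun (hχ a)
  · exact glue_ind V V' (fun a => congrArg (jL V V').toFun (hh.zero a)) fun b => rfl
  · rintro _ (⟨p, rfl⟩ | ⟨p, rfl⟩) t
    · exact congrArg (jL V V').toFun (hh.fixed _ (.inl ⟨p, rfl⟩) t)
    · rfl
  · exact glue_ind W W' (fun a => congrArg (jL V V').toFun (h1 a)) fun b => rfl

theorem Isotopic.glue_right {W V : Bordism M₁ M₂} {W' V' : Bordism M₂ M₃} {ψ ψ' : CollarDiffeo W' V'}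
    (h : Isotopic ψ ψ') (φ : CollarDiffeo W V) : Isotopic (φ.glue ψ) (φ.glue ψ') := by
  obtain ⟨h, hh, h1⟩ := h
  have key : ∀ t o, (jL V V').toFun (V.i₂.toFun o) = (jR V V').toFun (h (V'.i₁.toFun o, t)) := by
    intro t o
    rw [hh.fixed _ (.inl ⟨o, rfl⟩), glue_comm_apply]
  refine ⟨fun p => Bordism.desc V V' (fun a => (jL V V').toFun a)
    (fun b => (jR V V').toFun (h (b, p.2))) (key p.2) p.1, ⟨?_, fun t => ?_, ?_, ?_⟩, ?_⟩
  · exact glue_contMDiff_prod V V' ((jL V V').tame.smooth.comp contMDiff_fst)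
      ((jR V V').tame.smooth.comp hh.smooth)
  · obtain ⟨χ, hχ⟩ := hh.diffeo t
    refine ⟨(glue (V' := V') (W' := V') (V := V) (W := V) (refl V)
      ⟨χ, fun p => ?_, fun p => ?_⟩).diffeo, glue_ind V V' (fun a => rfl) (fun b => ?_)⟩
    · rw [← hχ, hh.fixed _ (.inl ⟨p, rfl⟩)]
    · rw [← hχ, hh.fixed _ (.inr ⟨p, rfl⟩)]
    · exact congrArg (jR V V').toFun (hχ b)
  · exact glue_ind V V' (fun a => rfl) fun b => congrArg (jR V V').toFun (hh.zero b)
  · rintro _ (⟨p, rfl⟩ | ⟨p, rfl⟩) t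
    · rfl
    · exact congrArg (jR V V').toFun (hh.fixed _ (.inr ⟨p, rfl⟩) t)
  · exact glue_ind W W' (fun a => rfl) fun b => congrArg (jR V V').toFun (h1 b)

end CollarDiffeo

/-- A class of diffeomorphisms of bordisms, up to diffeotopies fixing the collars. -/
def DClass {M₁ M₂ : ClosedMfd m} (W V : Bordism M₁ M₂) : Type :=
  Quot (CollarDiffeo.Isotopic (W := W) (V := V))

namespace DClass

variable {M₁ M₂ M₃ M₄ M₅ : ClosedMfd m}

/-- The class of a diffeomorphism. -/
def mk {W V : Bordism M₁ M₂} (φ : CollarDiffeo W V) : DClass W V := Quot.mk _ φ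

theorem ind {W V : Bordism M₁ M₂} {p : DClass W V → Prop} (h : ∀ φ, p (mk φ)) (x : DClass W V) :
    p x := Quot.ind h x

/-- Composition of classes. -/
def trans {W V U : Bordism M₁ M₂} : DClass W V → DClass V U → DClass W U :=
  Quot.map₂ CollarDiffeo.trans (fun φ _ _ h => h.trans_right φ) (fun _ _ ψ h => h.trans_left ψ)

/-- Gluing of classes. -/
def glue {W V : Bordism M₁ M₂} {W' V' : Bordism M₂ M₃} :
    DClass W V → DClass W' V' → DClass (W.comp W') (V.comp V') :=
  Quot.map₂ CollarDiffeo.glue (fun φ _ _ h => h.glue_right φ) (fun _ _ ψ h => h.glue_left ψ)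

/-- The class of embeddings given by a class of diffeomorphisms of bordisms. -/
def toEmb {W V : Bordism M₁ M₂} : DClass W V → (emb W.W ⟶ emb V.W) :=
  Quot.lift (fun φ => cls (ofDiffeo φ.diffeo)) (by
    rintro φ φ' ⟨h, hh, h1⟩
    refine CategoryTheory.Quotient.sound _ ⟨h, ⟨hh.smooth, hh.diffeo, hh.zero, fun x hx => hh.fixed x ?_⟩, h1⟩
    rcases (V.boundary x).1 hx with ⟨y, rfl⟩ | ⟨y, rfl⟩
    · exact .inl ⟨_, rfl⟩
    · exact .inr ⟨_, rfl⟩)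

@[simp] theorem trans_mk {W V U : Bordism M₁ M₂} (φ : CollarDiffeo W V) (ψ : CollarDiffeo V U) :
    (mk φ).trans (mk ψ) = mk (φ.trans ψ) := rfl
@[simp] theorem glue_mk {W V : Bordism M₁ M₂} {W' V' : Bordism M₂ M₃} (φ : CollarDiffeo W V)
    (ψ : CollarDiffeo W' V') : (mk φ).glue (mk ψ) = mk (φ.glue ψ) := rfl
@[simp] theorem toEmb_mk {W V : Bordism M₁ M₂} (φ : CollarDiffeo W V) :
    (mk φ).toEmb = cls (ofDiffeo φ.diffeo) := rfl

theorem toEmb_trans {W V U : Bordism M₁ M₂} (φ : DClass W V) (ψ : DClass V U) :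
    (φ.trans ψ).toEmb = φ.toEmb ≫ ψ.toEmb := by
  induction φ using ind with | h φ
  induction ψ using ind with | h ψ
  exact (Quotient.functor Diffeotopic).map_comp (ofDiffeo φ.diffeo) (ofDiffeo ψ.diffeo)

theorem jL_toEmb_glue {W V : Bordism M₁ M₂} {W' V' : Bordism M₂ M₃} (φ : DClass W V)
    (ψ : DClass W' V') : cls (jL W W') ≫ (φ.glue ψ).toEmb = φ.toEmb ≫ cls (jL V V') := by
  induction φ using ind with | h φ
  induction ψ using ind with | h ψ
  exact ((Quotient.functor Diffeotopic).map_comp _ _).symm.trans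
    ((Quotient.functor Diffeotopic).map_comp (ofDiffeo φ.diffeo) (jL V V'))

theorem jR_toEmb_glue {W V : Bordism M₁ M₂} {W' V' : Bordism M₂ M₃} (φ : DClass W V)
    (ψ : DClass W' V') : cls (jR W W') ≫ (φ.glue ψ).toEmb = ψ.toEmb ≫ cls (jR V V') := by
  induction φ using ind with | h φ
  induction ψ using ind with | h ψ
  exact ((Quotient.functor Diffeotopic).map_comp _ _).symm.trans
    ((Quotient.functor Diffeotopic).map_comp (ofDiffeo ψ.diffeo) (jR V V'))

theorem i₁_toEmb {W V : Bordism M₁ M₂} (φ : DClass W V) : cls W.i₁ ≫ φ.toEmb = cls V.i₁ := by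
  induction φ using ind with | h φ
  exact ((Quotient.functor Diffeotopic).map_comp _ _).symm.trans
    (congrArg cls (temb_ext φ.collar₁))

theorem i₂_toEmb {W V : Bordism M₁ M₂} (φ : DClass W V) : cls W.i₂ ≫ φ.toEmb = cls V.i₂ := by
  induction φ using ind with | h φ
  exact ((Quotient.functor Diffeotopic).map_comp _ _).symm.trans
    (congrArg cls (temb_ext φ.collar₂))

end DClass

end

end FieldTheory

namespace FieldTheory

open CategoryTheory Set Function Topology
open scoped Manifold ContDiff

noncomputable section
variable {m : ℕ}

open Bordism

instance (M₁ M₂ : ClosedMfd m) : Category (Bordism M₁ M₂) where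
  Hom := DClass
  id W := .mk (.refl W)
  comp := DClass.trans
  id_comp φ := by induction φ using DClass.ind with | h φ; rfl
  comp_id φ := by induction φ using DClass.ind with | h φ; rfl
  assoc φ ψ χ := by
    induction φ using DClass.ind with | h φ
    induction ψ using DClass.ind with | h ψ
    induction χ using DClass.ind with | h χ
    rfl

/-- The class of a diffeomorphism of bordisms as an isomorphism. -/
def DClass.iso {M₁ M₂ : ClosedMfd m} {W V : Bordism M₁ M₂} (φ : CollarDiffeo W V) : W ≅ V where
  hom := .mk φ
  inv := .mk φ.symm
  hom_inv_id := congrArg DClass.mk (CollarDiffeo.ext' fun x => φ.diffeo.symm_apply_apply x)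
  inv_hom_id := congrArg DClass.mk (CollarDiffeo.ext' fun x => φ.diffeo.apply_symm_apply x)

/-- The bicategory of closed manifolds, bordisms and classes of diffeomorphisms of bordisms. -/
instance : Bicategory (ClosedMfd m) where
  Hom := Bordism
  id := Bordism.one
  comp := Bordism.comp
  whiskerLeft W _ _ ψ := DClass.glue (𝟙 W) ψ
  whiskerRight φ W := DClass.glue φ (𝟙 W)
  associator A B C := DClass.iso (CollarDiffeo.assoc A B C)
  leftUnitor W := DClass.iso (CollarDiffeo.leftUnit W)
  rightUnitor W := DClass.iso (CollarDiffeo.rightUnit W)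
  whiskerLeft_id W V := congrArg DClass.mk (CollarDiffeo.ext' (glue_ind W V
    (fun _ => rfl) fun _ => rfl))
  whiskerLeft_comp A B B' B'' φ ψ := by
    induction φ using DClass.ind with | h φ
    induction ψ using DClass.ind with | h ψ
    exact congrArg DClass.mk (CollarDiffeo.ext' (glue_ind A B (fun _ => rfl) fun _ => rfl))
  id_whiskerLeft {a b} A B φ := by
    induction φ using DClass.ind with | h φ
    exact congrArg DClass.mk (CollarDiffeo.ext' (glue_ind (one a) A
      (fun o => (glue_comm_apply (one a) B o).trans
        (congrArg (jR (one a) B).toFun (φ.collar₁ o).symm)) fun _ => rfl))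
  comp_whiskerLeft A B C C' φ := by
    induction φ using DClass.ind with | h φ
    exact congrArg DClass.mk (CollarDiffeo.ext' (glue_ind (A.comp B) C
      (glue_ind A B (fun _ => rfl) fun _ => rfl) fun _ => rfl))
  id_whiskerRight A B := congrArg DClass.mk (CollarDiffeo.ext' (glue_ind A B
    (fun _ => rfl) fun _ => rfl))
  comp_whiskerRight {_ _ _ A _ _} φ ψ B := by
    induction φ using DClass.ind with | h φ
    induction ψ using DClass.ind with | h ψ
    exact congrArg DClass.mk (CollarDiffeo.ext' (glue_ind A B (fun _ => rfl) fun _ => rfl))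
  whiskerRight_id {_ b A B} φ := by
    induction φ using DClass.ind with | h φ
    exact congrArg DClass.mk (CollarDiffeo.ext' (glue_ind A (one b) (fun _ => rfl)
      (fun o => (glue_comm_apply B (one b) o).symm.trans
        (congrArg (jL B (one b)).toFun (φ.collar₂ o).symm))))
  whiskerRight_comp {_ _ _ _ A A'} φ B C := by
    induction φ using DClass.ind with | h φ
    exact congrArg DClass.mk (CollarDiffeo.ext' (glue_ind A (B.comp C)
      (fun _ => rfl) (glue_ind B C (fun _ => rfl) fun _ => rfl)))
  whisker_assoc A _ _ φ C := by
    induction φ using DClass.ind with | h φ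
    exact congrArg DClass.mk (CollarDiffeo.ext' (glue_ind (A.comp _) C
      (glue_ind A _ (fun _ => rfl) fun _ => rfl) fun _ => rfl))
  whisker_exchange {_ _ _ A _ B _} φ ψ := by
    induction φ using DClass.ind with | h φ
    induction ψ using DClass.ind with | h ψ
    exact congrArg DClass.mk (CollarDiffeo.ext' (glue_ind A B (fun _ => rfl) fun _ => rfl))
  pentagon A B C D := congrArg DClass.mk (CollarDiffeo.ext'
    (glue_ind ((A.comp B).comp C) D (glue_ind (A.comp B) C
      (glue_ind A B (fun _ => rfl) fun _ => rfl) fun _ => rfl) fun _ => rfl))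
  triangle {_ b _} A B := congrArg DClass.mk (CollarDiffeo.ext'
    (glue_ind (A.comp (one b)) B (glue_ind A (one b) (fun _ => rfl)
      (fun o => (glue_comm_apply A B o).symm)) fun _ => rfl))

end

end FieldTheory

namespace FieldTheory

open CategoryTheory Set Function Topology

noncomputable section

universe v u

variable {m : ℕ}

/-- The category of sections of `S` over `W`. -/
abbrev Sec (S : (Emb m)ᵒᵖ ⥤ Cat.{v, u}) (W : Mfd m) : Type u := S.obj (.op (emb W))

/-- The restriction of sections along (the class of) an embedding. -/
abbrev res (S : (Emb m)ᵒᵖ ⥤ Cat.{v, u}) {W V : Mfd m} (e : emb W ⟶ emb V) : Sec S V ⥤ Sec S W :=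
  (S.map e.op).toFunctor

theorem res_id (S : (Emb m)ᵒᵖ ⥤ Cat.{v, u}) (W : Mfd m) : res S (𝟙 (emb W)) = 𝟭 _ :=
  congrArg Cat.Hom.toFunctor (S.map_id (.op (emb W)))

theorem res_comp (S : (Emb m)ᵒᵖ ⥤ Cat.{v, u}) {W V U : Mfd m} (e : emb W ⟶ emb V)
    (f : emb V ⟶ emb U) : res S (e ≫ f) = res S f ⋙ res S e :=
  congrArg Cat.Hom.toFunctor (S.map_comp f.op e.op)

variable (S : (Emb m)ᵒᵖ ⥤ Cat.{v, u})

theorem res_id_obj {W : Mfd m} (s : Sec S W) : (res S (𝟙 (emb W))).obj s = s := by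
  rw [res_id]; rfl
theorem res_comp_obj {W V U : Mfd m} (e : emb W ⟶ emb V) (f : emb V ⟶ emb U) (s : Sec S U) :
    (res S (e ≫ f)).obj s = (res S e).obj ((res S f).obj s) := by
  rw [res_comp]; rfl
theorem res_cls_comp_obj {W V U : Mfd m} (e : W ⟶ V) (f : V ⟶ U) (s : Sec S U) :
    (res S (cls (e ≫ f))).obj s = (res S (cls e)).obj ((res S (cls f)).obj s) := by
  rw [cls, Functor.map_comp]; exact res_comp_obj S _ _ s
theorem res_cls_id_obj {W : Mfd m} (s : Sec S W) : (res S (cls (𝟙 W))).obj s = s := by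
  rw [cls, CategoryTheory.Functor.map_id]; exact res_id_obj S s

/-- A finite cover of a manifold `X` by embedded compact manifolds `W a` of the same dimension,
which intersect in embedded manifolds `ov a b`. -/
structure Cover (X : Mfd m) (ι : Type) where
  W : ι → Mfd m
  inc : ∀ a, W a ⟶ X
  ov : ι → ι → Mfd m
  p : ∀ a b, ov a b ⟶ W a
  q : ∀ a b, ov a b ⟶ W b
  comm : ∀ a b, p a b ≫ inc a = q a b ≫ inc b
  surj : ∀ x, ∃ a w, (inc a).toFun w = x
  inter : ∀ a b w w', (inc a).toFun w = (inc b).toFun w' →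
    ∃ o, (p a b).toFun o = w ∧ (q a b).toFun o = w'

/-- The sheaf condition: objects and morphisms of `S X` are given by compatible families of objects
and morphisms over a finite cover of `X`. -/
structure IsSheaf : Prop where
  glueObj : ∀ {X : Mfd m} {ι : Type} [Finite ι] (U : Cover X ι) (s : ∀ a, Sec S (U.W a)),
    (∀ a b, (res S (cls (U.p a b))).obj (s a) = (res S (cls (U.q a b))).obj (s b)) →
    ∃! x : Sec S X, ∀ a, (res S (cls (U.inc a))).obj x = s a
  glueHom : ∀ {X : Mfd m} {ι : Type} [Finite ι] (U : Cover X ι) (x y : Sec S X)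
    (φ : ∀ a, (res S (cls (U.inc a))).obj x ⟶ (res S (cls (U.inc a))).obj y),
    (∀ a b, (res S (cls (U.p a b))).map (φ a) ≍ (res S (cls (U.q a b))).map (φ b)) →
    ∃! ψ : x ⟶ y, ∀ a, (res S (cls (U.inc a))).map ψ = φ a

/-- A manifold with a section of `S`. -/
structure EEmb where
  mfd : Mfd m
  sec : Sec S mfd

variable {S}

namespace EEmb

/-- A morphism of manifolds with sections: a class of embeddings together with a morphism from the
section on the source to the restriction of the section on the target. -/
structure Hom (X Y : EEmb S) where
  base : emb X.mfd ⟶ emb Y.mfd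
  fib : X.sec ⟶ (res S base).obj Y.sec

theorem Hom.ext' {X Y : EEmb S} {f g : Hom X Y} (h : f.base = g.base)
    (h' : f.fib ≫ eqToHom (by rw [h]) = g.fib) : f = g := by
  obtain ⟨f, a⟩ := f
  obtain ⟨g, b⟩ := g
  obtain rfl : f = g := h
  obtain rfl : a = b := by simpa using h'
  rfl

theorem res_map_comp {W V U : Mfd m} (e : emb W ⟶ emb V) (f : emb V ⟶ emb U) {s t : Sec S U}
    (φ : s ⟶ t) : (res S (e ≫ f)).map φ = eqToHom (res_comp_obj S e f s) ≫
      (res S e).map ((res S f).map φ) ≫ eqToHom (res_comp_obj S e f t).symm :=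
  Functor.congr_hom (res_comp S e f) φ

theorem res_map_id {W : Mfd m} {s t : Sec S W} (φ : s ⟶ t) : (res S (𝟙 (emb W))).map φ =
    eqToHom (res_id_obj S s) ≫ φ ≫ eqToHom (res_id_obj S t).symm :=
  Functor.congr_hom (res_id S W) φ

theorem res_map_eq {W V : Mfd m} {e f : emb W ⟶ emb V} (h : e = f) {s t : Sec S V} (φ : s ⟶ t) :
    (res S e).map φ = eqToHom (by rw [h]) ≫ (res S f).map φ ≫ eqToHom (by rw [h]) := by
  subst h; simp

instance : Category (EEmb S) where
  Hom := Hom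
  id X := ⟨𝟙 _, eqToHom (res_id_obj S X.sec).symm⟩
  comp {X Y Z} f g := ⟨f.base ≫ g.base,
    f.fib ≫ (res S f.base).map g.fib ≫ eqToHom (res_comp_obj S f.base g.base Z.sec).symm⟩
  id_comp f := Hom.ext' (Category.id_comp _) (by simp [res_map_id])
  comp_id f := Hom.ext' (Category.comp_id _) (by simp [eqToHom_map])
  assoc f g h := Hom.ext' (Category.assoc _ _ _) (by simp [res_map_comp, eqToHom_map])

@[simp] theorem id_base (X : EEmb S) : (𝟙 X : X ⟶ X).base = 𝟙 _ := rfl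
@[simp] theorem comp_base {X Y Z : EEmb S} (f : X ⟶ Y) (g : Y ⟶ Z) :
    (f ≫ g).base = f.base ≫ g.base := rfl
theorem comp_fib {X Y Z : EEmb S} (f : X ⟶ Y) (g : Y ⟶ Z) :
    (f ≫ g).fib = f.fib ≫ (res S f.base).map g.fib ≫
      eqToHom (res_comp_obj S f.base g.base Z.sec).symm := rfl

/-- The morphism given by an embedding such that the section on the source is the restriction of the
section on the target. -/
def lift {X Y : EEmb S} (e : emb X.mfd ⟶ emb Y.mfd) (h : (res S e).obj Y.sec = X.sec) : X ⟶ Y :=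
  ⟨e, eqToHom h.symm⟩

@[simp] theorem lift_base {X Y : EEmb S} (e : emb X.mfd ⟶ emb Y.mfd)
    (h : (res S e).obj Y.sec = X.sec) : (lift e h).base = e := rfl

theorem lift_comp {X Y Z : EEmb S} (e : emb X.mfd ⟶ emb Y.mfd) (h : (res S e).obj Y.sec = X.sec)
    (f : emb Y.mfd ⟶ emb Z.mfd) (h' : (res S f).obj Z.sec = Y.sec) :
    lift e h ≫ lift f h' = lift (e ≫ f) (by rw [res_comp_obj, h', h]) :=
  Hom.ext' rfl (by simpa [comp_fib, lift, eqToHom_map] using eqToHom_trans _ _)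

theorem lift_congr {X Y : EEmb S} {e e' : emb X.mfd ⟶ emb Y.mfd}
    (h : (res S e).obj Y.sec = X.sec) (he : e = e') {h' : (res S e').obj Y.sec = X.sec} :
    lift e h = lift e' h' := by
  subst he; rfl

theorem lift_id (X : EEmb S) (h) : lift (𝟙 (emb X.mfd)) h = 𝟙 X := rfl

theorem lift_comp_fib {X Y Z : EEmb S} (e : emb X.mfd ⟶ emb Y.mfd)
    (h : (res S e).obj Y.sec = X.sec) (f : Y ⟶ Z) :
    (lift e h ≫ f).fib = eqToHom h.symm ≫ (res S e).map f.fib ≫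
      eqToHom (res_comp_obj S e f.base Z.sec).symm := rfl

theorem comp_lift_fib {X Y Z : EEmb S} (f : X ⟶ Y) (e : emb Y.mfd ⟶ emb Z.mfd)
    (h : (res S e).obj Z.sec = Y.sec) :
    (f ≫ lift e h).fib = f.fib ≫ eqToHom (by rw [← h]; exact (res_comp_obj S f.base e Z.sec).symm)
      := by
  simp [comp_fib, lift, eqToHom_map]

theorem fib_congr {X Y : EEmb S} {f g : X ⟶ Y} (h : f = g) :
    f.fib = g.fib ≫ eqToHom (by rw [h]) := by
  subst h; simp

end EEmb

theorem eqToHom_conj_injective {C : Type*} [Category C] {a a' b b' : C} (h : a' = a) (h' : b = b')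
    {f g : a ⟶ b} (e : eqToHom h ≫ f ≫ eqToHom h' = eqToHom h ≫ g ≫ eqToHom h') : f = g := by
  subst h h'; simpa using e

theorem eqToHom_conj_heq {C : Type*} [Category C] {a a' b b' : C} (h : a' = a) (h' : b = b')
    (f : a ⟶ b) : eqToHom h ≫ f ≫ eqToHom h' ≍ f := by
  subst h h'; simp

theorem comp_eqToHom_heq' {C : Type*} [Category C] {a b c : C} (f : a ⟶ b) (e : b = c) :
    f ≫ eqToHom e ≍ f := by
  subst e; simp

theorem eqToHom_comp_heq' {C : Type*} [Category C] {a b c : C} (f : b ⟶ c) (e : a = b) :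
    eqToHom e ≫ f ≍ f := by
  subst e; simp

namespace IsSheaf

theorem hom_ext (hS : IsSheaf S) {X Y : EEmb S} {ι : Type} [Finite ι] (U : Cover X.mfd ι) {f g : X ⟶ Y}
    (hb : f.base = g.base)
    (h : ∀ a, EEmb.lift (X := ⟨U.W a, (res S (cls (U.inc a))).obj X.sec⟩) (cls (U.inc a)) rfl ≫ f =
      EEmb.lift (cls (U.inc a)) rfl ≫ g) : f = g := by
  obtain ⟨f, φ⟩ := f
  obtain ⟨g, ψ⟩ := g
  obtain rfl : f = g := hb
  congr 1
  refine (hS.glueHom U X.sec _ (fun a => (res S (cls (U.inc a))).map φ) ?_).unique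
    (fun a => rfl) (fun a => ?_)
  · intro a b
    have h1 := EEmb.res_map_comp (cls (U.p a b)) (cls (U.inc a)) φ
    have h2 := EEmb.res_map_comp (cls (U.q a b)) (cls (U.inc b)) φ
    have h3 : cls (U.p a b) ≫ cls (U.inc a) = cls (U.q a b) ≫ cls (U.inc b) := by
      simp only [cls, ← Functor.map_comp, U.comm]
    refine (eqToHom_conj_heq (res_comp_obj S _ _ _) (res_comp_obj S _ _ _).symm _).symm.trans ?_
    refine HEq.trans ?_ (eqToHom_conj_heq (res_comp_obj S _ _ _) (res_comp_obj S _ _ _).symm _)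
    rw [← h1, ← h2, h3]
  · have h1 := EEmb.fib_congr (h a)
    rw [EEmb.lift_comp_fib, EEmb.lift_comp_fib] at h1
    refine eq_of_heq ((eqToHom_conj_heq rfl (res_comp_obj S _ _ _).symm _).symm.trans ?_)
    exact (comp_eqToHom_heq' _ _).symm.trans ((heq_of_eq h1.symm).trans
      (eqToHom_conj_heq rfl (res_comp_obj S _ _ _).symm _))

theorem exists_hom (hS : IsSheaf S) {X Y : EEmb S} {ι : Type} [Finite ι] (U : Cover X.mfd ι)
    (e : emb X.mfd ⟶ emb Y.mfd)
    (k : ∀ a, (⟨U.W a, (res S (cls (U.inc a))).obj X.sec⟩ : EEmb S) ⟶ Y)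
    (hk : ∀ a, (k a).base = cls (U.inc a) ≫ e)
    (h : ∀ a b, EEmb.lift
      (X := ⟨U.ov a b, (res S (cls (U.p a b))).obj ((res S (cls (U.inc a))).obj X.sec)⟩)
      (cls (U.p a b)) rfl ≫ k a = EEmb.lift (cls (U.q a b)) (by
        simp only [← res_cls_comp_obj, U.comm]) ≫ k b) :
    ∃ f : X ⟶ Y, f.base = e ∧ ∀ a, EEmb.lift (cls (U.inc a)) rfl ≫ f = k a := by
  let φ : ∀ a, (res S (cls (U.inc a))).obj X.sec ⟶
      (res S (cls (U.inc a))).obj ((res S e).obj Y.sec) := fun a =>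
    (k a).fib ≫ eqToHom (by rw [hk]; exact res_comp_obj S _ _ _)
  obtain ⟨ψ, hψ, -⟩ := hS.glueHom U X.sec ((res S e).obj Y.sec) φ (by
    intro a b
    have h1 := EEmb.fib_congr (h a b)
    rw [EEmb.lift_comp_fib, EEmb.lift_comp_fib] at h1
    simp only [φ, Functor.map_comp, eqToHom_map]
    refine (comp_eqToHom_heq' _ _).trans (HEq.trans ?_ (comp_eqToHom_heq' _ _).symm)
    refine (eqToHom_conj_heq rfl (res_comp_obj S _ _ _).symm _).symm.trans ?_
    rw [h1]
    exact (comp_eqToHom_heq' _ _).trans ((eqToHom_comp_heq' _ _).trans (comp_eqToHom_heq' _ _)))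
  refine ⟨⟨e, ψ⟩, rfl, fun a => EEmb.Hom.ext' (hk a).symm ?_⟩
  rw [EEmb.lift_comp_fib]
  simp only [hψ, φ]
  refine eq_of_heq ((comp_eqToHom_heq' _ _).trans ((eqToHom_comp_heq' _ _).trans ?_))
  exact (comp_eqToHom_heq' _ _).trans (comp_eqToHom_heq' _ _)

end IsSheaf

/-- Four embeddings which present `X` as the union of `A` and `B` with intersection `O`. -/
structure IsCover₂ {O A B X : Mfd m} (f : O ⟶ A) (g : O ⟶ B) (j : A ⟶ X) (j' : B ⟶ X) : Prop where
  comm : f ≫ j = g ≫ j'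
  surj : ∀ x, (∃ a, j.toFun a = x) ∨ ∃ b, j'.toFun b = x
  inter : ∀ a b, j.toFun a = j'.toFun b → ∃ o, f.toFun o = a ∧ g.toFun o = b

namespace IsCover₂

variable {O A B X : Mfd m} {f : O ⟶ A} {g : O ⟶ B} {j : A ⟶ X} {j' : B ⟶ X}

/-- A cover by two manifolds. -/
def cover (h : IsCover₂ f g j j') : Cover X Bool where
  W a := bif a then A else B
  inc a := match a with | true => j | false => j'
  ov a b := bif a then (bif b then A else O) else (bif b then O else B)
  p a b := match a, b with
    | true, true => 𝟙 A | true, false => f | false, true => g | false, false => 𝟙 B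
  q a b := match a, b with
    | true, true => 𝟙 A | true, false => g | false, true => f | false, false => 𝟙 B
  comm a b := match a, b with
    | true, true => rfl | true, false => h.comm | false, true => h.comm.symm | false, false => rfl
  surj x := by
    rcases h.surj x with ⟨a, e⟩ | ⟨b, e⟩
    · exact ⟨true, a, e⟩
    · exact ⟨false, b, e⟩
  inter a b w w' e := match a, b, w, w', e with
    | true, true, w, w', e => ⟨w, rfl, j.tame.injective e⟩
    | true, false, w, w', e => h.inter w w' e
    | false, true, w, w', e =>
      let ⟨o, h1, h2⟩ := h.inter w' w e.symm
      ⟨o, h2, h1⟩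
    | false, false, w, w', e => ⟨w, rfl, j'.tame.injective e⟩

theorem exists_sec (h : IsCover₂ f g j j') (hS : IsSheaf S) (s : Sec S A) (t : Sec S B) (e : (res S (cls f)).obj s = (res S (cls g)).obj t) :
    ∃! x : Sec S X, (res S (cls j)).obj x = s ∧ (res S (cls j')).obj x = t := by
  obtain ⟨x, hx, hu⟩ := hS.glueObj h.cover
    (fun a => match a with | true => s | false => t) (by
      rintro (_ | _) (_ | _)
      · rfl
      · exact e.symm
      · exact e
      · rfl)
  refine ⟨x, ⟨hx true, hx false⟩, fun y hy => hu y ?_⟩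
  rintro (_ | _)
  · exact hy.2
  · exact hy.1

theorem sec_ext (h : IsCover₂ f g j j') (hS : IsSheaf S) {x y : Sec S X} (h₁ : (res S (cls j)).obj x = (res S (cls j)).obj y)
    (h₂ : (res S (cls j')).obj x = (res S (cls j')).obj y) : x = y := by
  refine (h.exists_sec hS ((res S (cls j)).obj x) ((res S (cls j')).obj x) ?_).unique
    ⟨rfl, rfl⟩ ⟨h₁.symm, h₂.symm⟩
  rw [← res_cls_comp_obj, h.comm, res_cls_comp_obj]

variable {s : Sec S A} {t : Sec S B} {x : Sec S X} {Y : EEmb S}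

theorem hom_ext (h : IsCover₂ f g j j') (hS : IsSheaf S) (hs : (res S (cls j)).obj x = s) (ht : (res S (cls j')).obj x = t)
    {k l : (⟨X, x⟩ : EEmb S) ⟶ Y} (hb : k.base = l.base)
    (e : EEmb.lift (X := ⟨A, s⟩) (cls j) hs ≫ k = EEmb.lift (cls j) hs ≫ l)
    (e' : EEmb.lift (X := ⟨B, t⟩) (cls j') ht ≫ k = EEmb.lift (cls j') ht ≫ l) : k = l := by
  subst hs ht
  refine hS.hom_ext h.cover hb ?_
  rintro (_ | _)
  · exact e'
  · exact e

theorem exists_hom (h : IsCover₂ f g j j') (hS : IsSheaf S) (hs : (res S (cls j)).obj x = s) (ht : (res S (cls j')).obj x = t)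
    (b : emb X ⟶ emb Y.mfd) (k : (⟨A, s⟩ : EEmb S) ⟶ Y) (l : (⟨B, t⟩ : EEmb S) ⟶ Y)
    (hk : k.base = cls j ≫ b) (hl : l.base = cls j' ≫ b) {o : Sec S O}
    (ho : (res S (cls f)).obj s = o) (ho' : (res S (cls g)).obj t = o)
    (e : EEmb.lift (X := ⟨O, o⟩) (cls f) ho ≫ k = EEmb.lift (cls g) ho' ≫ l) :
    ∃ d : (⟨X, x⟩ : EEmb S) ⟶ Y, d.base = b ∧ EEmb.lift (cls j) hs ≫ d = k ∧
      EEmb.lift (cls j') ht ≫ d = l := by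
  subst hs ht
  obtain ⟨d, hd, hd'⟩ := hS.exists_hom (X := ⟨X, x⟩) h.cover b
    (fun a => match a with | true => k | false => l)
    (by rintro (_ | _)
        · exact hl
        · exact hk)
    (by rintro (_ | _) (_ | _)
        · rfl
        · subst ho'; exact e.symm
        · subst ho; exact e
        · rfl)
  exact ⟨d, hd, hd' true, hd' false⟩

end IsCover₂

end

end FieldTheory

namespace FieldTheory

open CategoryTheory Set Function Topology

noncomputable section

universe v u

variable {m : ℕ} {S : (Emb m)ᵒᵖ ⥤ Cat.{v, u}}

open Bordism EEmb

theorem Bordism.isCover₂ {M₁ M₂ M₃ : ClosedMfd m} (A : Bordism M₁ M₂) (B : Bordism M₂ M₃) :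
    IsCover₂ A.i₂ B.i₁ (jL A B) (jR A B) where
  comm := glue_comm A B
  surj := glue_cover A B
  inter _ _ := glue_inter A B

/-- The objects of the bicategory of bordisms over a sheaf `S`: closed manifolds `M` with a section
of `S` on (the collar) `M × [0, 1]`. -/
structure Bd (hS : IsSheaf S) where
  mfd : ClosedMfd m
  sec : Sec S mfd.cyl

namespace Bd

variable {hS : IsSheaf S}

/-- A closed manifold as an object of the category of embeddings over `S`. -/
abbrev obj (X : Bd hS) : EEmb S := ⟨X.mfd.cyl, X.sec⟩

/-- The `1`-cells: bordisms with a section of `S` which restricts to the given ones on the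
collars. -/
structure Hom (X Y : Bd hS) where
  bord : Bordism X.mfd Y.mfd
  sec : Sec S bord.W
  sec₁ : (res S (cls bord.i₁)).obj sec = X.sec
  sec₂ : (res S (cls bord.i₂)).obj sec = Y.sec

/-- A bordism as an object of the category of embeddings over `S`. -/
abbrev Hom.obj {X Y : Bd hS} (W : Hom X Y) : EEmb S := ⟨W.bord.W, W.sec⟩

/-- The inclusion of the incoming boundary. -/
def Hom.in₁ {X Y : Bd hS} (W : Hom X Y) : X.obj ⟶ W.obj := lift (cls W.bord.i₁) W.sec₁
/-- The inclusion of the outgoing boundary. -/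
def Hom.in₂ {X Y : Bd hS} (W : Hom X Y) : Y.obj ⟶ W.obj := lift (cls W.bord.i₂) W.sec₂

/-- The `2`-cells: classes of diffeomorphisms of bordisms, together with a morphism of sections
which is the identity on the collars. -/
structure Cell {X Y : Bd hS} (W V : Hom X Y) where
  cl : W.bord ⟶ V.bord
  hom : W.obj ⟶ V.obj
  base_eq : hom.base = DClass.toEmb cl
  comm₁ : W.in₁ ≫ hom = V.in₁
  comm₂ : W.in₂ ≫ hom = V.in₂

@[ext] theorem Cell.ext' {X Y : Bd hS} {W V : Hom X Y} {σ τ : Cell W V} (h : σ.cl = τ.cl)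
    (h' : σ.hom = τ.hom) : σ = τ := by
  obtain ⟨a, b, _, _, _⟩ := σ
  obtain ⟨a', b', _, _, _⟩ := τ
  obtain rfl : a = a' := h
  obtain rfl : b = b' := h'
  rfl

theorem toEmb_id {M₁ M₂ : ClosedMfd m} (W : Bordism M₁ M₂) : DClass.toEmb (𝟙 W) = 𝟙 (emb W.W) :=
  (Quotient.functor Diffeotopic).map_id W.W

instance (X Y : Bd hS) : Category (Hom X Y) where
  Hom := Cell
  id W := ⟨𝟙 _, 𝟙 _, (toEmb_id W.bord).symm, Category.comp_id _, Category.comp_id _⟩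
  comp σ τ := ⟨σ.cl ≫ τ.cl, σ.hom ≫ τ.hom, by
    rw [comp_base, σ.base_eq, τ.base_eq]; exact (DClass.toEmb_trans _ _).symm,
    by rw [← Category.assoc, σ.comm₁, τ.comm₁], by rw [← Category.assoc, σ.comm₂, τ.comm₂]⟩
  id_comp σ := Cell.ext' (Category.id_comp _) (Category.id_comp _)
  comp_id σ := Cell.ext' (Category.comp_id _) (Category.comp_id _)
  assoc σ τ υ := Cell.ext' (Category.assoc _ _ _) (Category.assoc _ _ _)

@[simp] theorem id_cl {X Y : Bd hS} (W : Hom X Y) : Cell.cl (𝟙 W) = 𝟙 _ := rfl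
@[simp] theorem id_hom {X Y : Bd hS} (W : Hom X Y) : Cell.hom (𝟙 W) = 𝟙 _ := rfl
@[simp] theorem comp_cl {X Y : Bd hS} {W V U : Hom X Y} (σ : W ⟶ V) (τ : V ⟶ U) :
    (σ ≫ τ).cl = σ.cl ≫ τ.cl := rfl
@[simp] theorem comp_hom {X Y : Bd hS} {W V U : Hom X Y} (σ : W ⟶ V) (τ : V ⟶ U) :
    (σ ≫ τ).hom = σ.hom ≫ τ.hom := rfl

/-- The identity bordism. -/
abbrev one (X : Bd hS) : Hom X X := ⟨Bordism.one X.mfd, X.sec, res_cls_id_obj S _, res_cls_id_obj S _⟩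

variable {X Y Z T : Bd hS}

theorem exists_sec (A : Hom X Y) (B : Hom Y Z) : ∃ x : Sec S (A.bord.comp B.bord).W,
    (res S (cls (jL A.bord B.bord))).obj x = A.sec ∧
      (res S (cls (jR A.bord B.bord))).obj x = B.sec :=
  ((isCover₂ A.bord B.bord).exists_sec hS A.sec B.sec (A.sec₂.trans B.sec₁.symm)).exists

/-- The composition of bordisms: they are glued, and the section is obtained by gluing the
sections. -/
abbrev comp (A : Hom X Y) (B : Hom Y Z) : Hom X Z where
  bord := A.bord.comp B.bord
  sec := (exists_sec A B).choose
  sec₁ := by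
    refine (res_cls_comp_obj S A.bord.i₁ (jL A.bord B.bord) _).trans ?_
    rw [(exists_sec A B).choose_spec.1, A.sec₁]
  sec₂ := by
    refine (res_cls_comp_obj S B.bord.i₂ (jR A.bord B.bord) _).trans ?_
    rw [(exists_sec A B).choose_spec.2, B.sec₂]

theorem comp_secL (A : Hom X Y) (B : Hom Y Z) :
    (res S (cls (jL A.bord B.bord))).obj (comp A B).sec = A.sec := (exists_sec A B).choose_spec.1
theorem comp_secR (A : Hom X Y) (B : Hom Y Z) :
    (res S (cls (jR A.bord B.bord))).obj (comp A B).sec = B.sec := (exists_sec A B).choose_spec.2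

/-- The inclusion of the first piece in a composition. -/
def inL (A : Hom X Y) (B : Hom Y Z) : A.obj ⟶ (comp A B).obj :=
  lift (cls (jL A.bord B.bord)) (comp_secL A B)
/-- The inclusion of the second piece in a composition. -/
def inR (A : Hom X Y) (B : Hom Y Z) : B.obj ⟶ (comp A B).obj :=
  lift (cls (jR A.bord B.bord)) (comp_secR A B)

theorem in_comm (A : Hom X Y) (B : Hom Y Z) : A.in₂ ≫ inL A B = B.in₁ ≫ inR A B := by
  simp only [Hom.in₂, Hom.in₁, inL, inR]
  refine (lift_comp _ _ _ _).trans ((lift_congr _ ?_).trans (lift_comp _ _ _ _).symm)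
  exact (cls_comp _ _).symm.trans ((congrArg cls (glue_comm _ _)).trans (cls_comp _ _))

theorem in₁_comp (A : Hom X Y) (B : Hom Y Z) : (comp A B).in₁ = A.in₁ ≫ inL A B := by
  refine ((lift_comp _ _ _ _).trans (lift_congr _ ?_)).symm
  exact (cls_comp _ _).symm
theorem in₂_comp (A : Hom X Y) (B : Hom Y Z) : (comp A B).in₂ = B.in₂ ≫ inR A B := by
  refine ((lift_comp _ _ _ _).trans (lift_congr _ ?_)).symm
  exact (cls_comp _ _).symm

theorem hom_ext (A : Hom X Y) (B : Hom Y Z) {E : EEmb S} {k l : (comp A B).obj ⟶ E}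
    (hb : k.base = l.base) (e : inL A B ≫ k = inL A B ≫ l) (e' : inR A B ≫ k = inR A B ≫ l) :
    k = l :=
  (isCover₂ A.bord B.bord).hom_ext hS (comp_secL A B) (comp_secR A B) hb e e'

theorem comp_base_congr {E E' E'' : EEmb S} (f : E ⟶ E') {k l : E' ⟶ E''} (hb : k.base = l.base) :
    (f ≫ k).base = (f ≫ l).base := by
  rw [comp_base, comp_base, hb]

theorem exists_hcomp {A A' : Hom X Y} {B B' : Hom Y Z} (σ : A ⟶ A') (τ : B ⟶ B') :
    ∃ d : (comp A B).obj ⟶ (comp A' B').obj, d.base = (DClass.glue σ.cl τ.cl).toEmb ∧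
      inL A B ≫ d = σ.hom ≫ inL A' B' ∧ inR A B ≫ d = τ.hom ≫ inR A' B' := by
  refine (isCover₂ A.bord B.bord).exists_hom hS (comp_secL A B) (comp_secR A B)
    (Y := (comp A' B').obj) (DClass.glue σ.cl τ.cl).toEmb (σ.hom ≫ inL A' B') (τ.hom ≫ inR A' B')
    ?_ ?_ A.sec₂ B.sec₁ ?_
  · rw [comp_base, σ.base_eq]; exact (DClass.jL_toEmb_glue _ _).symm
  · rw [comp_base, τ.base_eq]; exact (DClass.jR_toEmb_glue _ _).symm
  · change A.in₂ ≫ σ.hom ≫ inL A' B' = B.in₁ ≫ τ.hom ≫ inR A' B'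
    rw [← Category.assoc, ← Category.assoc, σ.comm₂, τ.comm₁, in_comm]

/-- The horizontal composition of `2`-cells. -/
def hcomp {A A' : Hom X Y} {B B' : Hom Y Z} (σ : A ⟶ A') (τ : B ⟶ B') : comp A B ⟶ comp A' B' where
  cl := DClass.glue σ.cl τ.cl
  hom := (exists_hcomp σ τ).choose
  base_eq := (exists_hcomp σ τ).choose_spec.1
  comm₁ := by
    rw [in₁_comp, in₁_comp, Category.assoc, (exists_hcomp σ τ).choose_spec.2.1, ← Category.assoc,
      σ.comm₁]
  comm₂ := by
    rw [in₂_comp, in₂_comp, Category.assoc, (exists_hcomp σ τ).choose_spec.2.2, ← Category.assoc,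
      τ.comm₂]

theorem inL_hcomp {A A' : Hom X Y} {B B' : Hom Y Z} (σ : A ⟶ A') (τ : B ⟶ B') :
    inL A B ≫ (hcomp σ τ).hom = σ.hom ≫ inL A' B' := (exists_hcomp σ τ).choose_spec.2.1
theorem inR_hcomp {A A' : Hom X Y} {B B' : Hom Y Z} (σ : A ⟶ A') (τ : B ⟶ B') :
    inR A B ≫ (hcomp σ τ).hom = τ.hom ≫ inR A' B' := (exists_hcomp σ τ).choose_spec.2.2
theorem inL_hcomp' {A A' : Hom X Y} {B B' : Hom Y Z} (σ : A ⟶ A') (τ : B ⟶ B') {E : EEmb S}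
    (k : (comp A' B').obj ⟶ E) :
    inL A B ≫ (hcomp σ τ).hom ≫ k = σ.hom ≫ inL A' B' ≫ k := by
  rw [← Category.assoc, inL_hcomp, Category.assoc]
theorem inR_hcomp' {A A' : Hom X Y} {B B' : Hom Y Z} (σ : A ⟶ A') (τ : B ⟶ B') {E : EEmb S}
    (k : (comp A' B').obj ⟶ E) :
    inR A B ≫ (hcomp σ τ).hom ≫ k = τ.hom ≫ inR A' B' ≫ k := by
  rw [← Category.assoc, inR_hcomp, Category.assoc]

/-- The invertible `2`-cell given by a diffeomorphism of bordisms which identifies the sections. -/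
def isoOfDiffeo {W V : Hom X Y} (φ : CollarDiffeo W.bord V.bord)
    (h : (res S (cls (ofDiffeo φ.diffeo))).obj V.sec = W.sec) : W ≅ V :=
  have h' : (res S (cls (ofDiffeo φ.symm.diffeo))).obj W.sec = V.sec := by
    rw [← h, ← res_cls_comp_obj]
    have : ofDiffeo φ.symm.diffeo ≫ ofDiffeo φ.diffeo = 𝟙 _ :=
      temb_ext fun x => φ.diffeo.apply_symm_apply x
    rw [this, res_cls_id_obj]
  have comm₁ : ∀ {W V : Hom X Y} (φ : CollarDiffeo W.bord V.bord)
      (h : (res S (cls (ofDiffeo φ.diffeo))).obj V.sec = W.sec),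
      W.in₁ ≫ lift (cls (ofDiffeo φ.diffeo)) h = V.in₁ := by
    intro W V φ h
    refine (lift_comp _ _ _ _).trans (lift_congr _ ?_)
    exact (DClass.i₁_toEmb (.mk φ) :)
  have comm₂ : ∀ {W V : Hom X Y} (φ : CollarDiffeo W.bord V.bord)
      (h : (res S (cls (ofDiffeo φ.diffeo))).obj V.sec = W.sec),
      W.in₂ ≫ lift (cls (ofDiffeo φ.diffeo)) h = V.in₂ := by
    intro W V φ h
    refine (lift_comp _ _ _ _).trans (lift_congr _ ?_)
    exact (DClass.i₂_toEmb (.mk φ) :)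
  { hom := ⟨(DClass.iso φ).hom, lift (cls (ofDiffeo φ.diffeo)) h, rfl, comm₁ φ h, comm₂ φ h⟩
    inv := ⟨(DClass.iso φ).inv, lift (cls (ofDiffeo φ.symm.diffeo)) h', rfl,
      comm₁ φ.symm h', comm₂ φ.symm h'⟩
    hom_inv_id := by
      refine Cell.ext' (DClass.iso φ).hom_inv_id ((lift_comp _ h _ h').trans
        ((lift_congr _ ?_).trans (lift_id _ (res_id_obj S _))))
      exact ((DClass.toEmb_trans (.mk φ) (.mk φ.symm)).symm.trans
        (congrArg DClass.toEmb (DClass.iso φ).hom_inv_id)).trans (toEmb_id _)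
    inv_hom_id := by
      refine Cell.ext' (DClass.iso φ).inv_hom_id ((lift_comp _ h' _ h).trans
        ((lift_congr _ ?_).trans (lift_id _ (res_id_obj S _))))
      exact ((DClass.toEmb_trans (.mk φ.symm) (.mk φ)).symm.trans
        (congrArg DClass.toEmb (DClass.iso φ).inv_hom_id)).trans (toEmb_id _) }

theorem comp_sec_ext {A : Hom X Y} {B : Hom Y Z} {x : Sec S (A.bord.comp B.bord).W}
    (h : (res S (cls (jL A.bord B.bord))).obj x = A.sec)
    (h' : (res S (cls (jR A.bord B.bord))).obj x = B.sec) : x = (comp A B).sec :=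
  (isCover₂ A.bord B.bord).sec_ext hS (h.trans (comp_secL A B).symm) (h'.trans (comp_secR A B).symm)

theorem assoc_sec (A : Hom X Y) (B : Hom Y Z) (C : Hom Z T) :
    (res S (cls (ofDiffeo (CollarDiffeo.assoc A.bord B.bord C.bord).diffeo))).obj
      (comp A (comp B C)).sec = (comp (comp A B) C).sec := by
  refine comp_sec_ext (A := comp A B) (B := C) ?_ ?_
  · refine (res_cls_comp_obj S _ _ _).symm.trans ?_
    refine comp_sec_ext (A := A) (B := B) ?_ ?_
    · refine (res_cls_comp_obj S _ _ _).symm.trans ?_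
      exact comp_secL A (comp B C)
    · refine (res_cls_comp_obj S _ _ _).symm.trans ?_
      refine Eq.trans (res_cls_comp_obj S (jL B.bord C.bord)
        (jR A.bord (B.bord.comp C.bord)) _) ?_
      exact (congrArg _ (comp_secR A (comp B C))).trans (comp_secL B C)
  · refine (res_cls_comp_obj S _ _ _).symm.trans ?_
    refine Eq.trans (res_cls_comp_obj S (jR B.bord C.bord)
        (jR A.bord (B.bord.comp C.bord)) _) ?_
    exact (congrArg _ (comp_secR A (comp B C))).trans (comp_secR B C)

theorem leftUnit_sec (A : Hom X Y) :
    (res S (cls (ofDiffeo (CollarDiffeo.leftUnit A.bord).diffeo))).obj A.sec =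
      (comp (one X) A).sec := by
  refine comp_sec_ext (A := one X) (B := A) ?_ ?_
  · exact (res_cls_comp_obj S _ _ _).symm.trans A.sec₁
  · exact (res_cls_comp_obj S _ _ _).symm.trans (res_cls_id_obj S _)

theorem rightUnit_sec (A : Hom X Y) :
    (res S (cls (ofDiffeo (CollarDiffeo.rightUnit A.bord).diffeo))).obj A.sec =
      (comp A (one Y)).sec := by
  refine comp_sec_ext (A := A) (B := one Y) ?_ ?_
  · exact (res_cls_comp_obj S _ _ _).symm.trans (res_cls_id_obj S _)
  · exact (res_cls_comp_obj S _ _ _).symm.trans A.sec₂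

/-- The associator. -/
def assoc (A : Hom X Y) (B : Hom Y Z) (C : Hom Z T) :
    comp (comp A B) C ≅ comp A (comp B C) :=
  isoOfDiffeo (CollarDiffeo.assoc A.bord B.bord C.bord) (assoc_sec A B C)

/-- The left unitor. -/
def leftUnit (A : Hom X Y) : comp (one X) A ≅ A :=
  isoOfDiffeo (CollarDiffeo.leftUnit A.bord) (leftUnit_sec A)

/-- The right unitor. -/
def rightUnit (A : Hom X Y) : comp A (one Y) ≅ A :=
  isoOfDiffeo (CollarDiffeo.rightUnit A.bord) (rightUnit_sec A)

@[simp] theorem hcomp_cl {A A' : Hom X Y} {B B' : Hom Y Z} (σ : A ⟶ A') (τ : B ⟶ B') :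
    (hcomp σ τ).cl = DClass.glue σ.cl τ.cl := rfl
@[simp] theorem assoc_cl (A : Hom X Y) (B : Hom Y Z) (C : Hom Z T) :
    (assoc A B C).hom.cl = (Bicategory.associator (B := ClosedMfd m) A.bord B.bord C.bord).hom :=
  rfl
@[simp] theorem leftUnit_cl (A : Hom X Y) :
    (leftUnit A).hom.cl = (Bicategory.leftUnitor (B := ClosedMfd m) A.bord).hom := rfl
@[simp] theorem rightUnit_cl (A : Hom X Y) :
    (rightUnit A).hom.cl = (Bicategory.rightUnitor (B := ClosedMfd m) A.bord).hom := rfl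

theorem lift_cls_comp {E E' E'' : EEmb S} (e : E.mfd ⟶ E'.mfd) {h} (f : E'.mfd ⟶ E''.mfd) {h'} :
    ∃ h'', (lift (cls e) h : E ⟶ E') ≫ (lift (cls f) h' : E' ⟶ E'') = lift (cls (e ≫ f)) h'' :=
  ⟨by rw [res_cls_comp_obj, h', h], (lift_comp _ _ _ _).trans (lift_congr _ (cls_comp _ _).symm)⟩

theorem lift₂₁ {E E' E'' : EEmb S} {e : E.mfd ⟶ E'.mfd} {h} {f : E'.mfd ⟶ E''.mfd} {h'}
    {k : E.mfd ⟶ E''.mfd} {h''} (H : ∀ x, f.toFun (e.toFun x) = k.toFun x) :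
    (lift (cls e) h : E ⟶ E') ≫ (lift (cls f) h' : E' ⟶ E'') = lift (cls k) h'' := by
  obtain ⟨a, ha⟩ := lift_cls_comp (h := h) (h' := h') e f
  rw [ha]
  exact lift_congr _ (congrArg cls (temb_ext H))

theorem lift₂₂ {E E' D E'' : EEmb S} {e : E.mfd ⟶ E'.mfd} {h} {f : E'.mfd ⟶ E''.mfd} {h'}
    {k : E.mfd ⟶ D.mfd} {g} {l : D.mfd ⟶ E''.mfd} {g'}
    (H : ∀ x, f.toFun (e.toFun x) = l.toFun (k.toFun x)) :
    (lift (cls e) h : E ⟶ E') ≫ (lift (cls f) h' : E' ⟶ E'') =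
      (lift (cls k) g : E ⟶ D) ≫ lift (cls l) g' := by
  obtain ⟨a, ha⟩ := lift_cls_comp (h := h) (h' := h') e f
  rw [ha]
  exact (lift₂₁ fun x => (H x).symm).symm

theorem lift₃₁ {E E' D E'' : EEmb S} {e : E.mfd ⟶ E'.mfd} {h} {f : E'.mfd ⟶ D.mfd} {h'}
    {g : D.mfd ⟶ E''.mfd} {h₃} {k : E.mfd ⟶ E''.mfd} {h''}
    (H : ∀ x, g.toFun (f.toFun (e.toFun x)) = k.toFun x) :
    (lift (cls e) h : E ⟶ E') ≫ (lift (cls f) h' : E' ⟶ D) ≫ (lift (cls g) h₃ : D ⟶ E'') =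
      lift (cls k) h'' := by
  obtain ⟨a, ha⟩ := lift_cls_comp (h := h') (h' := h₃) f g
  rw [ha]
  exact lift₂₁ H

theorem lift₃₂ {E E' D D' E'' : EEmb S} {e : E.mfd ⟶ E'.mfd} {h} {f : E'.mfd ⟶ D.mfd} {h'}
    {g : D.mfd ⟶ E''.mfd} {h₃} {k : E.mfd ⟶ D'.mfd} {h''} {l : D'.mfd ⟶ E''.mfd} {h₄}
    (H : ∀ x, g.toFun (f.toFun (e.toFun x)) = l.toFun (k.toFun x)) :
    (lift (cls e) h : E ⟶ E') ≫ (lift (cls f) h' : E' ⟶ D) ≫ (lift (cls g) h₃ : D ⟶ E'') =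
      (lift (cls k) h'' : E ⟶ D') ≫ lift (cls l) h₄ := by
  obtain ⟨a, ha⟩ := lift_cls_comp (h := h') (h' := h₃) f g
  rw [ha]
  exact lift₂₂ H

theorem inLL_assoc (A : Hom X Y) (B : Hom Y Z) (C : Hom Z T) :
    inL A B ≫ inL (comp A B) C ≫ (assoc A B C).hom.hom = inL A (comp B C) :=
  lift₃₁ (h₃ := assoc_sec A B C) fun _ => rfl
theorem inRL_assoc (A : Hom X Y) (B : Hom Y Z) (C : Hom Z T) :
    inR A B ≫ inL (comp A B) C ≫ (assoc A B C).hom.hom = inL B C ≫ inR A (comp B C) :=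
  lift₃₂ (h₃ := assoc_sec A B C) fun _ => rfl
theorem inR_assoc (A : Hom X Y) (B : Hom Y Z) (C : Hom Z T) :
    inR (comp A B) C ≫ (assoc A B C).hom.hom = inR B C ≫ inR A (comp B C) :=
  lift₂₂ (h' := assoc_sec A B C) fun _ => rfl
theorem inL_leftUnit (A : Hom X Y) : inL (one X) A ≫ (leftUnit A).hom.hom = A.in₁ :=
  lift₂₁ (h' := leftUnit_sec A) fun _ => rfl
theorem inR_leftUnit (A : Hom X Y) : inR (one X) A ≫ (leftUnit A).hom.hom = 𝟙 A.obj :=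
  (lift₂₁ (h' := leftUnit_sec A) (k := 𝟙 _) (h'' := res_cls_id_obj S _) fun _ => rfl).trans ((lift_congr _ (cls_id _)).trans (lift_id _ (res_id_obj S _)))
theorem inL_rightUnit (A : Hom X Y) : inL A (one Y) ≫ (rightUnit A).hom.hom = 𝟙 A.obj :=
  (lift₂₁ (h' := rightUnit_sec A) (k := 𝟙 _) (h'' := res_cls_id_obj S _) fun _ => rfl).trans ((lift_congr _ (cls_id _)).trans (lift_id _ (res_id_obj S _)))
theorem inR_rightUnit (A : Hom X Y) : inR A (one Y) ≫ (rightUnit A).hom.hom = A.in₂ :=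
  lift₂₁ (h' := rightUnit_sec A) fun _ => rfl

theorem inLL_assoc' (A : Hom X Y) (B : Hom Y Z) (C : Hom Z T) {E : EEmb S}
    (k : (comp A (comp B C)).obj ⟶ E) :
    inL A B ≫ inL (comp A B) C ≫ (assoc A B C).hom.hom ≫ k = inL A (comp B C) ≫ k := by
  rw [← inLL_assoc, Category.assoc, Category.assoc]
theorem inRL_assoc' (A : Hom X Y) (B : Hom Y Z) (C : Hom Z T) {E : EEmb S}
    (k : (comp A (comp B C)).obj ⟶ E) :
    inR A B ≫ inL (comp A B) C ≫ (assoc A B C).hom.hom ≫ k = inL B C ≫ inR A (comp B C) ≫ k := by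
  rw [← Category.assoc (inL B C), ← inRL_assoc, Category.assoc, Category.assoc]
theorem inR_assoc' (A : Hom X Y) (B : Hom Y Z) (C : Hom Z T) {E : EEmb S}
    (k : (comp A (comp B C)).obj ⟶ E) :
    inR (comp A B) C ≫ (assoc A B C).hom.hom ≫ k = inR B C ≫ inR A (comp B C) ≫ k := by
  rw [← Category.assoc (inR B C), ← inR_assoc, Category.assoc]
theorem inL_leftUnit' (A : Hom X Y) {E : EEmb S} (k : A.obj ⟶ E) :
    inL (one X) A ≫ (leftUnit A).hom.hom ≫ k = A.in₁ ≫ k := by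
  rw [← inL_leftUnit, Category.assoc]
theorem inR_leftUnit' (A : Hom X Y) {E : EEmb S} (k : A.obj ⟶ E) :
    inR (one X) A ≫ (leftUnit A).hom.hom ≫ k = k := by
  rw [← Category.assoc, inR_leftUnit, Category.id_comp]
theorem inL_rightUnit' (A : Hom X Y) {E : EEmb S} (k : A.obj ⟶ E) :
    inL A (one Y) ≫ (rightUnit A).hom.hom ≫ k = k := by
  rw [← Category.assoc, inL_rightUnit, Category.id_comp]
theorem inR_rightUnit' (A : Hom X Y) {E : EEmb S} (k : A.obj ⟶ E) :
    inR A (one Y) ≫ (rightUnit A).hom.hom ≫ k = A.in₂ ≫ k := by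
  rw [← inR_rightUnit, Category.assoc]
theorem comm₁' {W V : Hom X Y} (σ : W ⟶ V) {E : EEmb S} (k : V.obj ⟶ E) :
    W.in₁ ≫ σ.hom ≫ k = V.in₁ ≫ k := by rw [← σ.comm₁, Category.assoc]
theorem comm₂' {W V : Hom X Y} (σ : W ⟶ V) {E : EEmb S} (k : V.obj ⟶ E) :
    W.in₂ ≫ σ.hom ≫ k = V.in₂ ≫ k := by rw [← σ.comm₂, Category.assoc]

theorem cell_base {W V : Hom X Y} {σ τ : W ⟶ V} (h : σ.cl = τ.cl) : σ.hom.base = τ.hom.base := by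
  rw [σ.base_eq, τ.base_eq, h]

/-- Two `2`-cells out of a composition are equal as soon as they are equal on the pieces. -/
theorem cell_ext {A : Hom X Y} {B : Hom Y Z} {V : Hom X Z} {σ τ : comp A B ⟶ V} (h : σ.cl = τ.cl)
    (h₁ : inL A B ≫ σ.hom = inL A B ≫ τ.hom) (h₂ : inR A B ≫ σ.hom = inR A B ≫ τ.hom) : σ = τ :=
  Cell.ext' h (hom_ext A B (cell_base h) h₁ h₂)

theorem base_congr {E E' E'' : EEmb S} {f : E ⟶ E'} {k l : E' ⟶ E''} (h : k.base = l.base) :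
    (f ≫ k).base = (f ≫ l).base := congrArg (f.base ≫ ·) h

section Laws

attribute [local simp] inL_hcomp inR_hcomp inL_hcomp' inR_hcomp' inLL_assoc inRL_assoc inR_assoc
  inLL_assoc' inRL_assoc' inR_assoc' inL_leftUnit inR_leftUnit inL_rightUnit inR_rightUnit
  inL_leftUnit' inR_leftUnit' inL_rightUnit' inR_rightUnit' comm₁' comm₂' Cell.comm₁ Cell.comm₂

theorem glue_assoc_nat {M₁ M₂ M₃ M₄ : ClosedMfd m} {A A' : Bordism M₁ M₂} {B B' : Bordism M₂ M₃}
    {C C' : Bordism M₃ M₄} (φ : DClass A A') (ψ : DClass B B') (χ : DClass C C') :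
    DClass.trans (DClass.glue (DClass.glue φ ψ) χ) (.mk (CollarDiffeo.assoc A' B' C')) =
      DClass.trans (.mk (CollarDiffeo.assoc A B C)) (DClass.glue φ (DClass.glue ψ χ)) := by
  induction φ using DClass.ind with | h φ
  induction ψ using DClass.ind with | h ψ
  induction χ using DClass.ind with | h χ
  exact congrArg DClass.mk (CollarDiffeo.ext' (glue_ind (A.comp B) C
    (glue_ind A B (fun _ => rfl) fun _ => rfl) fun _ => rfl))

theorem glue_trans {M₁ M₂ M₃ : ClosedMfd m} {A A' A'' : Bordism M₁ M₂} {B B' B'' : Bordism M₂ M₃}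
    (φ : DClass A A') (φ' : DClass A' A'') (ψ : DClass B B') (ψ' : DClass B' B'') :
    DClass.glue (φ.trans φ') (ψ.trans ψ') = (DClass.glue φ ψ).trans (DClass.glue φ' ψ') := by
  induction φ using DClass.ind with | h φ
  induction ψ using DClass.ind with | h ψ
  induction φ' using DClass.ind with | h φ'
  induction ψ' using DClass.ind with | h ψ'
  exact congrArg DClass.mk (CollarDiffeo.ext' (glue_ind A B (fun _ => rfl) fun _ => rfl))

theorem assoc_nat {A A' : Hom X Y} {B B' : Hom Y Z} {C C' : Hom Z T} (φ : A ⟶ A') (ψ : B ⟶ B')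
    (χ : C ⟶ C') :
    hcomp (hcomp φ ψ) χ ≫ (assoc A' B' C').hom = (assoc A B C).hom ≫ hcomp φ (hcomp ψ χ) := by
  have h : (hcomp (hcomp φ ψ) χ ≫ (assoc A' B' C').hom).cl =
      ((assoc A B C).hom ≫ hcomp φ (hcomp ψ χ)).cl := glue_assoc_nat φ.cl ψ.cl χ.cl
  refine cell_ext h (hom_ext A B (base_congr (cell_base h)) ?_ ?_) ?_ <;> simp

theorem hcomp_comp {A A' A'' : Hom X Y} {B B' B'' : Hom Y Z} (φ : A ⟶ A') (φ' : A' ⟶ A'')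
    (ψ : B ⟶ B') (ψ' : B' ⟶ B'') : hcomp (φ ≫ φ') (ψ ≫ ψ') = hcomp φ ψ ≫ hcomp φ' ψ' :=
  cell_ext (glue_trans φ.cl φ'.cl ψ.cl ψ'.cl) (by simp) (by simp)

theorem leftUnit_nat {A B : Hom X Y} (φ : A ⟶ B) :
    hcomp (𝟙 (one X)) φ ≫ (leftUnit B).hom = (leftUnit A).hom ≫ φ :=
  cell_ext (Bicategory.leftUnitor_naturality (B := ClosedMfd m) φ.cl) (by simp) (by simp)

theorem rightUnit_nat {A B : Hom X Y} (φ : A ⟶ B) :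
    hcomp φ (𝟙 (one Y)) ≫ (rightUnit B).hom = (rightUnit A).hom ≫ φ :=
  cell_ext (Bicategory.rightUnitor_naturality (B := ClosedMfd m) φ.cl) (by simp) (by simp)

theorem hcomp_id (A : Hom X Y) (B : Hom Y Z) : hcomp (𝟙 A) (𝟙 B) = 𝟙 (comp A B) :=
  cell_ext (Bicategory.whiskerLeft_id (B := ClosedMfd m) A.bord B.bord) (by simp) (by simp)

/-- The bicategory of bordisms over a sheaf. -/
instance : Bicategory (Bd hS) where
  Hom := Hom
  id := one
  comp := comp
  whiskerLeft W _ _ ψ := hcomp (𝟙 W) ψ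
  whiskerRight φ W := hcomp φ (𝟙 W)
  associator := assoc
  leftUnitor := leftUnit
  rightUnitor := rightUnit
  whiskerLeft_id W V := hcomp_id W V
  whiskerLeft_comp A _ _ _ φ ψ := (congrArg (hcomp · (φ ≫ ψ)) (Category.comp_id (𝟙 A)).symm).trans
    (hcomp_comp _ _ _ _)
  id_whiskerLeft φ := by
    rw [← Category.assoc, ← leftUnit_nat, Category.assoc, Iso.hom_inv_id, Category.comp_id]
  comp_whiskerLeft A B C C' φ := by
    rw [← Category.assoc, Iso.eq_comp_inv, ← hcomp_id]
    exact assoc_nat _ _ _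
  id_whiskerRight A B := hcomp_id A B
  comp_whiskerRight φ ψ B := (congrArg (hcomp (φ ≫ ψ) ·) (Category.comp_id (𝟙 B)).symm).trans
    (hcomp_comp _ _ _ _)
  whiskerRight_id φ := by
    rw [← Category.assoc, ← rightUnit_nat, Category.assoc, Iso.hom_inv_id, Category.comp_id]
  whiskerRight_comp φ B C := by
    rw [Iso.eq_inv_comp, ← hcomp_id]
    exact (assoc_nat _ _ _).symm
  whisker_assoc A _ _ φ C := by
    rw [← Category.assoc, Iso.eq_comp_inv]
    exact assoc_nat _ _ _
  whisker_exchange φ ψ := by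
    rw [← hcomp_comp, ← hcomp_comp, Category.id_comp, Category.comp_id, Category.id_comp,
      Category.comp_id]
  pentagon A B C D := by
    have h := Bicategory.pentagon (B := ClosedMfd m) A.bord B.bord C.bord D.bord
    refine cell_ext h (hom_ext (comp A B) C (base_congr (cell_base h)) (hom_ext A B
      (base_congr (base_congr (cell_base h))) ?_ ?_) ?_) ?_ <;> simp
  triangle {_ Y _} A B := by
    have h := Bicategory.triangle (B := ClosedMfd m) A.bord B.bord
    refine cell_ext h (hom_ext A (one Y) (base_congr (cell_base h)) ?_ ?_) ?_ <;> simp [in_comm]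

end Laws

end Bd

end

end FieldTheory

namespace FieldTheory

open CategoryTheory Set Function Topology
open scoped Manifold ContDiff

noncomputable section

variable {m : ℕ}

open ClosedMfd (pt)
open Bordism

section LocalLemmas

variable {E H : Type} [NormedAddCommGroup E] [NormedSpace ℝ E] [TopologicalSpace H]
  {I : ModelWithCorners ℝ E H}
  {A X : Type} [TopologicalSpace A] [ChartedSpace H A] [TopologicalSpace X] [ChartedSpace H X]

theorem isLocalDiffeomorphAt_of_retract {j : A → X} (hj : ContMDiff I I ∞ j) (ho : IsOpen (range j))
    {r : X → A} (hr : ContMDiff I I ∞ r) (h : ∀ a, r (j a) = a) (a : A) :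
    IsLocalDiffeomorphAt I I ∞ j a := by
  refine ⟨⟨⟨j, r, univ, range j, fun _ _ => mem_range_self _, fun _ _ => trivial, fun _ _ => h _, ?_⟩,
    isOpen_univ, ho, hj.contMDiffOn, hr.contMDiffOn⟩, trivial, fun _ _ => rfl⟩
  rintro _ ⟨a, rfl⟩
  exact congrArg j (h a)

end LocalLemmas

/-- The disjoint union of two manifolds. -/
def Mfd.sum (A B : Mfd m) : Mfd m where
  carrier := A ⊕ B

/-- The disjoint union of two closed manifolds. -/
def ClosedMfd.sum (M N : ClosedMfd m) : ClosedMfd m where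
  carrier := M ⊕ N

/-- The empty closed manifold. -/
def ClosedMfd.empty (m : ℕ) : ClosedMfd m where
  carrier := Empty
  charted := ChartedSpace.empty _ _
  smooth := letI := ChartedSpace.empty (EuclideanSpace ℝ (Fin m)) Empty; IsManifold.empty ∞

instance : IsEmpty (ClosedMfd.empty m) := inferInstanceAs (IsEmpty Empty)
instance : IsEmpty (ClosedMfd.empty m).cyl :=
  inferInstanceAs (IsEmpty (ClosedMfd.empty m × unitInterval))

/-- The embedding of an empty manifold. -/
def fromEmpty (O X : Mfd m) [IsEmpty O] : O ⟶ X where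
  toFun o := isEmptyElim o
  tame :=
    { smooth := fun o => isEmptyElim o
      injective := fun o => isEmptyElim o
      immersion := fun o => isEmptyElim o
      closed := by
        convert isClosed_empty
        ext o; exact isEmptyElim o
      locDiffeo := fun o => isEmptyElim o }

/-- `X` is the disjoint union of (the images of) `A` and `B`. -/
structure IsSum {A B X : Mfd m} (j : A → X) (j' : B → X) : Prop where
  loc : ∀ a, IsLocalDiffeomorphAt (mdl m) (mdl m) ∞ j a
  loc' : ∀ b, IsLocalDiffeomorphAt (mdl m) (mdl m) ∞ j' b
  surj : ∀ x, (∃ a, j a = x) ∨ ∃ b, j' b = x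
  disj : ∀ a b, j a ≠ j' b

namespace IsSum

variable {A B X Y : Mfd m} {j : A → X} {j' : B → X}

theorem contMDiff (h : IsSum j j') {k : X → Y} (hk : ContMDiff (mdl m) (mdl m) ∞ (k ∘ j))
    (hk' : ContMDiff (mdl m) (mdl m) ∞ (k ∘ j')) : ContMDiff (mdl m) (mdl m) ∞ k := by
  intro x
  rcases h.surj x with ⟨a, rfl⟩ | ⟨b, rfl⟩
  · exact contMDiffAt_of_comp_localDiffeo (h.loc a) (hk a)
  · exact contMDiffAt_of_comp_localDiffeo (h.loc' b) (hk' b)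

theorem contMDiff_prod (h : IsSum j j') {k : X × unitInterval → Y}
    (hk : ContMDiff ((mdl m).prod (𝓡∂ 1)) (mdl m) ∞ fun p : A × unitInterval => k (j p.1, p.2))
    (hk' : ContMDiff ((mdl m).prod (𝓡∂ 1)) (mdl m) ∞ fun p : B × unitInterval => k (j' p.1, p.2)) :
    ContMDiff ((mdl m).prod (𝓡∂ 1)) (mdl m) ∞ k := by
  rintro ⟨x, t⟩
  rcases h.surj x with ⟨a, rfl⟩ | ⟨b, rfl⟩
  · exact contMDiffAt_of_comp_localDiffeo_prod (h.loc a) (hk (a, t))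
  · exact contMDiffAt_of_comp_localDiffeo_prod (h.loc' b) (hk' (b, t))

theorem tame (h : IsSum j j') {k : X → Y} (hk : IsTame (k ∘ j)) (hk' : IsTame (k ∘ j'))
    (hd : ∀ a b, k (j a) ≠ k (j' b)) : IsTame k := by
  have hs : ContMDiff (mdl m) (mdl m) ∞ k := h.contMDiff hk.smooth hk'.smooth
  have hb : ∀ a, j a ∈ X.bd ↔ a ∈ A.bd := fun a => ((h.loc a).isBoundaryPoint_iff (by simp)).symm
  have hb' : ∀ a, j' a ∈ X.bd ↔ a ∈ B.bd := fun a => ((h.loc' a).isBoundaryPoint_iff (by simp)).symm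
  have hc : Continuous j := ContMDiff.continuous (I := mdl m) (I' := mdl m) (n := ∞)
    fun a => (h.loc a).contMDiffAt
  have hc' : Continuous j' := ContMDiff.continuous (I := mdl m) (I' := mdl m) (n := ∞)
    fun a => (h.loc' a).contMDiffAt
  refine ⟨hs, ?_, ?_, ?_, ?_⟩
  · intro x y hxy
    rcases h.surj x with ⟨a, rfl⟩ | ⟨b, rfl⟩ <;> rcases h.surj y with ⟨a', rfl⟩ | ⟨b', rfl⟩
    · exact congrArg j (hk.injective hxy)
    · exact absurd hxy (hd _ _)
    · exact absurd hxy.symm (hd _ _)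
    · exact congrArg j' (hk'.injective hxy)
  · have key : ∀ {C : Mfd m} (i : C → X) (c : C), IsLocalDiffeomorphAt (mdl m) (mdl m) ∞ i c →
        IsTame (k ∘ i) → Injective (mfderiv (mdl m) (mdl m) k (i c)) := by
      intro C i c hi hki v w hvw
      have h1 := mfderiv_comp c (hs.mdifferentiable (by simp) (i c))
        (hi.mdifferentiableAt (by simp))
      have h4 : Surjective (mfderiv (mdl m) (mdl m) i c) :=
        (hi.mfderivToContinuousLinearEquiv (by simp)).surjective
      obtain ⟨v, rfl⟩ := h4 v
      obtain ⟨w, rfl⟩ := h4 w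
      have e1 := DFunLike.congr_fun h1 v
      have e2 := DFunLike.congr_fun h1 w
      rw [hki.immersion c (e1.trans (Eq.trans hvw e2.symm))]
    intro x
    rcases h.surj x with ⟨a, rfl⟩ | ⟨b, rfl⟩
    · exact key j a (h.loc a) hk
    · exact key j' b (h.loc' b) hk'
  · have : {x | x ∈ X.bd ∧ k x ∉ Y.bd} = j '' {a | a ∈ A.bd ∧ (k ∘ j) a ∉ Y.bd} ∪
        j' '' {b | b ∈ B.bd ∧ (k ∘ j') b ∉ Y.bd} := by
      ext x
      constructor
      · rintro ⟨h1, h2⟩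
        rcases h.surj x with ⟨a, rfl⟩ | ⟨b, rfl⟩
        · exact .inl ⟨a, ⟨(hb a).1 h1, h2⟩, rfl⟩
        · exact .inr ⟨b, ⟨(hb' b).1 h1, h2⟩, rfl⟩
      · rintro (⟨a, ⟨h1, h2⟩, rfl⟩ | ⟨a, ⟨h1, h2⟩, rfl⟩)
        · exact ⟨(hb a).2 h1, h2⟩
        · exact ⟨(hb' a).2 h1, h2⟩
    rw [this]
    exact (hk.closed.isCompact.image hc).isClosed.union (hk'.closed.isCompact.image hc').isClosed
  · intro x hx
    rcases h.surj x with ⟨a, rfl⟩ | ⟨b, rfl⟩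
    · exact isLocalDiffeomorphAt_of_comp (h.loc a)
        (hk.locDiffeo a fun h' => hx ⟨(hb a).2 h'.1, h'.2⟩)
    · exact isLocalDiffeomorphAt_of_comp (h.loc' b)
        (hk'.locDiffeo b fun h' => hx ⟨(hb' b).2 h'.1, h'.2⟩)

end IsSum

theorem IsTame.of_loc {A X : Mfd m} {j : A → X}
    (h : ∀ a, IsLocalDiffeomorphAt (mdl m) (mdl m) ∞ j a) (hi : Injective j) : IsTame j where
  smooth a := (h a).contMDiffAt
  injective := hi
  immersion a := ((h a).mfderivToContinuousLinearEquiv (by simp)).injective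
  closed := by
    convert isClosed_empty
    ext x
    simp only [mem_ofPred_eq, mem_empty_iff_false, iff_false, not_and, not_not]
    exact fun h' => ((h x).isBoundaryPoint_iff (by simp)).1 h'
  locDiffeo a _ := h a

theorem isSum_sum (A B : Mfd m) : IsSum (X := A.sum B) (Sum.inl : A → A ⊕ B)
    (Sum.inr : B → A ⊕ B) where
  loc a := isLocalDiffeomorphAt_of_retract ContMDiff.inl isOpen_range_inl
    (ContMDiff.sumElim contMDiff_id (contMDiff_const (c := a))) (fun _ => rfl) a
  loc' b := isLocalDiffeomorphAt_of_retract ContMDiff.inr isOpen_range_inr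
    (ContMDiff.sumElim (contMDiff_const (c := b)) contMDiff_id) (fun _ => rfl) b
  surj := by rintro (a | b); exacts [.inl ⟨a, rfl⟩, .inr ⟨b, rfl⟩]
  disj _ _ := Sum.inl_ne_inr

theorem isSum_cyl (M N : ClosedMfd m) : IsSum (A := M.cyl) (B := N.cyl) (X := (M.sum N).cyl)
    (fun p => pt (M := M.sum N) (.inl p.1) p.2) (fun p => pt (M := M.sum N) (.inr p.1) p.2) where
  loc a := by
    refine isLocalDiffeomorphAt_of_retract (r := fun p : (M ⊕ N) × unitInterval =>
      ((Sum.elim id (fun _ => a.1) p.1, p.2) : M × unitInterval)) ?_ ?_ ?_ (fun _ => rfl) a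
    · exact (ContMDiff.inl.comp contMDiff_fst).prodMk contMDiff_snd
    · convert (isOpen_range_inl (X := M) (Y := N)).preimage
        (continuous_fst (Y := unitInterval))
      ext ⟨x, t⟩
      constructor
      · rintro ⟨p, hp⟩; exact ⟨p.1, congrArg Prod.fst hp⟩
      · rintro ⟨p, rfl⟩; exact ⟨(p, t), rfl⟩
    · exact ((ContMDiff.sumElim contMDiff_id contMDiff_const).comp contMDiff_fst).prodMk
        contMDiff_snd
  loc' a := by
    refine isLocalDiffeomorphAt_of_retract (r := fun p : (M ⊕ N) × unitInterval =>
      ((Sum.elim (fun _ => a.1) id p.1, p.2) : N × unitInterval)) ?_ ?_ ?_ (fun _ => rfl) a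
    · exact (ContMDiff.inr.comp contMDiff_fst).prodMk contMDiff_snd
    · convert (isOpen_range_inr (X := M) (Y := N)).preimage
        (continuous_fst (Y := unitInterval))
      ext ⟨x, t⟩
      constructor
      · rintro ⟨p, hp⟩; exact ⟨p.1, congrArg Prod.fst hp⟩
      · rintro ⟨p, rfl⟩; exact ⟨(p, t), rfl⟩
    · exact ((ContMDiff.sumElim contMDiff_const contMDiff_id).comp contMDiff_fst).prodMk
        contMDiff_snd
  surj := by
    rintro ⟨x | x, t⟩
    exacts [.inl ⟨(x, t), rfl⟩, .inr ⟨(x, t), rfl⟩]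
  disj a b h := by
    have := (pt_inj.1 h).1
    exact Sum.inl_ne_inr this

/-- The inclusion of the first manifold in a disjoint union. -/
def sumL (A B : Mfd m) : A ⟶ A.sum B := ⟨Sum.inl, .of_loc (isSum_sum A B).loc Sum.inl_injective⟩
/-- The inclusion of the second manifold in a disjoint union. -/
def sumR (A B : Mfd m) : B ⟶ A.sum B := ⟨Sum.inr, .of_loc (isSum_sum A B).loc' Sum.inr_injective⟩

/-- The inclusion of the first cylinder in the cylinder over a disjoint union. -/
def cylL (M N : ClosedMfd m) : M.cyl ⟶ (M.sum N).cyl :=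
  ⟨fun p => pt (M := M.sum N) (.inl p.1) p.2, .of_loc (isSum_cyl M N).loc fun _ _ h =>
    Prod.ext (Sum.inl_injective (pt_inj.1 h).1) (pt_inj.1 h).2⟩
/-- The inclusion of the second cylinder in the cylinder over a disjoint union. -/
def cylR (M N : ClosedMfd m) : N.cyl ⟶ (M.sum N).cyl :=
  ⟨fun p => pt (M := M.sum N) (.inr p.1) p.2, .of_loc (isSum_cyl M N).loc' fun _ _ h =>
    Prod.ext (Sum.inr_injective (pt_inj.1 h).1) (pt_inj.1 h).2⟩

/-- The map from the cylinder over a disjoint union which is `i` and `i'` on the pieces. -/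
def collarSum {M N : ClosedMfd m} {A B : Mfd m} (i : M.cyl ⟶ A) (i' : N.cyl ⟶ B) :
    (M.sum N).cyl ⟶ A.sum B where
  toFun p := Sum.elim (fun x => (sumL A B).toFun (i.toFun (pt x p.2)))
    (fun y => (sumR A B).toFun (i'.toFun (pt y p.2))) p.1
  tame := (isSum_cyl M N).tame (k := fun p => Sum.elim
      (fun x => (sumL A B).toFun (i.toFun (pt x p.2)))
      (fun y => (sumR A B).toFun (i'.toFun (pt y p.2))) p.1)
    ((sumL A B).tame.comp i.tame) ((sumR A B).tame.comp i'.tame)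
    (fun _ _ => Sum.inl_ne_inr)

@[simp] theorem collarSum_inl {M N : ClosedMfd m} {A B : Mfd m} (i : M.cyl ⟶ A) (i' : N.cyl ⟶ B)
    (x : M) (t : unitInterval) : (collarSum i i').toFun (pt (M := M.sum N) (.inl x) t) =
      (sumL A B).toFun (i.toFun (pt x t)) := rfl
@[simp] theorem collarSum_inr {M N : ClosedMfd m} {A B : Mfd m} (i : M.cyl ⟶ A) (i' : N.cyl ⟶ B)
    (x : N) (t : unitInterval) : (collarSum i i').toFun (pt (M := M.sum N) (.inr x) t) =
      (sumR A B).toFun (i'.toFun (pt x t)) := rfl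

theorem sumL_mem_bd {A B : Mfd m} {a : A} : (sumL A B).toFun a ∈ (A.sum B).bd ↔ a ∈ A.bd :=
  (((isSum_sum A B).loc a).isBoundaryPoint_iff (by simp)).symm
theorem sumR_mem_bd {A B : Mfd m} {b : B} : (sumR A B).toFun b ∈ (A.sum B).bd ↔ b ∈ B.bd :=
  (((isSum_sum A B).loc' b).isBoundaryPoint_iff (by simp)).symm
theorem sumL_inj {A B : Mfd m} {a a' : A} : (sumL A B).toFun a = (sumL A B).toFun a' ↔ a = a' :=
  Sum.inl_injective.eq_iff
theorem sumR_inj {A B : Mfd m} {a a' : B} : (sumR A B).toFun a = (sumR A B).toFun a' ↔ a = a' :=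
  Sum.inr_injective.eq_iff
theorem sumL_ne_sumR {A B : Mfd m} {a : A} {b : B} : (sumL A B).toFun a ≠ (sumR A B).toFun b :=
  Sum.inl_ne_inr
theorem sum_ind {A B : Mfd m} {p : A.sum B → Prop} (h : ∀ a, p ((sumL A B).toFun a))
    (h' : ∀ b, p ((sumR A B).toFun b)) (x : A.sum B) : p x := by
  rcases x with a | b
  exacts [h a, h' b]
theorem cylSum_ind {M N : ClosedMfd m} {p : (M.sum N).cyl → Prop} (h : ∀ a, p ((cylL M N).toFun a))
    (h' : ∀ b, p ((cylR M N).toFun b)) (x : (M.sum N).cyl) : p x := by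
  obtain ⟨a | b, t⟩ := x
  exacts [h (a, t), h' (b, t)]

/-- The map out of a disjoint union which is `u` and `v` on the pieces. -/
def sumDesc {A B : Mfd m} {Y : Type*} (u : A → Y) (v : B → Y) : A.sum B → Y := Sum.elim u v

theorem sumDesc_contMDiff {A B Y : Mfd m} {u : A → Y} {v : B → Y}
    (hu : ContMDiff (mdl m) (mdl m) ∞ u) (hv : ContMDiff (mdl m) (mdl m) ∞ v) :
    ContMDiff (mdl m) (mdl m) ∞ (sumDesc u v) :=
  (isSum_sum A B).contMDiff hu hv

variable {M₁ M₂ M₃ N₁ N₂ N₃ : ClosedMfd m}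

/-- The disjoint union of two bordisms. -/
abbrev Bordism.sum (W : Bordism M₁ M₂) (V : Bordism N₁ N₂) :
    Bordism (M₁.sum N₁) (M₂.sum N₂) where
  W := W.W.sum V.W
  i₁ := collarSum W.i₁ V.i₁
  i₂ := collarSum W.i₂ V.i₂
  boundary := sum_ind
    (fun w => by
      rw [sumL_mem_bd, W.boundary]
      constructor
      · rintro (⟨x, rfl⟩ | ⟨x, rfl⟩)
        · exact .inl ⟨.inl x, rfl⟩
        · exact .inr ⟨.inl x, rfl⟩
      · rintro (⟨x | x, h⟩ | ⟨x | x, h⟩)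
        · exact .inl ⟨x, sumL_inj.1 h⟩
        · exact absurd h.symm sumL_ne_sumR
        · exact .inr ⟨x, sumL_inj.1 h⟩
        · exact absurd h.symm sumL_ne_sumR)
    (fun w => by
      rw [sumR_mem_bd, V.boundary]
      constructor
      · rintro (⟨x, rfl⟩ | ⟨x, rfl⟩)
        · exact .inl ⟨.inr x, rfl⟩
        · exact .inr ⟨.inr x, rfl⟩
      · rintro (⟨x | x, h⟩ | ⟨x | x, h⟩)
        · exact absurd h sumL_ne_sumR
        · exact .inl ⟨x, sumR_inj.1 h⟩
        · exact absurd h sumL_ne_sumR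
        · exact .inr ⟨x, sumR_inj.1 h⟩)
  meet := by
    rintro (x | x) (y | y) t u h
    · obtain ⟨h1, h2⟩ := W.meet x y t u (sumL_inj.1 h)
      exact ⟨h1, fun v => congrArg (sumL W.W V.W).toFun (h2 v)⟩
    · exact absurd h sumL_ne_sumR
    · exact absurd h.symm sumL_ne_sumR
    · obtain ⟨h1, h2⟩ := V.meet x y t u (sumR_inj.1 h)
      exact ⟨h1, fun v => congrArg (sumR W.W V.W).toFun (h2 v)⟩

namespace CollarDiffeo

/-- The disjoint union of two diffeomorphisms. -/
def sum {W W' : Bordism M₁ M₂} {V V' : Bordism N₁ N₂} (φ : CollarDiffeo W W')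
    (ψ : CollarDiffeo V V') : CollarDiffeo (W.sum V) (W'.sum V') where
  diffeo := Diffeomorph.sumCongr φ.diffeo ψ.diffeo
  collar₁ := cylSum_ind (fun p => congrArg (sumL W'.W V'.W).toFun (φ.collar₁ p))
    (fun p => congrArg (sumR W'.W V'.W).toFun (ψ.collar₁ p))
  collar₂ := cylSum_ind (fun p => congrArg (sumL W'.W V'.W).toFun (φ.collar₂ p))
    (fun p => congrArg (sumR W'.W V'.W).toFun (ψ.collar₂ p))

theorem Isotopic.sum_left {W W' : Bordism M₁ M₂} {V V' : Bordism N₁ N₂} {φ φ' : CollarDiffeo W W'}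
    (h : Isotopic φ φ') (ψ : CollarDiffeo V V') : Isotopic (φ.sum ψ) (φ'.sum ψ) := by
  obtain ⟨h, hh, h1⟩ := h
  refine ⟨fun p => sumDesc (A := W'.W) (B := V'.W) (fun a => (sumL W'.W V'.W).toFun (h (a, p.2)))
    (fun b => (sumR W'.W V'.W).toFun b) p.1, ⟨?_, fun t => ?_, ?_, ?_⟩, ?_⟩
  · exact (isSum_sum W'.W V'.W).contMDiff_prod ((sumL W'.W V'.W).tame.smooth.comp hh.smooth)
      ((sumR W'.W V'.W).tame.smooth.comp contMDiff_fst)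
  · obtain ⟨χ, hχ⟩ := hh.diffeo t
    exact ⟨Diffeomorph.sumCongr χ (.refl _ _ _), sum_ind
      (fun a => congrArg (sumL W'.W V'.W).toFun (hχ a)) fun b => rfl⟩
  · exact sum_ind (fun a => congrArg (sumL W'.W V'.W).toFun (hh.zero a)) fun b => rfl
  · rintro _ (⟨⟨p | p, s⟩, rfl⟩ | ⟨⟨p | p, s⟩, rfl⟩) t
    · exact congrArg (sumL W'.W V'.W).toFun (hh.fixed _ (.inl ⟨pt p s, rfl⟩) t)
    · rfl
    · exact congrArg (sumL W'.W V'.W).toFun (hh.fixed _ (.inr ⟨pt p s, rfl⟩) t)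
    · rfl
  · exact sum_ind (fun a => congrArg (sumL W'.W V'.W).toFun (h1 a)) fun b => rfl

theorem Isotopic.sum_right {W W' : Bordism M₁ M₂} {V V' : Bordism N₁ N₂} {ψ ψ' : CollarDiffeo V V'}
    (h : Isotopic ψ ψ') (φ : CollarDiffeo W W') : Isotopic (φ.sum ψ) (φ.sum ψ') := by
  obtain ⟨h, hh, h1⟩ := h
  refine ⟨fun p => sumDesc (A := W'.W) (B := V'.W) (fun a => (sumL W'.W V'.W).toFun a)
    (fun b => (sumR W'.W V'.W).toFun (h (b, p.2))) p.1, ⟨?_, fun t => ?_, ?_, ?_⟩, ?_⟩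
  · exact (isSum_sum W'.W V'.W).contMDiff_prod ((sumL W'.W V'.W).tame.smooth.comp contMDiff_fst)
      ((sumR W'.W V'.W).tame.smooth.comp hh.smooth)
  · obtain ⟨χ, hχ⟩ := hh.diffeo t
    exact ⟨Diffeomorph.sumCongr (.refl _ _ _) χ, sum_ind
      (fun a => rfl) fun b => congrArg (sumR W'.W V'.W).toFun (hχ b)⟩
  · exact sum_ind (fun a => rfl) fun b => congrArg (sumR W'.W V'.W).toFun (hh.zero b)
  · rintro _ (⟨⟨p | p, s⟩, rfl⟩ | ⟨⟨p | p, s⟩, rfl⟩) t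
    · rfl
    · exact congrArg (sumR W'.W V'.W).toFun (hh.fixed _ (.inl ⟨pt p s, rfl⟩) t)
    · rfl
    · exact congrArg (sumR W'.W V'.W).toFun (hh.fixed _ (.inr ⟨pt p s, rfl⟩) t)
  · exact sum_ind (fun a => rfl) fun b => congrArg (sumR W'.W V'.W).toFun (h1 b)

/-- The disjoint union of two cylinders is a cylinder. -/
def sumOne (M N : ClosedMfd m) : CollarDiffeo ((one M).sum (one N)) (one (M.sum N)) where
  diffeo :=
    { toFun := sumDesc (cylL M N).toFun (cylR M N).toFun
      invFun := (collarSum (𝟙 M.cyl) (𝟙 N.cyl)).toFun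
      left_inv := sum_ind (fun _ => rfl) fun _ => rfl
      right_inv := cylSum_ind (fun _ => rfl) fun _ => rfl
      contMDiff_toFun := sumDesc_contMDiff (cylL M N).tame.smooth (cylR M N).tame.smooth
      contMDiff_invFun := (collarSum (𝟙 M.cyl) (𝟙 N.cyl)).tame.smooth }
  collar₁ := cylSum_ind (fun _ => rfl) fun _ => rfl
  collar₂ := cylSum_ind (fun _ => rfl) fun _ => rfl

/-- Disjoint union commutes with gluing. -/
def sumComp (A : Bordism M₁ M₂) (B : Bordism M₂ M₃) (A' : Bordism N₁ N₂) (B' : Bordism N₂ N₃) :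
    CollarDiffeo ((A.comp B).sum (A'.comp B')) ((A.sum A').comp (B.sum B')) where
  diffeo :=
    { toFun := sumDesc
        (Bordism.desc A B (sumL A.W A'.W ≫ jL (A.sum A') (B.sum B')).toFun
          (sumL B.W B'.W ≫ jR (A.sum A') (B.sum B')).toFun
          fun o => glue_comm_apply (A.sum A') (B.sum B') ((cylL M₂ N₂).toFun o))
        (Bordism.desc A' B' (sumR A.W A'.W ≫ jL (A.sum A') (B.sum B')).toFun
          (sumR B.W B'.W ≫ jR (A.sum A') (B.sum B')).toFun
          fun o => glue_comm_apply (A.sum A') (B.sum B') ((cylR M₂ N₂).toFun o))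
      invFun := Bordism.desc (A.sum A') (B.sum B')
        (sumDesc (jL A B ≫ sumL (Bordism.glue A B) (Bordism.glue A' B')).toFun
          (jL A' B' ≫ sumR (Bordism.glue A B) (Bordism.glue A' B')).toFun)
        (sumDesc (jR A B ≫ sumL (Bordism.glue A B) (Bordism.glue A' B')).toFun
          (jR A' B' ≫ sumR (Bordism.glue A B) (Bordism.glue A' B')).toFun)
        (cylSum_ind
          (fun o => congrArg (sumL (Bordism.glue A B) (Bordism.glue A' B')).toFun
            (glue_comm_apply A B o))
          (fun o => congrArg (sumR (Bordism.glue A B) (Bordism.glue A' B')).toFun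
            (glue_comm_apply A' B' o)))
      left_inv := sum_ind (glue_ind A B (fun _ => rfl) fun _ => rfl)
        (glue_ind A' B' (fun _ => rfl) fun _ => rfl)
      right_inv := glue_ind (A.sum A') (B.sum B') (sum_ind (fun _ => rfl) fun _ => rfl)
        (sum_ind (fun _ => rfl) fun _ => rfl)
      contMDiff_toFun := sumDesc_contMDiff
        (glue_contMDiff A B (sumL A.W A'.W ≫ jL (A.sum A') (B.sum B')).tame.smooth
          (sumL B.W B'.W ≫ jR (A.sum A') (B.sum B')).tame.smooth)
        (glue_contMDiff A' B' (sumR A.W A'.W ≫ jL (A.sum A') (B.sum B')).tame.smooth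
          (sumR B.W B'.W ≫ jR (A.sum A') (B.sum B')).tame.smooth)
      contMDiff_invFun := glue_contMDiff (A.sum A') (B.sum B')
        (sumDesc_contMDiff (jL A B ≫ sumL (Bordism.glue A B) (Bordism.glue A' B')).tame.smooth
          (jL A' B' ≫ sumR (Bordism.glue A B) (Bordism.glue A' B')).tame.smooth)
        (sumDesc_contMDiff (jR A B ≫ sumL (Bordism.glue A B) (Bordism.glue A' B')).tame.smooth
          (jR A' B' ≫ sumR (Bordism.glue A B) (Bordism.glue A' B')).tame.smooth) }
  collar₁ := cylSum_ind (fun _ => rfl) fun _ => rfl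
  collar₂ := cylSum_ind (fun _ => rfl) fun _ => rfl

end CollarDiffeo

/-- The disjoint union of two classes of diffeomorphisms. -/
def DClass.sum {W W' : Bordism M₁ M₂} {V V' : Bordism N₁ N₂} :
    DClass W W' → DClass V V' → DClass (W.sum V) (W'.sum V') :=
  Quot.map₂ CollarDiffeo.sum (fun φ _ _ h => h.sum_right φ) (fun _ _ ψ h => h.sum_left ψ)

namespace DClass

theorem sumL_toEmb {W W' : Bordism M₁ M₂} {V V' : Bordism N₁ N₂} (φ : DClass W W')
    (ψ : DClass V V') :
    cls (sumL W.W V.W) ≫ (φ.sum ψ).toEmb = φ.toEmb ≫ cls (sumL W'.W V'.W) := by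
  induction φ using ind with | h φ
  induction ψ using ind with | h ψ
  exact (cls_comp _ _).symm.trans (cls_comp (ofDiffeo φ.diffeo) (sumL W'.W V'.W))

theorem sumR_toEmb {W W' : Bordism M₁ M₂} {V V' : Bordism N₁ N₂} (φ : DClass W W')
    (ψ : DClass V V') :
    cls (sumR W.W V.W) ≫ (φ.sum ψ).toEmb = ψ.toEmb ≫ cls (sumR W'.W V'.W) := by
  induction φ using ind with | h φ
  induction ψ using ind with | h ψ
  exact (cls_comp _ _).symm.trans (cls_comp (ofDiffeo ψ.diffeo) (sumR W'.W V'.W))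

theorem sum_trans {W W' W'' : Bordism M₁ M₂} {V V' V'' : Bordism N₁ N₂} (φ : DClass W W')
    (φ' : DClass W' W'') (ψ : DClass V V') (ψ' : DClass V' V'') :
    (φ.trans φ').sum (ψ.trans ψ') = (φ.sum ψ).trans (φ'.sum ψ') := by
  induction φ using ind with | h φ
  induction ψ using ind with | h ψ
  induction φ' using ind with | h φ'
  induction ψ' using ind with | h ψ'
  exact congrArg mk (CollarDiffeo.ext' (sum_ind (fun _ => rfl) fun _ => rfl))

theorem sum_id (W : Bordism M₁ M₂) (V : Bordism N₁ N₂) :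
    (mk (.refl W)).sum (mk (.refl V)) = mk (.refl (W.sum V)) :=
  congrArg mk (CollarDiffeo.ext' (sum_ind (fun _ => rfl) fun _ => rfl))

theorem sum_glue {A C : Bordism M₁ M₂} {B D : Bordism M₂ M₃} {A' C' : Bordism N₁ N₂}
    {B' D' : Bordism N₂ N₃} (φ : DClass A C) (ψ : DClass B D) (φ' : DClass A' C')
    (ψ' : DClass B' D') :
    ((φ.glue ψ).sum (φ'.glue ψ')).trans (mk (.sumComp C D C' D')) =
      (mk (.sumComp A B A' B')).trans ((φ.sum φ').glue (ψ.sum ψ')) := by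
  induction φ using ind with | h φ
  induction ψ using ind with | h ψ
  induction φ' using ind with | h φ'
  induction ψ' using ind with | h ψ'
  exact congrArg mk (CollarDiffeo.ext' (sum_ind (glue_ind A B (fun _ => rfl) fun _ => rfl)
    (glue_ind A' B' (fun _ => rfl) fun _ => rfl)))

end DClass

end

end FieldTheory

namespace FieldTheory

open CategoryTheory Set Function Topology

noncomputable section

universe v u

variable {m : ℕ} {S : (Emb m)ᵒᵖ ⥤ Cat.{v, u}}

open Bordism EEmb

theorem IsSum.isCover₂ {A B X : Mfd m} {j : A ⟶ X} {j' : B ⟶ X} (h : IsSum j.toFun j'.toFun) :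
    IsCover₂ (fromEmpty (ClosedMfd.empty m).cyl A) (fromEmpty (ClosedMfd.empty m).cyl B) j j' where
  comm := temb_ext fun o => isEmptyElim o
  surj := h.surj
  inter a b e := absurd e (h.disj a b)

/-- The empty cover. -/
def emptyCover (X : Mfd m) [IsEmpty X] : Cover X Empty where
  W := Empty.elim
  inc a := a.elim
  ov a := a.elim
  p a := a.elim
  q a := a.elim
  comm a := a.elim
  surj x := isEmptyElim x
  inter a := a.elim

namespace IsSheaf

theorem exists_sec_empty (hS : IsSheaf S) (X : Mfd m) [IsEmpty X] : ∃ x : Sec S X, ∀ y, y = x := by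
  obtain ⟨x, -, h⟩ := hS.glueObj (emptyCover X) (fun a => a.elim) (fun a => a.elim)
  exact ⟨x, fun y => h y fun a => a.elim⟩

theorem sec_empty_ext (hS : IsSheaf S) {X : Mfd m} [IsEmpty X] (x y : Sec S X) : x = y := by
  obtain ⟨z, h⟩ := hS.exists_sec_empty X
  rw [h x, h y]

theorem emb_empty_ext {X : Mfd m} [IsEmpty X] {Y : Mfd m} (e f : emb X ⟶ emb Y) : e = f := by
  obtain ⟨e, rfl⟩ := (Quotient.functor (Diffeotopic (m := m))).map_surjective e
  obtain ⟨f, rfl⟩ := (Quotient.functor (Diffeotopic (m := m))).map_surjective f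
  exact congrArg cls (temb_ext fun x => isEmptyElim x)

theorem hom_empty_ext (hS : IsSheaf S) {X Y : EEmb S} [IsEmpty X.mfd] (e f : X ⟶ Y) : e = f :=
  hS.hom_ext (emptyCover X.mfd) (emb_empty_ext _ _) fun a => a.elim

end IsSheaf

namespace Bd

variable {hS : IsSheaf S}

theorem exists_sum_sec (hS : IsSheaf S) {A B X : Mfd m} {j : A ⟶ X} {j' : B ⟶ X}
    (h : IsSum j.toFun j'.toFun) (s : Sec S A) (t : Sec S B) :
    ∃ x : Sec S X, (res S (cls j)).obj x = s ∧ (res S (cls j')).obj x = t :=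
  (h.isCover₂.exists_sec hS s t (hS.sec_empty_ext _ _)).exists

theorem isSum_cyl' (M N : ClosedMfd m) : IsSum (cylL M N).toFun (cylR M N).toFun := isSum_cyl M N
theorem isSum_sum' (A B : Mfd m) : IsSum (sumL A B).toFun (sumR A B).toFun := isSum_sum A B

/-- The disjoint union of closed manifolds with sections. -/
def sum (X Y : Bd hS) : Bd hS where
  mfd := X.mfd.sum Y.mfd
  sec := (exists_sum_sec hS (isSum_cyl' X.mfd Y.mfd) X.sec Y.sec).choose

theorem sum_secL (X Y : Bd hS) : (res S (cls (cylL X.mfd Y.mfd))).obj (sum X Y).sec = X.sec :=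
  (exists_sum_sec hS (isSum_cyl' X.mfd Y.mfd) X.sec Y.sec).choose_spec.1
theorem sum_secR (X Y : Bd hS) : (res S (cls (cylR X.mfd Y.mfd))).obj (sum X Y).sec = Y.sec :=
  (exists_sum_sec hS (isSum_cyl' X.mfd Y.mfd) X.sec Y.sec).choose_spec.2

/-- The inclusion of the first closed manifold in the disjoint union. -/
def sumInl (X Y : Bd hS) : X.obj ⟶ (sum X Y).obj := lift (cls (cylL X.mfd Y.mfd)) (sum_secL X Y)
/-- The inclusion of the second closed manifold in the disjoint union. -/
def sumInr (X Y : Bd hS) : Y.obj ⟶ (sum X Y).obj := lift (cls (cylR X.mfd Y.mfd)) (sum_secR X Y)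

theorem sum_sec_ext {X Y : Bd hS} {x : Sec S (X.mfd.sum Y.mfd).cyl}
    (h : (res S (cls (cylL X.mfd Y.mfd))).obj x = X.sec)
    (h' : (res S (cls (cylR X.mfd Y.mfd))).obj x = Y.sec) : x = (sum X Y).sec :=
  (isSum_cyl' X.mfd Y.mfd).isCover₂.sec_ext hS (h.trans (sum_secL X Y).symm)
    (h'.trans (sum_secR X Y).symm)

theorem sum_hom_ext {X Y : Bd hS} {E : EEmb S} {k l : (sum X Y).obj ⟶ E} (hb : k.base = l.base)
    (e : sumInl X Y ≫ k = sumInl X Y ≫ l) (e' : sumInr X Y ≫ k = sumInr X Y ≫ l) : k = l :=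
  (isSum_cyl' X.mfd Y.mfd).isCover₂.hom_ext hS (sum_secL X Y) (sum_secR X Y) hb e e'

variable {X X' Y Y' Z Z' T T' : Bd hS}

theorem exists_sum_sec' (A : Hom X Y) (B : Hom X' Y') : ∃ x : Sec S (A.bord.W.sum B.bord.W),
    (res S (cls (sumL A.bord.W B.bord.W))).obj x = A.sec ∧
      (res S (cls (sumR A.bord.W B.bord.W))).obj x = B.sec :=
  exists_sum_sec hS (isSum_sum' A.bord.W B.bord.W) A.sec B.sec

/-- The disjoint union of bordisms with sections. -/
abbrev homSum (A : Hom X Y) (B : Hom X' Y') : Hom (sum X X') (sum Y Y') where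
  bord := A.bord.sum B.bord
  sec := (exists_sum_sec' A B).choose
  sec₁ := by
    obtain ⟨h₁, h₂⟩ := (exists_sum_sec' A B).choose_spec
    apply sum_sec_ext
    · refine (res_cls_comp_obj S _ _ _).symm.trans ?_
      refine (res_cls_comp_obj S A.bord.i₁ (sumL A.bord.W B.bord.W) _).trans ?_
      rw [h₁, A.sec₁]
    · refine (res_cls_comp_obj S _ _ _).symm.trans ?_
      refine (res_cls_comp_obj S B.bord.i₁ (sumR A.bord.W B.bord.W) _).trans ?_
      rw [h₂, B.sec₁]
  sec₂ := by
    obtain ⟨h₁, h₂⟩ := (exists_sum_sec' A B).choose_spec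
    apply sum_sec_ext
    · refine (res_cls_comp_obj S _ _ _).symm.trans ?_
      refine (res_cls_comp_obj S A.bord.i₂ (sumL A.bord.W B.bord.W) _).trans ?_
      rw [h₁, A.sec₂]
    · refine (res_cls_comp_obj S _ _ _).symm.trans ?_
      refine (res_cls_comp_obj S B.bord.i₂ (sumR A.bord.W B.bord.W) _).trans ?_
      rw [h₂, B.sec₂]

theorem homSum_secL (A : Hom X Y) (B : Hom X' Y') :
    (res S (cls (sumL A.bord.W B.bord.W))).obj (homSum A B).sec = A.sec :=
  (exists_sum_sec' A B).choose_spec.1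
theorem homSum_secR (A : Hom X Y) (B : Hom X' Y') :
    (res S (cls (sumR A.bord.W B.bord.W))).obj (homSum A B).sec = B.sec :=
  (exists_sum_sec' A B).choose_spec.2

/-- The inclusion of the first bordism in the disjoint union. -/
def homInl (A : Hom X Y) (B : Hom X' Y') : A.obj ⟶ (homSum A B).obj :=
  lift (cls (sumL A.bord.W B.bord.W)) (homSum_secL A B)
/-- The inclusion of the second bordism in the disjoint union. -/
def homInr (A : Hom X Y) (B : Hom X' Y') : B.obj ⟶ (homSum A B).obj :=
  lift (cls (sumR A.bord.W B.bord.W)) (homSum_secR A B)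

theorem homSum_sec_ext {A : Hom X Y} {B : Hom X' Y'} {x : Sec S (A.bord.W.sum B.bord.W)}
    (h : (res S (cls (sumL A.bord.W B.bord.W))).obj x = A.sec)
    (h' : (res S (cls (sumR A.bord.W B.bord.W))).obj x = B.sec) : x = (homSum A B).sec :=
  (isSum_sum' A.bord.W B.bord.W).isCover₂.sec_ext hS (h.trans (homSum_secL A B).symm)
    (h'.trans (homSum_secR A B).symm)

theorem homSum_hom_ext {A : Hom X Y} {B : Hom X' Y'} {E : EEmb S} {k l : (homSum A B).obj ⟶ E}
    (hb : k.base = l.base) (e : homInl A B ≫ k = homInl A B ≫ l)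
    (e' : homInr A B ≫ k = homInr A B ≫ l) : k = l :=
  (isSum_sum' A.bord.W B.bord.W).isCover₂.hom_ext hS (homSum_secL A B) (homSum_secR A B) hb e e'

theorem homSum_cell_ext {A : Hom X Y} {B : Hom X' Y'} {V : Hom (sum X X') (sum Y Y')}
    {σ τ : homSum A B ⟶ V} (h : σ.cl = τ.cl) (h₁ : homInl A B ≫ σ.hom = homInl A B ≫ τ.hom)
    (h₂ : homInr A B ≫ σ.hom = homInr A B ≫ τ.hom) : σ = τ :=
  Cell.ext' h (homSum_hom_ext (cell_base h) h₁ h₂)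

theorem sumInl_in₁ (A : Hom X Y) (B : Hom X' Y') :
    sumInl X X' ≫ (homSum A B).in₁ = A.in₁ ≫ homInl A B :=
  lift₂₂ (h' := (homSum A B).sec₁) fun _ => rfl
theorem sumInr_in₁ (A : Hom X Y) (B : Hom X' Y') :
    sumInr X X' ≫ (homSum A B).in₁ = B.in₁ ≫ homInr A B :=
  lift₂₂ (h' := (homSum A B).sec₁) fun _ => rfl
theorem sumInl_in₂ (A : Hom X Y) (B : Hom X' Y') :
    sumInl Y Y' ≫ (homSum A B).in₂ = A.in₂ ≫ homInl A B :=
  lift₂₂ (h' := (homSum A B).sec₂) fun _ => rfl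
theorem sumInr_in₂ (A : Hom X Y) (B : Hom X' Y') :
    sumInr Y Y' ≫ (homSum A B).in₂ = B.in₂ ≫ homInr A B :=
  lift₂₂ (h' := (homSum A B).sec₂) fun _ => rfl

theorem exists_cellSum {A A' : Hom X Y} {B B' : Hom X' Y'} (σ : A ⟶ A') (τ : B ⟶ B') :
    ∃ d : (homSum A B).obj ⟶ (homSum A' B').obj, d.base = (DClass.sum σ.cl τ.cl).toEmb ∧
      homInl A B ≫ d = σ.hom ≫ homInl A' B' ∧ homInr A B ≫ d = τ.hom ≫ homInr A' B' := by
  refine (isSum_sum' A.bord.W B.bord.W).isCover₂.exists_hom hS (homSum_secL A B) (homSum_secR A B)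
    (Y := (homSum A' B').obj) (DClass.sum σ.cl τ.cl).toEmb (σ.hom ≫ homInl A' B')
    (τ.hom ≫ homInr A' B') ?_ ?_ rfl (hS.sec_empty_ext _ _) ?_
  · rw [comp_base, σ.base_eq]; exact (DClass.sumL_toEmb _ _).symm
  · rw [comp_base, τ.base_eq]; exact (DClass.sumR_toEmb _ _).symm
  · have : IsEmpty (EEmb.mfd (⟨(ClosedMfd.empty m).cyl, (res S (cls (fromEmpty
      (ClosedMfd.empty m).cyl A.bord.W))).obj A.sec⟩ : EEmb S)) :=
        inferInstanceAs (IsEmpty (ClosedMfd.empty m).cyl)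
    exact hS.hom_empty_ext _ _

/-- The disjoint union of `2`-cells. -/
def cellSum {A A' : Hom X Y} {B B' : Hom X' Y'} (σ : A ⟶ A') (τ : B ⟶ B') :
    homSum A B ⟶ homSum A' B' where
  cl := DClass.sum σ.cl τ.cl
  hom := (exists_cellSum σ τ).choose
  base_eq := (exists_cellSum σ τ).choose_spec.1
  comm₁ := by
    obtain ⟨h, h₁, h₂⟩ := (exists_cellSum σ τ).choose_spec
    refine sum_hom_ext ?_ ?_ ?_
    · rw [comp_base, h]; exact DClass.i₁_toEmb (DClass.sum σ.cl τ.cl)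
    · rw [← Category.assoc, sumInl_in₁, Category.assoc, h₁, ← Category.assoc, σ.comm₁, sumInl_in₁]
    · rw [← Category.assoc, sumInr_in₁, Category.assoc, h₂, ← Category.assoc, τ.comm₁, sumInr_in₁]
  comm₂ := by
    obtain ⟨h, h₁, h₂⟩ := (exists_cellSum σ τ).choose_spec
    refine sum_hom_ext ?_ ?_ ?_
    · rw [comp_base, h]; exact DClass.i₂_toEmb (DClass.sum σ.cl τ.cl)
    · rw [← Category.assoc, sumInl_in₂, Category.assoc, h₁, ← Category.assoc, σ.comm₂, sumInl_in₂]
    · rw [← Category.assoc, sumInr_in₂, Category.assoc, h₂, ← Category.assoc, τ.comm₂, sumInr_in₂]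

theorem homInl_cellSum {A A' : Hom X Y} {B B' : Hom X' Y'} (σ : A ⟶ A') (τ : B ⟶ B') :
    homInl A B ≫ (cellSum σ τ).hom = σ.hom ≫ homInl A' B' := (exists_cellSum σ τ).choose_spec.2.1
theorem homInr_cellSum {A A' : Hom X Y} {B B' : Hom X' Y'} (σ : A ⟶ A') (τ : B ⟶ B') :
    homInr A B ≫ (cellSum σ τ).hom = τ.hom ≫ homInr A' B' := (exists_cellSum σ τ).choose_spec.2.2
theorem homInl_cellSum' {A A' : Hom X Y} {B B' : Hom X' Y'} (σ : A ⟶ A') (τ : B ⟶ B') {E : EEmb S}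
    (k : (homSum A' B').obj ⟶ E) :
    homInl A B ≫ (cellSum σ τ).hom ≫ k = σ.hom ≫ homInl A' B' ≫ k := by
  rw [← Category.assoc, homInl_cellSum, Category.assoc]
theorem homInr_cellSum' {A A' : Hom X Y} {B B' : Hom X' Y'} (σ : A ⟶ A') (τ : B ⟶ B') {E : EEmb S}
    (k : (homSum A' B').obj ⟶ E) :
    homInr A B ≫ (cellSum σ τ).hom ≫ k = τ.hom ≫ homInr A' B' ≫ k := by
  rw [← Category.assoc, homInr_cellSum, Category.assoc]

theorem sumOne_sec (X Y : Bd hS) :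
    (res S (cls (ofDiffeo (CollarDiffeo.sumOne X.mfd Y.mfd).diffeo))).obj (one (sum X Y)).sec =
      (homSum (one X) (one Y)).sec := by
  refine homSum_sec_ext (A := one X) (B := one Y) ?_ ?_
  · exact (res_cls_comp_obj S _ _ _).symm.trans (sum_secL X Y)
  · exact (res_cls_comp_obj S _ _ _).symm.trans (sum_secR X Y)

theorem sumComp_sec (A : Hom X Y) (B : Hom Y Z) (A' : Hom X' Y') (B' : Hom Y' Z') :
    (res S (cls (ofDiffeo (CollarDiffeo.sumComp A.bord B.bord A'.bord B'.bord).diffeo))).obj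
      (comp (homSum A A') (homSum B B')).sec = (homSum (comp A B) (comp A' B')).sec := by
  refine homSum_sec_ext (A := comp A B) (B := comp A' B') ?_ ?_
  · refine (res_cls_comp_obj S _ _ _).symm.trans ?_
    refine comp_sec_ext (A := A) (B := B) ?_ ?_
    · refine (res_cls_comp_obj S _ _ _).symm.trans ?_
      refine Eq.trans (res_cls_comp_obj S (sumL A.bord.W A'.bord.W)
        (jL (A.bord.sum A'.bord) (B.bord.sum B'.bord)) _) ?_
      exact (congrArg _ (comp_secL (homSum A A') (homSum B B'))).trans (homSum_secL A A')
    · refine (res_cls_comp_obj S _ _ _).symm.trans ?_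
      refine Eq.trans (res_cls_comp_obj S (sumL B.bord.W B'.bord.W)
        (jR (A.bord.sum A'.bord) (B.bord.sum B'.bord)) _) ?_
      exact (congrArg _ (comp_secR (homSum A A') (homSum B B'))).trans (homSum_secL B B')
  · refine (res_cls_comp_obj S _ _ _).symm.trans ?_
    refine comp_sec_ext (A := A') (B := B') ?_ ?_
    · refine (res_cls_comp_obj S _ _ _).symm.trans ?_
      refine Eq.trans (res_cls_comp_obj S (sumR A.bord.W A'.bord.W)
        (jL (A.bord.sum A'.bord) (B.bord.sum B'.bord)) _) ?_
      exact (congrArg _ (comp_secL (homSum A A') (homSum B B'))).trans (homSum_secR A A')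
    · refine (res_cls_comp_obj S _ _ _).symm.trans ?_
      refine Eq.trans (res_cls_comp_obj S (sumR B.bord.W B'.bord.W)
        (jR (A.bord.sum A'.bord) (B.bord.sum B'.bord)) _) ?_
      exact (congrArg _ (comp_secR (homSum A A') (homSum B B'))).trans (homSum_secR B B')

/-- The disjoint union of identities is an identity. -/
def sumOne (X Y : Bd hS) : homSum (one X) (one Y) ≅ one (sum X Y) :=
  isoOfDiffeo (CollarDiffeo.sumOne X.mfd Y.mfd) (sumOne_sec X Y)

/-- Disjoint unions commute with composition. -/
def sumComp (A : Hom X Y) (B : Hom Y Z) (A' : Hom X' Y') (B' : Hom Y' Z') :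
    homSum (comp A B) (comp A' B') ≅ comp (homSum A A') (homSum B B') :=
  isoOfDiffeo (CollarDiffeo.sumComp A.bord B.bord A'.bord B'.bord) (sumComp_sec A B A' B')

theorem homInl_sumOne (X Y : Bd hS) : homInl (one X) (one Y) ≫ (sumOne X Y).hom.hom = sumInl X Y :=
  lift₂₁ (h' := sumOne_sec X Y) fun _ => rfl
theorem homInr_sumOne (X Y : Bd hS) : homInr (one X) (one Y) ≫ (sumOne X Y).hom.hom = sumInr X Y :=
  lift₂₁ (h' := sumOne_sec X Y) fun _ => rfl
theorem homInl_sumOne' (X Y : Bd hS) {E : EEmb S} (k : (sum X Y).obj ⟶ E) :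
    homInl (one X) (one Y) ≫ (sumOne X Y).hom.hom ≫ k = sumInl X Y ≫ k :=
  (Category.assoc _ _ _).symm.trans (congrArg (· ≫ k) (homInl_sumOne X Y))
theorem homInr_sumOne' (X Y : Bd hS) {E : EEmb S} (k : (sum X Y).obj ⟶ E) :
    homInr (one X) (one Y) ≫ (sumOne X Y).hom.hom ≫ k = sumInr X Y ≫ k :=
  (Category.assoc _ _ _).symm.trans (congrArg (· ≫ k) (homInr_sumOne X Y))
theorem inL_homInl_sumComp (A : Hom X Y) (B : Hom Y Z) (A' : Hom X' Y') (B' : Hom Y' Z') :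
    inL A B ≫ homInl (comp A B) (comp A' B') ≫ (sumComp A B A' B').hom.hom =
      homInl A A' ≫ inL (homSum A A') (homSum B B') :=
  lift₃₂ (h₃ := sumComp_sec A B A' B') fun _ => rfl
theorem inR_homInl_sumComp (A : Hom X Y) (B : Hom Y Z) (A' : Hom X' Y') (B' : Hom Y' Z') :
    inR A B ≫ homInl (comp A B) (comp A' B') ≫ (sumComp A B A' B').hom.hom =
      homInl B B' ≫ inR (homSum A A') (homSum B B') :=
  lift₃₂ (h₃ := sumComp_sec A B A' B') fun _ => rfl
theorem inL_homInr_sumComp (A : Hom X Y) (B : Hom Y Z) (A' : Hom X' Y') (B' : Hom Y' Z') :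
    inL A' B' ≫ homInr (comp A B) (comp A' B') ≫ (sumComp A B A' B').hom.hom =
      homInr A A' ≫ inL (homSum A A') (homSum B B') :=
  lift₃₂ (h₃ := sumComp_sec A B A' B') fun _ => rfl
theorem inR_homInr_sumComp (A : Hom X Y) (B : Hom Y Z) (A' : Hom X' Y') (B' : Hom Y' Z') :
    inR A' B' ≫ homInr (comp A B) (comp A' B') ≫ (sumComp A B A' B').hom.hom =
      homInr B B' ≫ inR (homSum A A') (homSum B B') :=
  lift₃₂ (h₃ := sumComp_sec A B A' B') fun _ => rfl

theorem inL_homInl_sumComp' (A : Hom X Y) (B : Hom Y Z) (A' : Hom X' Y') (B' : Hom Y' Z')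
    {E : EEmb S} (k : (comp (homSum A A') (homSum B B')).obj ⟶ E) :
    inL A B ≫ homInl (comp A B) (comp A' B') ≫ (sumComp A B A' B').hom.hom ≫ k =
      homInl A A' ≫ inL (homSum A A') (homSum B B') ≫ k := by
  have := congrArg (· ≫ k) (inL_homInl_sumComp A B A' B'); simpa using this
theorem inR_homInl_sumComp' (A : Hom X Y) (B : Hom Y Z) (A' : Hom X' Y') (B' : Hom Y' Z')
    {E : EEmb S} (k : (comp (homSum A A') (homSum B B')).obj ⟶ E) :
    inR A B ≫ homInl (comp A B) (comp A' B') ≫ (sumComp A B A' B').hom.hom ≫ k =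
      homInl B B' ≫ inR (homSum A A') (homSum B B') ≫ k := by
  have := congrArg (· ≫ k) (inR_homInl_sumComp A B A' B'); simpa using this
theorem inL_homInr_sumComp' (A : Hom X Y) (B : Hom Y Z) (A' : Hom X' Y') (B' : Hom Y' Z')
    {E : EEmb S} (k : (comp (homSum A A') (homSum B B')).obj ⟶ E) :
    inL A' B' ≫ homInr (comp A B) (comp A' B') ≫ (sumComp A B A' B').hom.hom ≫ k =
      homInr A A' ≫ inL (homSum A A') (homSum B B') ≫ k := by
  have := congrArg (· ≫ k) (inL_homInr_sumComp A B A' B'); simpa using this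
theorem inR_homInr_sumComp' (A : Hom X Y) (B : Hom Y Z) (A' : Hom X' Y') (B' : Hom Y' Z')
    {E : EEmb S} (k : (comp (homSum A A') (homSum B B')).obj ⟶ E) :
    inR A' B' ≫ homInr (comp A B) (comp A' B') ≫ (sumComp A B A' B').hom.hom ≫ k =
      homInr B B' ≫ inR (homSum A A') (homSum B B') ≫ k := by
  have := congrArg (· ≫ k) (inR_homInr_sumComp A B A' B'); simpa using this

section Laws

attribute [local simp] inL_hcomp inR_hcomp inL_hcomp' inR_hcomp' inLL_assoc inRL_assoc inR_assoc
  inLL_assoc' inRL_assoc' inR_assoc' inL_leftUnit inR_leftUnit inL_rightUnit inR_rightUnit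
  inL_leftUnit' inR_leftUnit' inL_rightUnit' inR_rightUnit' comm₁' comm₂' Cell.comm₁ Cell.comm₂
  homInl_cellSum homInr_cellSum homInl_cellSum' homInr_cellSum' homInl_sumOne homInr_sumOne homInl_sumOne'
  homInr_sumOne'
  inL_homInl_sumComp inR_homInl_sumComp inL_homInr_sumComp inR_homInr_sumComp
  inL_homInl_sumComp' inR_homInl_sumComp' inL_homInr_sumComp' inR_homInr_sumComp'
  sumInl_in₁ sumInr_in₁ sumInl_in₂ sumInr_in₂

theorem cellSum_id (A : Hom X Y) (B : Hom X' Y') : cellSum (𝟙 A) (𝟙 B) = 𝟙 (homSum A B) :=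
  homSum_cell_ext (DClass.sum_id A.bord B.bord) (by simp) (by simp)

theorem cellSum_comp {A A' A'' : Hom X Y} {B B' B'' : Hom X' Y'} (σ : A ⟶ A') (σ' : A' ⟶ A'')
    (τ : B ⟶ B') (τ' : B' ⟶ B'') : cellSum (σ ≫ σ') (τ ≫ τ') = cellSum σ τ ≫ cellSum σ' τ' :=
  homSum_cell_ext (DClass.sum_trans σ.cl σ'.cl τ.cl τ'.cl) (by simp) (by simp)

theorem sumComp_nat {A C : Hom X Y} {B D : Hom Y Z} {A' C' : Hom X' Y'} {B' D' : Hom Y' Z'}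
    (φ : A ⟶ C) (ψ : B ⟶ D) (φ' : A' ⟶ C') (ψ' : B' ⟶ D') :
    cellSum (hcomp φ ψ) (hcomp φ' ψ') ≫ (sumComp C D C' D').hom =
      (sumComp A B A' B').hom ≫ hcomp (cellSum φ φ') (cellSum ψ ψ') := by
  have h : (cellSum (hcomp φ ψ) (hcomp φ' ψ') ≫ (sumComp C D C' D').hom).cl =
      ((sumComp A B A' B').hom ≫ hcomp (cellSum φ φ') (cellSum ψ ψ')).cl :=
    DClass.sum_glue φ.cl ψ.cl φ'.cl ψ'.cl
  refine homSum_cell_ext h (hom_ext A B (base_congr (cell_base h)) ?_ ?_)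
    (hom_ext A' B' (base_congr (cell_base h)) ?_ ?_) <;> simp

theorem sumComp_assoc (A : Hom X Y) (B : Hom Y Z) (C : Hom Z T) (A' : Hom X' Y') (B' : Hom Y' Z')
    (C' : Hom Z' T') :
    cellSum (assoc A B C).hom (assoc A' B' C').hom ≫ (sumComp A (comp B C) A' (comp B' C')).hom ≫
      hcomp (𝟙 (homSum A A')) (sumComp B C B' C').hom =
    (sumComp (comp A B) C (comp A' B') C').hom ≫
      hcomp (sumComp A B A' B').hom (𝟙 (homSum C C')) ≫
        (assoc (homSum A A') (homSum B B') (homSum C C')).hom := by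
  have h : (cellSum (assoc A B C).hom (assoc A' B' C').hom ≫
      (sumComp A (comp B C) A' (comp B' C')).hom ≫
        hcomp (𝟙 (homSum A A')) (sumComp B C B' C').hom).cl =
    ((sumComp (comp A B) C (comp A' B') C').hom ≫
      hcomp (sumComp A B A' B').hom (𝟙 (homSum C C')) ≫
        (assoc (homSum A A') (homSum B B') (homSum C C')).hom).cl :=
    congrArg DClass.mk (CollarDiffeo.ext' (sum_ind
      (glue_ind (A.bord.comp B.bord) C.bord (glue_ind A.bord B.bord (fun _ => rfl) fun _ => rfl)
        fun _ => rfl)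
      (glue_ind (A'.bord.comp B'.bord) C'.bord (glue_ind A'.bord B'.bord (fun _ => rfl)
        fun _ => rfl) fun _ => rfl)))
  refine homSum_cell_ext h
    (hom_ext (comp A B) C (base_congr (cell_base h))
      (hom_ext A B (base_congr (base_congr (cell_base h))) ?_ ?_) ?_)
    (hom_ext (comp A' B') C' (base_congr (cell_base h))
      (hom_ext A' B' (base_congr (base_congr (cell_base h))) ?_ ?_) ?_) <;> simp

theorem sumComp_leftUnit (A : Hom X Y) (A' : Hom X' Y') :
    cellSum (leftUnit A).hom (leftUnit A').hom = (sumComp (one X) A (one X') A').hom ≫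
      hcomp (sumOne X X').hom (𝟙 (homSum A A')) ≫ (leftUnit (homSum A A')).hom := by
  have h : (cellSum (leftUnit A).hom (leftUnit A').hom).cl =
      ((sumComp (one X) A (one X') A').hom ≫
        hcomp (sumOne X X').hom (𝟙 (homSum A A')) ≫ (leftUnit (homSum A A')).hom).cl :=
    congrArg DClass.mk (CollarDiffeo.ext' (sum_ind
      (glue_ind (Bordism.one X.mfd) A.bord (fun _ => rfl) fun _ => rfl)
      (glue_ind (Bordism.one X'.mfd) A'.bord (fun _ => rfl) fun _ => rfl)))
  refine homSum_cell_ext h (hom_ext (one X) A (base_congr (cell_base h)) ?_ ?_)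
    (hom_ext (one X') A' (base_congr (cell_base h)) ?_ ?_) <;> simp

theorem sumComp_rightUnit (A : Hom X Y) (A' : Hom X' Y') :
    cellSum (rightUnit A).hom (rightUnit A').hom = (sumComp A (one Y) A' (one Y')).hom ≫
      hcomp (𝟙 (homSum A A')) (sumOne Y Y').hom ≫ (rightUnit (homSum A A')).hom := by
  have h : (cellSum (rightUnit A).hom (rightUnit A').hom).cl =
      ((sumComp A (one Y) A' (one Y')).hom ≫
        hcomp (𝟙 (homSum A A')) (sumOne Y Y').hom ≫ (rightUnit (homSum A A')).hom).cl :=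
    congrArg DClass.mk (CollarDiffeo.ext' (sum_ind
      (glue_ind A.bord (Bordism.one Y.mfd) (fun _ => rfl) fun _ => rfl)
      (glue_ind A'.bord (Bordism.one Y'.mfd) (fun _ => rfl) fun _ => rfl)))
  refine homSum_cell_ext h (hom_ext A (one Y) (base_congr (cell_base h)) ?_ ?_)
    (hom_ext A' (one Y') (base_congr (cell_base h)) ?_ ?_) <;> simp

end Laws

/-- The disjoint union, as a pseudofunctor. -/
def tensor (hS : IsSheaf S) : Pseudofunctor (Bd hS × Bd hS) (Bd hS) where
  obj X := sum X.1 X.2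
  map A := homSum A.1 A.2
  map₂ σ := cellSum σ.1 σ.2
  map₂_id A := cellSum_id A.1 A.2
  map₂_comp σ τ := cellSum_comp σ.1 τ.1 σ.2 τ.2
  mapId X := sumOne X.1 X.2
  mapComp A B := sumComp A.1 B.1 A.2 B.2
  map₂_whisker_left A _ _ σ := by
    rw [← Category.assoc, Iso.eq_comp_inv]
    refine (sumComp_nat _ _ _ _).trans ?_
    rw [cellSum_id]
    rfl
  map₂_whisker_right σ A := by
    rw [← Category.assoc, Iso.eq_comp_inv]
    refine (sumComp_nat _ _ _ _).trans ?_
    rw [cellSum_id]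
    rfl
  map₂_associator A B C := by
    have e := sumComp_assoc A.1 B.1 C.1 A.2 B.2 C.2
    have h₁ : hcomp (𝟙 (homSum A.1 A.2)) (sumComp B.1 C.1 B.2 C.2).hom ≫
        hcomp (𝟙 (homSum A.1 A.2)) (sumComp B.1 C.1 B.2 C.2).inv = 𝟙 _ := by
      rw [← hcomp_comp, Category.id_comp, Iso.hom_inv_id]
      exact hcomp_id _ _
    have h₂ : cellSum (assoc A.1 B.1 C.1).hom (assoc A.2 B.2 C.2).hom =
        (sumComp (comp A.1 B.1) C.1 (comp A.2 B.2) C.2).hom ≫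
          hcomp (sumComp A.1 B.1 A.2 B.2).hom (𝟙 (homSum C.1 C.2)) ≫
            (assoc (homSum A.1 A.2) (homSum B.1 B.2) (homSum C.1 C.2)).hom ≫
              hcomp (𝟙 (homSum A.1 A.2)) (sumComp B.1 C.1 B.2 C.2).inv ≫
                (sumComp A.1 (comp B.1 C.1) A.2 (comp B.2 C.2)).inv := by
      rw [← Category.assoc, ← Category.assoc, ← Category.assoc, Iso.eq_comp_inv]
      have := congrArg (· ≫ hcomp (𝟙 (homSum A.1 A.2)) (sumComp B.1 C.1 B.2 C.2).inv) e
      simp only [Category.assoc, h₁, Category.comp_id] at this ⊢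
      exact this
    exact h₂
  map₂_left_unitor A := sumComp_leftUnit A.1 A.2
  map₂_right_unitor A := sumComp_rightUnit A.1 A.2

/-- The unit for the disjoint union: the empty manifold. -/
def unit (hS : IsSheaf S) : Bd hS := ⟨ClosedMfd.empty m, (hS.exists_sec_empty (ClosedMfd.empty m).cyl).choose⟩

end Bd

end

end FieldTheory

namespace FieldTheory

open CategoryTheory Set Function Topology

noncomputable section

open Limits

/-- The bicategory of spans in a category `C`: its objects are those of `C`. -/
structure SpanCat (C : Type*) where
  of ::
  obj : C

namespace SpanCat

universe w z

variable {C : Type w} [Category.{z} C]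

/-- The `1`-cells: spans `a ← apex → b`. -/
@[ext]
structure Span (a b : C) where
  apex : C
  left : apex ⟶ a
  right : apex ⟶ b

/-- The `2`-cells `s ⇒ t` between spans are the maps `t.apex ⟶ s.apex` (in this direction) which
commute with the legs. -/
structure Cell {a b : C} (s t : Span a b) where
  hom : t.apex ⟶ s.apex
  left : hom ≫ s.left = t.left
  right : hom ≫ s.right = t.right

attribute [simp] Cell.left Cell.right

instance (a b : C) : Category (Span a b) where
  Hom := Cell
  id s := ⟨𝟙 _, by simp, by simp⟩
  comp σ τ := ⟨τ.hom ≫ σ.hom, by simp, by simp⟩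
  id_comp σ := by cases σ; simp
  comp_id σ := by cases σ; simp
  assoc σ τ ρ := by cases σ; simp

theorem Cell.ext' {a b : C} {s t : Span a b} {σ τ : s ⟶ t} (h : σ.hom = τ.hom) : σ = τ := by
  obtain ⟨σ, _, _⟩ := σ
  obtain ⟨τ, _, _⟩ := τ
  cases h
  rfl

@[simp] theorem id_hom {a b : C} (s : Span a b) : Cell.hom (𝟙 s) = 𝟙 s.apex := rfl
@[simp] theorem comp_hom {a b : C} {s t r : Span a b} (σ : s ⟶ t) (τ : t ⟶ r) :
    Cell.hom (σ ≫ τ) = τ.hom ≫ σ.hom := rfl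
@[simp] theorem left' {a b : C} {s t : Span a b} (σ : s ⟶ t) : σ.hom ≫ s.left = t.left := σ.left
@[simp] theorem right' {a b : C} {s t : Span a b} (σ : s ⟶ t) : σ.hom ≫ s.right = t.right := σ.right
@[simp] theorem left'_assoc {a b : C} {s t : Span a b} (σ : s ⟶ t) {c : C} (k : a ⟶ c) :
    σ.hom ≫ s.left ≫ k = t.left ≫ k := by rw [← Category.assoc, left']
@[simp] theorem right'_assoc {a b : C} {s t : Span a b} (σ : s ⟶ t) {c : C} (k : b ⟶ c) :
    σ.hom ≫ s.right ≫ k = t.right ≫ k := by rw [← Category.assoc, right']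

/-- An isomorphism of spans, from an isomorphism between the apices. -/
def isoMk {a b : C} {s t : Span a b} (e : t.apex ≅ s.apex) (h : e.hom ≫ s.left = t.left)
    (h' : e.hom ≫ s.right = t.right) : s ≅ t where
  hom := ⟨e.hom, h, h'⟩
  inv := ⟨e.inv, by rw [← h]; simp, by rw [← h']; simp⟩
  hom_inv_id := Cell.ext' e.inv_hom_id
  inv_hom_id := Cell.ext' e.hom_inv_id

@[simp] theorem isoMk_hom {a b : C} {s t : Span a b} (e : t.apex ≅ s.apex) (h h') :
    (isoMk (s := s) (t := t) e h h').hom.hom = e.hom := rfl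
@[simp] theorem isoMk_inv {a b : C} {s t : Span a b} (e : t.apex ≅ s.apex) (h h') :
    (isoMk (s := s) (t := t) e h h').inv.hom = e.inv := rfl

/-- The identity span. -/
abbrev one (a : C) : Span a a := ⟨a, 𝟙 a, 𝟙 a⟩

variable [HasPullbacks C]

/-- The composition of spans, by pullback. -/
abbrev comp {a b c : C} (s : Span a b) (t : Span b c) : Span a c :=
  ⟨pullback s.right t.left, pullback.fst _ _ ≫ s.left, pullback.snd _ _ ≫ t.right⟩

attribute [local simp] pullback.lift_fst pullback.lift_snd pullback.lift_fst_assoc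
  pullback.lift_snd_assoc

/-- The horizontal composition of `2`-cells. -/
def hcomp {a b c : C} {s s' : Span a b} {t t' : Span b c} (σ : s ⟶ s') (τ : t ⟶ t') :
    comp s t ⟶ comp s' t' where
  hom := pullback.lift (pullback.fst _ _ ≫ σ.hom) (pullback.snd _ _ ≫ τ.hom)
    (by simp [pullback.condition])
  left := by simp
  right := by simp

@[simp] theorem hcomp_hom {a b c : C} {s s' : Span a b} {t t' : Span b c} (σ : s ⟶ s')
    (τ : t ⟶ t') : (hcomp σ τ).hom = pullback.lift (pullback.fst _ _ ≫ σ.hom)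
      (pullback.snd _ _ ≫ τ.hom) (by simp [pullback.condition]) := rfl

/-- The associator. -/
def assoc {a b c d : C} (s : Span a b) (t : Span b c) (r : Span c d) :
    comp (comp s t) r ≅ comp s (comp t r) :=
  isoMk
    { hom := pullback.lift
        (pullback.lift (pullback.fst _ _) (pullback.snd _ _ ≫ pullback.fst _ _)
          (by simp [pullback.condition]))
        (pullback.snd _ _ ≫ pullback.snd _ _) (by simp [pullback.condition])
      inv := pullback.lift (pullback.fst _ _ ≫ pullback.fst _ _)
        (pullback.lift (pullback.fst _ _ ≫ pullback.snd _ _) (pullback.snd _ _)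
          (by simpa using pullback.condition))
        (by simp [pullback.condition])
      hom_inv_id := by
        apply pullback.hom_ext
        · simp
        · apply pullback.hom_ext <;> simp
      inv_hom_id := by
        apply pullback.hom_ext
        · apply pullback.hom_ext <;> simp
        · simp }
    (by simp) (by simp)

/-- The left unitor. -/
def leftUnit {a b : C} (s : Span a b) : comp (one a) s ≅ s :=
  isoMk
    { hom := pullback.lift s.left (𝟙 s.apex) (by simp)
      inv := pullback.snd (𝟙 a) s.left
      hom_inv_id := by simp
      inv_hom_id := by
        apply pullback.hom_ext
        · simpa using (pullback.condition (f := 𝟙 a) (g := s.left)).symm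
        · simp }
    (by simp) (by simp)

/-- The right unitor. -/
def rightUnit {a b : C} (s : Span a b) : comp s (one b) ≅ s :=
  isoMk
    { hom := pullback.lift (𝟙 s.apex) s.right (by simp)
      inv := pullback.fst s.right (𝟙 b)
      hom_inv_id := by simp
      inv_hom_id := by
        apply pullback.hom_ext
        · simp
        · simpa using pullback.condition (f := s.right) (g := 𝟙 b) }
    (by simp) (by simp)

section Laws

variable {a b c d e : C}

theorem whisker_comp {s s' s'' : Span a b} {t t' t'' : Span b c} (σ : s ⟶ s') (σ' : s' ⟶ s'')
    (τ : t ⟶ t') (τ' : t' ⟶ t'') : hcomp (σ ≫ σ') (τ ≫ τ') = hcomp σ τ ≫ hcomp σ' τ' :=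
  Cell.ext' (by simp only [hcomp_hom, comp_hom]; apply pullback.hom_ext <;> simp)

theorem hcomp_id (s : Span a b) (t : Span b c) : hcomp (𝟙 s) (𝟙 t) = 𝟙 (comp s t) :=
  Cell.ext' (by simp only [hcomp_hom, id_hom]; apply pullback.hom_ext <;> simp)

theorem assoc_nat {s s' : Span a b} {t t' : Span b c} {r r' : Span c d} (σ : s ⟶ s') (τ : t ⟶ t')
    (ρ : r ⟶ r') :
    hcomp (hcomp σ τ) ρ ≫ (assoc s' t' r').hom = (assoc s t r).hom ≫ hcomp σ (hcomp τ ρ) :=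
  Cell.ext' (by
    simp only [assoc, comp_hom, isoMk_hom, hcomp_hom]
    apply pullback.hom_ext
    · apply pullback.hom_ext <;> simp
    · simp)

theorem leftUnit_nat {s t : Span a b} (σ : s ⟶ t) :
    hcomp (𝟙 (one a)) σ ≫ (leftUnit t).hom = (leftUnit s).hom ≫ σ :=
  Cell.ext' (by
    simp only [leftUnit, comp_hom, isoMk_hom, hcomp_hom, id_hom]
    apply pullback.hom_ext <;> simp)

theorem rightUnit_nat {s t : Span a b} (σ : s ⟶ t) :
    hcomp σ (𝟙 (one b)) ≫ (rightUnit t).hom = (rightUnit s).hom ≫ σ :=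
  Cell.ext' (by
    simp only [rightUnit, comp_hom, isoMk_hom, hcomp_hom, id_hom]
    apply pullback.hom_ext <;> simp)

theorem pentagon' (s : Span a b) (t : Span b c) (r : Span c d) (q : Span d e) :
    hcomp (assoc s t r).hom (𝟙 q) ≫ (assoc s (comp t r) q).hom ≫ hcomp (𝟙 s) (assoc t r q).hom =
      (assoc (comp s t) r q).hom ≫ (assoc s t (comp r q)).hom :=
  Cell.ext' (by
    simp only [assoc, comp_hom, isoMk_hom, hcomp_hom, id_hom]
    apply pullback.hom_ext
    · apply pullback.hom_ext
      · apply pullback.hom_ext <;> simp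
      · simp
    · simp)

theorem triangle' (s : Span a b) (t : Span b c) :
    (assoc s (one b) t).hom ≫ hcomp (𝟙 s) (leftUnit t).hom = hcomp (rightUnit s).hom (𝟙 t) :=
  Cell.ext' (by
    simp only [assoc, leftUnit, rightUnit, comp_hom, isoMk_hom, hcomp_hom, id_hom]
    apply pullback.hom_ext
    · apply pullback.hom_ext
      · simp
      · simp [pullback.condition]
    · simp)

end Laws

instance : Bicategory (SpanCat C) where
  Hom a b := Span a.obj b.obj
  id a := one a.obj
  comp s t := comp s t
  whiskerLeft s _ _ τ := hcomp (𝟙 s) τ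
  whiskerRight σ t := hcomp σ (𝟙 t)
  associator := assoc
  leftUnitor := leftUnit
  rightUnitor := rightUnit
  whiskerLeft_id s t := hcomp_id s t
  whiskerLeft_comp s _ _ _ σ τ := (congrArg (hcomp · (σ ≫ τ)) (Category.comp_id (𝟙 s)).symm).trans
    (whisker_comp _ _ _ _)
  id_whiskerLeft σ := by
    rw [← Category.assoc, ← leftUnit_nat, Category.assoc, Iso.hom_inv_id, Category.comp_id]
  comp_whiskerLeft s t _ _ σ := by
    rw [← Category.assoc, Iso.eq_comp_inv, ← hcomp_id]
    exact assoc_nat _ _ _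
  id_whiskerRight s t := hcomp_id s t
  comp_whiskerRight σ τ t := (congrArg (hcomp (σ ≫ τ) ·) (Category.comp_id (𝟙 t)).symm).trans
    (whisker_comp _ _ _ _)
  whiskerRight_id σ := by
    rw [← Category.assoc, ← rightUnit_nat, Category.assoc, Iso.hom_inv_id, Category.comp_id]
  whiskerRight_comp σ t r := by
    rw [Iso.eq_inv_comp, ← hcomp_id]
    exact (assoc_nat _ _ _).symm
  whisker_assoc s _ _ σ t := by
    rw [← Category.assoc, Iso.eq_comp_inv]
    exact assoc_nat _ _ _
  whisker_exchange σ τ := by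
    rw [← whisker_comp, ← whisker_comp, Category.id_comp, Category.comp_id, Category.id_comp,
      Category.comp_id]
  pentagon s t r q := pentagon' s t r q
  triangle s t := triangle' s t

variable [HasTerminal C]

attribute [local instance] hasBinaryProducts_of_hasTerminal_and_pullbacks

attribute [local simp] prod.lift_fst prod.lift_snd prod.lift_fst_assoc prod.lift_snd_assoc
  prod.map_fst prod.map_snd prod.map_fst_assoc prod.map_snd_assoc

/-- The product of spans. -/
abbrev prodSpan {a b a' b' : C} (s : Span a b) (t : Span a' b') : Span (a ⨯ a') (b ⨯ b') :=
  ⟨s.apex ⨯ t.apex, prod.map s.left t.left, prod.map s.right t.right⟩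

/-- The product of `2`-cells. -/
def prodCell {a b a' b' : C} {s s' : Span a b} {t t' : Span a' b'} (σ : s ⟶ s') (τ : t ⟶ t') :
    prodSpan s t ⟶ prodSpan s' t' where
  hom := prod.map σ.hom τ.hom
  left := by simp
  right := by simp

@[simp] theorem prodCell_hom {a b a' b' : C} {s s' : Span a b} {t t' : Span a' b'} (σ : s ⟶ s')
    (τ : t ⟶ t') : (prodCell σ τ).hom = prod.map σ.hom τ.hom := rfl

/-- Products commute with the composition of spans. -/
def prodComp {a b c a' b' c' : C} (s : Span a b) (t : Span b c) (s' : Span a' b')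
    (t' : Span b' c') :
    prodSpan (comp s t) (comp s' t') ≅ comp (prodSpan s s') (prodSpan t t') :=
  isoMk
    { hom := prod.lift
        (pullback.lift (pullback.fst _ _ ≫ prod.fst) (pullback.snd _ _ ≫ prod.fst) (by
          have := congrArg (· ≫ prod.fst)
            (pullback.condition (f := prod.map s.right s'.right) (g := prod.map t.left t'.left))
          simpa using this))
        (pullback.lift (pullback.fst _ _ ≫ prod.snd) (pullback.snd _ _ ≫ prod.snd) (by
          have := congrArg (· ≫ prod.snd)
            (pullback.condition (f := prod.map s.right s'.right) (g := prod.map t.left t'.left))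
          simpa using this))
      inv := pullback.lift (prod.map (pullback.fst _ _) (pullback.fst _ _))
        (prod.map (pullback.snd _ _) (pullback.snd _ _)) (by simp [pullback.condition])
      hom_inv_id := by
        apply pullback.hom_ext <;> apply prod.hom_ext <;> simp
      inv_hom_id := by
        apply prod.hom_ext <;> apply pullback.hom_ext <;> simp }
    (by apply prod.hom_ext <;> simp) (by apply prod.hom_ext <;> simp)

/-- The product of identities is an identity. -/
def prodOne (a b : C) : prodSpan (one a) (one b) ≅ one (a ⨯ b) :=
  isoMk (Iso.refl _) (by simp) (by simp)

theorem prodCell_id {a b a' b' : C} (s : Span a b) (t : Span a' b') :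
    prodCell (𝟙 s) (𝟙 t) = 𝟙 (prodSpan s t) := Cell.ext' prod.map_id_id

theorem prodCell_comp {a b a' b' : C} {s s' s'' : Span a b} {t t' t'' : Span a' b'} (σ : s ⟶ s')
    (σ' : s' ⟶ s'') (τ : t ⟶ t') (τ' : t' ⟶ t'') :
    prodCell (σ ≫ σ') (τ ≫ τ') = prodCell σ τ ≫ prodCell σ' τ' :=
  Cell.ext' (by simp)

section Laws

variable {a b c d a' b' c' d' : C}

theorem prodComp_nat {s t : Span a b} {r q : Span b c} {s' t' : Span a' b'} {r' q' : Span b' c'}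
    (φ : s ⟶ t) (ψ : r ⟶ q) (φ' : s' ⟶ t') (ψ' : r' ⟶ q') :
    prodCell (hcomp φ ψ) (hcomp φ' ψ') ≫ (prodComp t q t' q').hom =
      (prodComp s r s' r').hom ≫ hcomp (prodCell φ φ') (prodCell ψ ψ') :=
  Cell.ext' (by
    simp only [prodComp, comp_hom, isoMk_hom, hcomp_hom, prodCell_hom]
    apply prod.hom_ext <;> apply pullback.hom_ext <;> simp)

theorem prodComp_assoc (s : Span a b) (t : Span b c) (r : Span c d) (s' : Span a' b')
    (t' : Span b' c') (r' : Span c' d') :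
    prodCell (assoc s t r).hom (assoc s' t' r').hom ≫
      (prodComp s (comp t r) s' (comp t' r')).hom ≫
        hcomp (𝟙 (prodSpan s s')) (prodComp t r t' r').hom =
    (prodComp (comp s t) r (comp s' t') r').hom ≫
      hcomp (prodComp s t s' t').hom (𝟙 (prodSpan r r')) ≫
        (assoc (prodSpan s s') (prodSpan t t') (prodSpan r r')).hom :=
  Cell.ext' (by
    simp only [prodComp, assoc, comp_hom, isoMk_hom, hcomp_hom, prodCell_hom, id_hom]
    apply prod.hom_ext <;> apply pullback.hom_ext
    · apply pullback.hom_ext <;> simp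
    · simp
    · apply pullback.hom_ext <;> simp
    · simp)

theorem prodComp_leftUnit (s : Span a b) (s' : Span a' b') :
    prodCell (leftUnit s).hom (leftUnit s').hom = (prodComp (one a) s (one a') s').hom ≫
      hcomp (prodOne a a').hom (𝟙 (prodSpan s s')) ≫ (leftUnit (prodSpan s s')).hom :=
  Cell.ext' (by
    simp only [prodComp, prodOne, leftUnit, comp_hom, isoMk_hom, hcomp_hom, prodCell_hom, id_hom]
    apply prod.hom_ext <;> apply pullback.hom_ext <;> simp)

theorem prodComp_rightUnit (s : Span a b) (s' : Span a' b') :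
    prodCell (rightUnit s).hom (rightUnit s').hom = (prodComp s (one b) s' (one b')).hom ≫
      hcomp (𝟙 (prodSpan s s')) (prodOne b b').hom ≫ (rightUnit (prodSpan s s')).hom :=
  Cell.ext' (by
    simp only [prodComp, prodOne, rightUnit, comp_hom, isoMk_hom, hcomp_hom, prodCell_hom, id_hom]
    apply prod.hom_ext <;> apply pullback.hom_ext <;> simp)

end Laws

/-- The monoidal product on spans, given by the product of `C`. -/
def tensor (C : Type w) [Category.{z} C] [HasPullbacks C] [HasTerminal C] :
    Pseudofunctor (SpanCat C × SpanCat C) (SpanCat C) where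
  obj X := ⟨X.1.obj ⨯ X.2.obj⟩
  map s := prodSpan s.1 s.2
  map₂ σ := prodCell σ.1 σ.2
  map₂_id s := prodCell_id s.1 s.2
  map₂_comp σ τ := prodCell_comp σ.1 τ.1 σ.2 τ.2
  mapId X := prodOne X.1.obj X.2.obj
  mapComp s t := prodComp s.1 t.1 s.2 t.2
  map₂_whisker_left s _ _ σ := by
    rw [← Category.assoc, Iso.eq_comp_inv]
    refine (prodComp_nat _ _ _ _).trans ?_
    rw [prodCell_id]
    rfl
  map₂_whisker_right σ s := by
    rw [← Category.assoc, Iso.eq_comp_inv]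
    refine (prodComp_nat _ _ _ _).trans ?_
    rw [prodCell_id]
    rfl
  map₂_associator A B C := by
    have e := prodComp_assoc A.1 B.1 C.1 A.2 B.2 C.2
    have h₁ : hcomp (𝟙 (prodSpan A.1 A.2)) (prodComp B.1 C.1 B.2 C.2).hom ≫
        hcomp (𝟙 (prodSpan A.1 A.2)) (prodComp B.1 C.1 B.2 C.2).inv = 𝟙 _ := by
      rw [← whisker_comp, Category.id_comp, Iso.hom_inv_id]
      exact hcomp_id _ _
    have h₂ : prodCell (assoc A.1 B.1 C.1).hom (assoc A.2 B.2 C.2).hom =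
        (prodComp (comp A.1 B.1) C.1 (comp A.2 B.2) C.2).hom ≫
          hcomp (prodComp A.1 B.1 A.2 B.2).hom (𝟙 (prodSpan C.1 C.2)) ≫
            (assoc (prodSpan A.1 A.2) (prodSpan B.1 B.2) (prodSpan C.1 C.2)).hom ≫
              hcomp (𝟙 (prodSpan A.1 A.2)) (prodComp B.1 C.1 B.2 C.2).inv ≫
                (prodComp A.1 (comp B.1 C.1) A.2 (comp B.2 C.2)).inv := by
      rw [← Category.assoc, ← Category.assoc, ← Category.assoc, Iso.eq_comp_inv]
      have := congrArg (· ≫ hcomp (𝟙 (prodSpan A.1 A.2)) (prodComp B.1 C.1 B.2 C.2).inv) e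
      simp only [Category.assoc, h₁, Category.comp_id] at this ⊢
      exact this
    exact h₂
  map₂_left_unitor A := prodComp_leftUnit A.1 A.2
  map₂_right_unitor A := prodComp_rightUnit A.1 A.2

/-- The unit for the product: the terminal object. -/
def unit (C : Type w) [Category.{z} C] [HasTerminal C] : SpanCat C := ⟨⊤_ C⟩

end SpanCat

end

end FieldTheory

namespace FieldTheory

open CategoryTheory Set Function Topology

noncomputable section

open Limits

universe v u w z

/-- The product of two pseudofunctors. -/
def prodPseudofunctor {B B' D D' : Type*} [Bicategory B] [Bicategory B'] [Bicategory D]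
    [Bicategory D'] (F : Pseudofunctor B D) (G : Pseudofunctor B' D') :
    Pseudofunctor (B × B') (D × D') where
  obj X := (F.obj X.1, G.obj X.2)
  map f := (F.map f.1, G.map f.2)
  map₂ σ := (F.map₂ σ.1, G.map₂ σ.2)
  map₂_id f := Prod.ext (F.map₂_id f.1) (G.map₂_id f.2)
  map₂_comp σ τ := Prod.ext (F.map₂_comp σ.1 τ.1) (G.map₂_comp σ.2 τ.2)
  mapId X := Iso.prod (F.mapId X.1) (G.mapId X.2)
  mapComp f g := Iso.prod (F.mapComp f.1 g.1) (G.mapComp f.2 g.2)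
  map₂_whisker_left f _ _ σ := Prod.ext (F.map₂_whisker_left f.1 σ.1) (G.map₂_whisker_left f.2 σ.2)
  map₂_whisker_right σ f := Prod.ext (F.map₂_whisker_right σ.1 f.1) (G.map₂_whisker_right σ.2 f.2)
  map₂_associator f g h := Prod.ext (F.map₂_associator f.1 g.1 h.1) (G.map₂_associator f.2 g.2 h.2)
  map₂_left_unitor f := Prod.ext (F.map₂_left_unitor f.1) (G.map₂_left_unitor f.2)
  map₂_right_unitor f := Prod.ext (F.map₂_right_unitor f.1) (G.map₂_right_unitor f.2)

variable {m : ℕ} {S : (Emb m)ᵒᵖ ⥤ Cat.{v, u}} {C : Type w} [Category.{z} C]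

/-- The Seifert–van Kampen property: the functor sends the empty manifold to a terminal object, and
it sends to a pullback every square in which `(X, x)` is obtained by gluing `(A, s)` and `(B, t)`
along a closed manifold `M`, which is embedded with a collar `M × [0, 1]` in both, such that
`M × {1}` goes to the boundary of `A` and `M × {0}` goes to the boundary of `B`. -/
structure SeifertVanKampen (F : (EEmb S)ᵒᵖ ⥤ C) : Prop where
  empty (X : EEmb S) [IsEmpty X.mfd] : Nonempty (IsTerminal (F.obj (.op X)))
  gluing {M : ClosedMfd m} {A B X : Mfd m} {f : M.cyl ⟶ A} {g : M.cyl ⟶ B} {j : A ⟶ X} {j' : B ⟶ X}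
    (h : IsCover₂ f g j j') (hf : ∀ p, f.toFun (ClosedMfd.pt p 1) ∈ A.bd) (hg : ∀ p, g.toFun (ClosedMfd.pt p 0) ∈ B.bd)
    {o : Sec S M.cyl} {s : Sec S A} {t : Sec S B} {x : Sec S X}
    (ho : (res S (cls f)).obj s = o) (ho' : (res S (cls g)).obj t = o)
    (hs : (res S (cls j)).obj x = s) (ht : (res S (cls j')).obj x = t) :
    IsPullback
      (F.map (EEmb.lift (X := ⟨A, s⟩) (Y := ⟨X, x⟩) (cls j) hs).op)
      (F.map (EEmb.lift (X := ⟨B, t⟩) (Y := ⟨X, x⟩) (cls j') ht).op)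
      (F.map (EEmb.lift (X := ⟨M.cyl, o⟩) (Y := ⟨A, s⟩) (cls f) ho).op)
      (F.map (EEmb.lift (X := ⟨M.cyl, o⟩) (Y := ⟨B, t⟩) (cls g) ho').op)

variable [HasTerminal C] [HasPullbacks C] {hS : IsSheaf S}

/-- The span `F M₁ ← F W → F M₂` of a bordism `W` from `M₁` to `M₂`. -/
abbrev fieldSpan (F : (EEmb S)ᵒᵖ ⥤ C) {X Y : Bd hS} (W : Bd.Hom X Y) :
    SpanCat.Span (F.obj (.op X.obj)) (F.obj (.op Y.obj)) :=
  ⟨F.obj (.op W.obj), F.map W.in₁.op, F.map W.in₂.op⟩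

/-- The map `F V → F W` of a `2`-cell `W ⇒ V`. -/
abbrev fieldCell (F : (EEmb S)ᵒᵖ ⥤ C) {X Y : Bd hS} {W V : Bd.Hom X Y} (σ : Bd.Cell W V) :
    SpanCat.Cell (fieldSpan F W) (fieldSpan F V) where
  hom := F.map σ.hom.op
  left := by rw [← F.map_comp, ← op_comp, σ.comm₁]
  right := by rw [← F.map_comp, ← op_comp, σ.comm₂]

/-- The assignment of objects, spans and maps of spans to closed manifolds `(M, s)`, bordisms and
`2`-cells: `(M, s)` goes to `F (M, s)`. -/
def fieldAssignment (hS : IsSheaf S) (F : (EEmb S)ᵒᵖ ⥤ C) : PrelaxFunctorStruct (Bd hS) (SpanCat C) where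
  obj X := ⟨F.obj (.op X.obj)⟩
  map W := fieldSpan F W
  map₂ σ := fieldCell F σ

attribute [local instance] hasBinaryProducts_of_hasTerminal_and_pullbacks

/-- The canonical map `F (M ⊔ N) → F M × F N`, as a span from `F M × F N` to `F (M ⊔ N)`. -/
def comparison (F : (EEmb S)ᵒᵖ ⥤ C) (X Y : Bd hS) :
    (SpanCat.tensor C).obj ((fieldAssignment hS F).obj X, (fieldAssignment hS F).obj Y) ⟶
      (fieldAssignment hS F).obj ((Bd.tensor hS).obj (X, Y)) where
  apex := F.obj (.op (Bd.sum X Y).obj)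
  left := prod.lift (F.map (Bd.sumInl X Y).op) (F.map (Bd.sumInr X Y).op)
  right := 𝟙 _

end

end FieldTheory

open FieldTheory CategoryTheory CategoryTheory.Limits CategoryTheory.Bicategory

/-! The functor `F` is contravariant, so it turns the inclusions of the two collars of a bordism
into the legs of a span, and a 2-cell of bordisms into a map of apices in the opposite direction,
which is the direction of a 2-cell of spans. That map commutes with the legs because a 2-cell is the
identity on the collars. What has to be proved is that composition and disjoint union are respected.

Composition. A composite of bordisms is the union of its two pieces, which meet in the collar of the
middle manifold. The Seifert–van Kampen property says that `F` of such a union is the pullback of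
`F` of the pieces over `F` of the collar, and this pullback is the apex of the composite span
(`SeifertVanKampen.isPullback_comp`, `fieldComp`). The identity bordism is a cylinder whose collars
are both the identity, so it goes to the identity span (`fieldOne`).

Coherence. The laws for associators, unitors and whiskerings are equations between maps into `F` of
a composite bordism. By the universal property of the pullback (`SeifertVanKampen.comp_hom_ext`)
such maps may be compared after restriction to each piece. There, one side is computed from the
projections of iterated pullbacks, and the other is the image under `F` of an identity between
embeddings which says how the constraint cells of `Bd hS` restrict to the pieces, such as
`Bd.inL_hcomp` or `Bd.inLL_assoc`. So the geometry has been settled in `Bd hS`, and only bookkeeping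
with projections remains (`fieldComp_nat`, `fieldComp_assoc`, `fieldComp_leftUnit`,
`fieldComp_rightUnit`).

Monoidality. A disjoint union is a gluing along the empty manifold. As `F` of the empty manifold is
terminal, the pullback is a product, and the canonical map from `F` of the union to the product is
an isomorphism (`SeifertVanKampen.isIso_sum`). This applies to closed manifolds and to bordisms
alike. A span with one leg an identity and the other an isomorphism is an equivalence
(`SpanCat.equivalenceOfIso`), hence so are the components of the transformation. The same fact gives
the unit, since any two terminal objects are isomorphic. The naturality constraint `comparisonNat`
at a pair of bordisms comes from the canonical map of the bordisms themselves. Its laws are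
equations between maps into a pullback over `F` of two closed manifolds, and they are checked on the
factors: one for each bordism, which is split further when the bordism is a composite, and one for
the outgoing boundary. -/

namespace FieldTheory

noncomputable section

universe v u w z

attribute [local simp] pullback.lift_fst pullback.lift_snd pullback.lift_fst_assoc
  pullback.lift_snd_assoc prod.lift_fst prod.lift_snd prod.lift_fst_assoc prod.lift_snd_assoc
  prod.map_fst prod.map_snd prod.map_fst_assoc prod.map_snd_assoc

attribute [local instance] hasBinaryProducts_of_hasTerminal_and_pullbacks

/-! ### Isomorphisms as equivalences of spans. -/

namespace SpanCat

variable {C : Type w} [Category.{z} C]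

/-- The span whose right leg is the identity. -/
abbrev ofLeft {a b : C} (f : b ⟶ a) : Span a b := ⟨b, f, 𝟙 b⟩

variable [HasPullbacks C]

/-- A pullback along an identity is carried by its second projection. Rewriting the first projection
in terms of the second brings the maps out of such a pullback to a form in which they can be
compared. -/
theorem fst_id_left {a b : C} (g : b ⟶ a) :
    pullback.fst (𝟙 a) g = pullback.snd (𝟙 a) g ≫ g := by
  simpa using pullback.condition (f := 𝟙 a) (g := g)

/-- An isomorphism of `C` is an equivalence in the bicategory of spans. -/
def equivalenceOfIso {a b : SpanCat C} (e : b.obj ≅ a.obj) : Bicategory.Equivalence a b :=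
  -- This constructor corrects the counit, so that two invertible 2-cells suffice and no triangle
  -- identity has to be checked.
  .mkOfAdjointifyCounit (f := (ofLeft e.hom : Span a.obj b.obj))
    (g := (ofLeft e.inv : Span b.obj a.obj))
    -- The apex of this composite is the pullback of `𝟙 b.obj` and `e.inv`, a copy of `a.obj`
    -- through the second projection. Under this identification its left leg becomes `e.inv ≫
    -- e.hom`, which is the identity.
    (isoMk (s := one a.obj) (t := comp (ofLeft e.hom) (ofLeft e.inv))
      { hom := pullback.snd _ _
        inv := pullback.lift e.inv (𝟙 _) (by simp)
        hom_inv_id := by apply pullback.hom_ext <;> simp [fst_id_left]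
        inv_hom_id := by simp }
      (by simp [fst_id_left]) (by simp))
    -- The same argument with the roles exchanged: `isoMk` wants a map from the apex of the target
    -- span to that of the source span, so the section of the second projection is now the forward
    -- map.
    (isoMk (s := comp (ofLeft e.inv) (ofLeft e.hom)) (t := one b.obj)
      { hom := pullback.lift e.hom (𝟙 _) (by simp)
        inv := pullback.snd _ _
        hom_inv_id := by simp
        inv_hom_id := by apply pullback.hom_ext <;> simp [fst_id_left] }
      (by simp) (by simp))

end SpanCat

variable {m : ℕ} {S : (Emb m)ᵒᵖ ⥤ Cat.{v, u}} {C : Type w} [Category.{z} C]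
  {F : (EEmb S)ᵒᵖ ⥤ C} {hS : IsSheaf S}

/-! ### Consequences of the Seifert–van Kampen property. -/

namespace SeifertVanKampen

variable {X Y Z T X' Y' Z' : Bd hS}

/-- The Seifert–van Kampen property enters composition here. A composite bordism is a gluing square
of the required kind: the outgoing collar of `A` takes `M × {1}` to the boundary of `A`, the
incoming collar of `B` takes `M × {0}` to the boundary of `B`, and the glued section restricts to
the given ones. -/
theorem isPullback_comp (hF : SeifertVanKampen F) (A : Bd.Hom X Y) (B : Bd.Hom Y Z) :
    IsPullback (F.map (Bd.inL A B).op) (F.map (Bd.inR A B).op) (F.map A.in₂.op)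
      (F.map B.in₁.op) :=
  hF.gluing (Bordism.isCover₂ A.bord B.bord) (fun p => (A.bord.boundary _).2 (.inr ⟨p, rfl⟩))
    (fun p => (B.bord.boundary _).2 (.inl ⟨p, rfl⟩)) A.sec₂ B.sec₁ (Bd.comp_secL A B)
    (Bd.comp_secR A B)

/-- The form in which the pullback property serves in the coherence laws: it reduces an equation
over a glued bordism to one equation over each piece. -/
theorem comp_hom_ext (hF : SeifertVanKampen F) {A : Bd.Hom X Y} {B : Bd.Hom Y Z} {c : C}
    {k l : c ⟶ F.obj (.op (Bd.comp A B).obj)}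
    (h : k ≫ F.map (Bd.inL A B).op = l ≫ F.map (Bd.inL A B).op)
    (h' : k ≫ F.map (Bd.inR A B).op = l ≫ F.map (Bd.inR A B).op) : k = l :=
  (hF.isPullback_comp A B).hom_ext h h'

/-- A disjoint union is a gluing along the empty closed manifold, and a pullback over a terminal
object is a product. The union is given abstractly by `IsSum`, because two models of it occur: for
closed manifolds the cylinder over the union, for bordisms the union itself. -/
theorem isIso_sum [HasTerminal C] [HasPullbacks C] (hF : SeifertVanKampen F) (hS : IsSheaf S)
    {A B V : Mfd m} {j : A ⟶ V} {j' : B ⟶ V} (h : IsSum j.toFun j'.toFun)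
    {s : Sec S A} {t : Sec S B} {x : Sec S V}
    (hs : (res S (cls j)).obj x = s) (ht : (res S (cls j')).obj x = t) :
    IsIso (prod.lift (F.map (EEmb.lift (X := ⟨A, s⟩) (Y := ⟨V, x⟩) (cls j) hs).op)
      (F.map (EEmb.lift (X := ⟨B, t⟩) (Y := ⟨V, x⟩) (cls j') ht).op)) := by
  -- The conditions on the boundary are vacuous. The section over the empty collar is taken to be
  -- the restriction of `s`; the restriction of `t` agrees with it because a sheaf has a single
  -- section over an empty manifold.
  have P := hF.gluing h.isCover₂ (fun p => isEmptyElim p) (fun p => isEmptyElim p) rfl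
    (hS.sec_empty_ext _ _) hs ht
  have : IsEmpty (EEmb.mfd (⟨(ClosedMfd.empty m).cyl, (res S (cls (fromEmpty
      (ClosedMfd.empty m).cyl A))).obj s⟩ : EEmb S)) :=
    inferInstanceAs (IsEmpty (ClosedMfd.empty m).cyl)
  obtain ⟨hT⟩ := hF.empty ⟨(ClosedMfd.empty m).cyl, (res S (cls (fromEmpty
      (ClosedMfd.empty m).cyl A))).obj s⟩
  -- The inverse is induced by the two projections of the product, which agree over the collar
  -- because `F` of the collar is terminal.
  refine ⟨P.lift prod.fst prod.snd (hT.hom_ext _ _), P.hom_ext ?_ ?_, prod.hom_ext ?_ ?_⟩ <;>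
    simp

variable [HasTerminal C] [HasPullbacks C]

theorem isIso_comparison (hF : SeifertVanKampen F) (X Y : Bd hS) : IsIso (comparison F X Y).left :=
  hF.isIso_sum hS (Bd.isSum_cyl' X.mfd Y.mfd) (Bd.sum_secL X Y) (Bd.sum_secR X Y)

theorem isIso_homSum (hF : SeifertVanKampen F) (A : Bd.Hom X Y) (B : Bd.Hom X' Y') :
    IsIso (prod.lift (F.map (Bd.homInl A B).op) (F.map (Bd.homInr A B).op)) :=
  hF.isIso_sum hS (Bd.isSum_sum' A.bord.W B.bord.W) (Bd.homSum_secL A B) (Bd.homSum_secR A B)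

end SeifertVanKampen

/-- This lemma and the next three carry an identity between embeddings over to `C`, where the order
of the factors is reversed. They differ only in the number of factors. The result is bracketed to
the right, so that an instance can serve as a rewriting rule for `simp`. -/
theorem map_op_congr {E₁ E₂ D D' : EEmb S} {f : E₁ ⟶ D} {g : D ⟶ E₂} {f' : E₁ ⟶ D'}
    {g' : D' ⟶ E₂} (h : f ≫ g = f' ≫ g') :
    F.map g.op ≫ F.map f.op = F.map g'.op ≫ F.map f'.op := by
  rw [← F.map_comp, ← F.map_comp, ← op_comp, ← op_comp, h]

theorem map_op_comp {E₁ E₂ D : EEmb S} {f : E₁ ⟶ D} {g : D ⟶ E₂} {k : E₁ ⟶ E₂}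
    (h : f ≫ g = k) : F.map g.op ≫ F.map f.op = F.map k.op := by
  rw [← F.map_comp, ← op_comp, h]

theorem map_op_congr₃ {E₁ E₂ D D' D'' : EEmb S} {f : E₁ ⟶ D} {g : D ⟶ D''} {k : D'' ⟶ E₂}
    {f' : E₁ ⟶ D'} {g' : D' ⟶ E₂} (h : f ≫ g ≫ k = f' ≫ g') :
    F.map k.op ≫ F.map g.op ≫ F.map f.op = F.map g'.op ≫ F.map f'.op := by
  simp only [← F.map_comp, ← op_comp, Category.assoc, h]

theorem map_op_comp₃ {E₁ E₂ D D'' : EEmb S} {f : E₁ ⟶ D} {g : D ⟶ D''} {k : D'' ⟶ E₂}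
    {l : E₁ ⟶ E₂} (h : f ≫ g ≫ k = l) :
    F.map k.op ≫ F.map g.op ≫ F.map f.op = F.map l.op := by
  simp only [← F.map_comp, ← op_comp, Category.assoc, h]

/-! ### Unit and composition constraints, and their coherence. -/

variable {X Y Z T X' Y' Z' : Bd hS}

/-- The collars of the identity bordism are identity embeddings, and the morphisms of sections over
them are the canonical identifications. So both legs of its span are images of identities under `F`.
-/
theorem in₁_one (X : Bd hS) : (Bd.one X).in₁ = 𝟙 X.obj :=
  (EEmb.lift_congr _ (cls_id _)).trans (EEmb.lift_id _ (res_id_obj S _))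
theorem in₂_one (X : Bd hS) : (Bd.one X).in₂ = 𝟙 X.obj :=
  (EEmb.lift_congr _ (cls_id _)).trans (EEmb.lift_id _ (res_id_obj S _))

/-- The identity bordism goes to the identity span. -/
def fieldOne (F : (EEmb S)ᵒᵖ ⥤ C) (X : Bd hS) :
    fieldSpan F (Bd.one X) ≅ SpanCat.one (F.obj (.op X.obj)) :=
  SpanCat.isoMk (Iso.refl _) (by simp [in₁_one]) (by simp [in₂_one])

/-- The map of spans of a `2`-cell, as a morphism of the category of spans. -/
abbrev fieldMap₂ (F : (EEmb S)ᵒᵖ ⥤ C) {A B : Bd.Hom X Y} (σ : A ⟶ B) :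
    fieldSpan F A ⟶ fieldSpan F B := fieldCell F σ

theorem fieldMap₂_id (A : Bd.Hom X Y) : fieldMap₂ F (𝟙 A) = 𝟙 (fieldSpan F A) :=
  SpanCat.Cell.ext' (F.map_id _)

/-- Vertical composition of cells of spans reverses the order of the maps of apices, and so does
`F`; the two reversals cancel. -/
theorem fieldMap₂_comp {A B D : Bd.Hom X Y} (σ : A ⟶ B) (τ : B ⟶ D) :
    fieldMap₂ F (σ ≫ τ) = fieldMap₂ F σ ≫ fieldMap₂ F τ :=
  SpanCat.Cell.ext' (F.map_comp τ.hom.op σ.hom.op)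

variable [HasPullbacks C]

/-- The span of a glued bordism is the composition of spans. -/
def fieldComp (hF : SeifertVanKampen F) (A : Bd.Hom X Y) (B : Bd.Hom Y Z) :
    fieldSpan F (Bd.comp A B) ≅ SpanCat.comp (fieldSpan F A) (fieldSpan F B) :=
  -- The inverse of the usual comparison appears because of the direction of 2-cells of spans: the
  -- map underlying `hom` goes from the pullback to `F` of the glued bordism, and the one underlying
  -- `inv` goes back.
  SpanCat.isoMk (hF.isPullback_comp A B).isoPullback.symm
    (by simp [Bd.in₁_comp]) (by simp [Bd.in₂_comp])

/-- The constraint matches restriction to a piece with a projection of the pullback. The laws below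
use `fieldComp` through these equations and their reassociated forms, without unfolding it. -/
theorem fieldComp_hom_inL (hF : SeifertVanKampen F) (A : Bd.Hom X Y) (B : Bd.Hom Y Z) :
    (fieldComp hF A B).hom.hom ≫ F.map (Bd.inL A B).op = pullback.fst _ _ :=
  (hF.isPullback_comp A B).isoPullback_inv_fst
theorem fieldComp_hom_inR (hF : SeifertVanKampen F) (A : Bd.Hom X Y) (B : Bd.Hom Y Z) :
    (fieldComp hF A B).hom.hom ≫ F.map (Bd.inR A B).op = pullback.snd _ _ :=
  (hF.isPullback_comp A B).isoPullback_inv_snd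
theorem fieldComp_inv_fst (hF : SeifertVanKampen F) (A : Bd.Hom X Y) (B : Bd.Hom Y Z) :
    (fieldComp hF A B).inv.hom ≫ pullback.fst _ _ = F.map (Bd.inL A B).op :=
  (hF.isPullback_comp A B).isoPullback_hom_fst
theorem fieldComp_inv_snd (hF : SeifertVanKampen F) (A : Bd.Hom X Y) (B : Bd.Hom Y Z) :
    (fieldComp hF A B).inv.hom ≫ pullback.snd _ _ = F.map (Bd.inR A B).op :=
  (hF.isPullback_comp A B).isoPullback_hom_snd
theorem fieldComp_inv_fst_assoc (hF : SeifertVanKampen F) (A : Bd.Hom X Y) (B : Bd.Hom Y Z) {c : C}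
    (k : F.obj (.op A.obj) ⟶ c) :
    (fieldComp hF A B).inv.hom ≫ pullback.fst _ _ ≫ k = F.map (Bd.inL A B).op ≫ k := by
  rw [← fieldComp_inv_fst hF, Category.assoc]
theorem fieldComp_inv_snd_assoc (hF : SeifertVanKampen F) (A : Bd.Hom X Y) (B : Bd.Hom Y Z) {c : C}
    (k : F.obj (.op B.obj) ⟶ c) :
    (fieldComp hF A B).inv.hom ≫ pullback.snd _ _ ≫ k = F.map (Bd.inR A B).op ≫ k := by
  rw [← fieldComp_inv_snd hF, Category.assoc]
theorem fieldComp_hom_inL_assoc (hF : SeifertVanKampen F) (A : Bd.Hom X Y) (B : Bd.Hom Y Z) {c : C}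
    (k : F.obj (.op A.obj) ⟶ c) :
    (fieldComp hF A B).hom.hom ≫ F.map (Bd.inL A B).op ≫ k = pullback.fst _ _ ≫ k := by
  rw [← fieldComp_hom_inL hF, Category.assoc]
theorem fieldComp_hom_inR_assoc (hF : SeifertVanKampen F) (A : Bd.Hom X Y) (B : Bd.Hom Y Z) {c : C}
    (k : F.obj (.op B.obj) ⟶ c) :
    (fieldComp hF A B).hom.hom ≫ F.map (Bd.inR A B).op ≫ k = pullback.snd _ _ ≫ k := by
  rw [← fieldComp_hom_inR hF, Category.assoc]

attribute [local simp] fieldComp_hom_inL fieldComp_hom_inR fieldComp_inv_fst fieldComp_inv_snd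
  fieldComp_inv_fst_assoc fieldComp_inv_snd_assoc fieldComp_hom_inL_assoc fieldComp_hom_inR_assoc

/-- The underlying maps end in `F` of `Bd.comp A B`, so they are compared on the two pieces. There a
horizontal composite of 2-cells of bordisms restricts to its factors, which is also how the
horizontal composite of cells of spans is defined. -/
theorem fieldComp_nat (hF : SeifertVanKampen F) {A A' : Bd.Hom X Y} {B B' : Bd.Hom Y Z}
    (σ : A ⟶ A') (τ : B ⟶ B') :
    fieldMap₂ F (Bd.hcomp σ τ) ≫ (fieldComp hF A' B').hom =
      (fieldComp hF A B).hom ≫ SpanCat.hcomp (fieldMap₂ F σ) (fieldMap₂ F τ) :=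
  SpanCat.Cell.ext' (hF.comp_hom_ext
    (by simp [map_op_congr (F := F) (Bd.inL_hcomp σ τ)])
    (by simp [map_op_congr (F := F) (Bd.inR_hcomp σ τ)]))

/-- Both associators only rebracket: one matches the pieces of a triple gluing, the other the
projections of a triple pullback. The law is stated without inverses, so that each side is a plain
composite of restrictions and lifts. -/
theorem fieldComp_assoc (hF : SeifertVanKampen F) (A : Bd.Hom X Y) (B : Bd.Hom Y Z)
    (D : Bd.Hom Z T) :
    fieldMap₂ F (Bd.assoc A B D).hom ≫ (fieldComp hF A (Bd.comp B D)).hom ≫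
      SpanCat.hcomp (𝟙 (fieldSpan F A)) (fieldComp hF B D).hom =
    (fieldComp hF (Bd.comp A B) D).hom ≫
      SpanCat.hcomp (fieldComp hF A B).hom (𝟙 (fieldSpan F D)) ≫
        (SpanCat.assoc (fieldSpan F A) (fieldSpan F B) (fieldSpan F D)).hom := by
  -- The maps end in `F` of the bordism glued as `(A B) D`; the three goals are the restrictions to
  -- `A`, `B` and `D`.
  refine SpanCat.Cell.ext' (hF.comp_hom_ext (hF.comp_hom_ext ?_ ?_) ?_)
  · simp [SpanCat.assoc, map_op_comp₃ (F := F) (Bd.inLL_assoc A B D)]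
  · simp [SpanCat.assoc, map_op_congr₃ (F := F) (Bd.inRL_assoc A B D)]
  · simp [SpanCat.assoc, map_op_congr (F := F) (Bd.inR_assoc A B D)]

/-- The unitor of bordisms is the incoming collar on the cylinder and the identity on `A`. Under `F`
these become the left leg of the span and the identity of its apex, the two components of the unitor
of spans. -/
theorem fieldComp_leftUnit (hF : SeifertVanKampen F) (A : Bd.Hom X Y) :
    fieldMap₂ F (Bd.leftUnit A).hom = (fieldComp hF (Bd.one X) A).hom ≫
      SpanCat.hcomp (fieldOne F X).hom (𝟙 (fieldSpan F A)) ≫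
        (SpanCat.leftUnit (fieldSpan F A)).hom := by
  refine SpanCat.Cell.ext' (hF.comp_hom_ext ?_ ?_)
  · simp [SpanCat.leftUnit, fieldOne, map_op_comp (F := F) (Bd.inL_leftUnit A)]
  · simp [SpanCat.leftUnit, fieldOne, map_op_comp (F := F) (Bd.inR_leftUnit A)]

theorem fieldComp_rightUnit (hF : SeifertVanKampen F) (A : Bd.Hom X Y) :
    fieldMap₂ F (Bd.rightUnit A).hom = (fieldComp hF A (Bd.one Y)).hom ≫
      SpanCat.hcomp (𝟙 (fieldSpan F A)) (fieldOne F Y).hom ≫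
        (SpanCat.rightUnit (fieldSpan F A)).hom := by
  refine SpanCat.Cell.ext' (hF.comp_hom_ext ?_ ?_)
  · simp [SpanCat.rightUnit, fieldOne, map_op_comp (F := F) (Bd.inL_rightUnit A)]
  · simp [SpanCat.rightUnit, fieldOne, map_op_comp (F := F) (Bd.inR_rightUnit A)]

/-- This and its mirror image are the cases of `fieldComp_nat` in which one of the 2-cells is an
identity, with the last constraint moved to the other side. -/
theorem fieldComp_whiskerLeft (hF : SeifertVanKampen F) (A : Bd.Hom X Y) {B B' : Bd.Hom Y Z}
    (τ : B ⟶ B') : fieldMap₂ F (Bd.hcomp (𝟙 A) τ) = (fieldComp hF A B).hom ≫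
      SpanCat.hcomp (𝟙 (fieldSpan F A)) (fieldMap₂ F τ) ≫ (fieldComp hF A B').inv := by
  rw [← Category.assoc, Iso.eq_comp_inv, fieldComp_nat, fieldMap₂_id]

theorem fieldComp_whiskerRight (hF : SeifertVanKampen F) {A A' : Bd.Hom X Y} (σ : A ⟶ A')
    (B : Bd.Hom Y Z) : fieldMap₂ F (Bd.hcomp σ (𝟙 B)) = (fieldComp hF A B).hom ≫
      SpanCat.hcomp (fieldMap₂ F σ) (𝟙 (fieldSpan F B)) ≫ (fieldComp hF A' B).inv := by
  rw [← Category.assoc, Iso.eq_comp_inv, fieldComp_nat, fieldMap₂_id]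

/-! ### The pseudofunctor from bordisms to spans. -/

variable [HasTerminal C]

/-- The pseudofunctor from bordisms to spans. -/
def field (hF : SeifertVanKampen F) (hS : IsSheaf S) : Pseudofunctor (Bd hS) (SpanCat C) where
  -- Taking the assignment as the underlying data makes the prescribed values on objects, bordisms
  -- and 2-cells hold by definition.
  toPrelaxFunctorStruct := fieldAssignment hS F
  map₂_id A := fieldMap₂_id A
  map₂_comp σ τ := fieldMap₂_comp σ τ
  mapId X := fieldOne F X
  mapComp A B := fieldComp hF A B
  map₂_whisker_left A _ _ σ := fieldComp_whiskerLeft hF A σ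
  map₂_whisker_right σ A := fieldComp_whiskerRight hF σ A
  map₂_associator A B D := by
    -- The law of a pseudofunctor has two inverse constraints on its right side, while
    -- `fieldComp_assoc` has none. This equation cancels the whiskered one; the other is moved
    -- across by `Iso.eq_comp_inv`.
    have h₁ : SpanCat.hcomp (𝟙 (fieldSpan F A)) (fieldComp hF B D).hom ≫
        SpanCat.hcomp (𝟙 (fieldSpan F A)) (fieldComp hF B D).inv = 𝟙 _ := by
      rw [← SpanCat.whisker_comp, Category.id_comp, Iso.hom_inv_id]
      exact SpanCat.hcomp_id _ _
    have h₂ : fieldMap₂ F (Bd.assoc A B D).hom =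
        (fieldComp hF (Bd.comp A B) D).hom ≫
          SpanCat.hcomp (fieldComp hF A B).hom (𝟙 (fieldSpan F D)) ≫
            (SpanCat.assoc (fieldSpan F A) (fieldSpan F B) (fieldSpan F D)).hom ≫
              SpanCat.hcomp (𝟙 (fieldSpan F A)) (fieldComp hF B D).inv ≫
                (fieldComp hF A (Bd.comp B D)).inv := by
      rw [← Category.assoc, ← Category.assoc, ← Category.assoc, Iso.eq_comp_inv]
      have := congrArg (· ≫ SpanCat.hcomp (𝟙 (fieldSpan F A)) (fieldComp hF B D).inv)
        (fieldComp_assoc hF A B D)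
      simp only [Category.assoc, h₁, Category.comp_id] at this ⊢
      exact this
    exact h₂
  map₂_left_unitor A := fieldComp_leftUnit hF A
  map₂_right_unitor A := fieldComp_rightUnit hF A

/-! ### Disjoint unions and the comparison with products. -/

/-- The canonical map `F (X ⊔ Y) → F X × F Y`. -/
abbrev comparisonMap (F : (EEmb S)ᵒᵖ ⥤ C) (X Y : Bd hS) :
    F.obj (.op (Bd.sum X Y).obj) ⟶ F.obj (.op X.obj) ⨯ F.obj (.op Y.obj) :=
  prod.lift (F.map (Bd.sumInl X Y).op) (F.map (Bd.sumInr X Y).op)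

/-- The canonical map `F (A ⊔ B) → F A × F B` for bordisms. -/
abbrev homComparison (F : (EEmb S)ᵒᵖ ⥤ C) (A : Bd.Hom X Y) (B : Bd.Hom X' Y') :
    F.obj (.op (Bd.homSum A B).obj) ⟶ F.obj (.op A.obj) ⨯ F.obj (.op B.obj) :=
  prod.lift (F.map (Bd.homInl A B).op) (F.map (Bd.homInr A B).op)

/-- The collar of a disjoint union is, on each summand, the collar of that summand. Together with
`homComparison_right` this makes `homComparison` compatible with both legs, over the comparison maps
of the two ends. -/
theorem homComparison_left (A : Bd.Hom X Y) (B : Bd.Hom X' Y') :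
    homComparison F A B ≫ prod.map (F.map A.in₁.op) (F.map B.in₁.op) =
      F.map (Bd.homSum A B).in₁.op ≫ comparisonMap F X X' := by
  apply prod.hom_ext
  · simp [map_op_congr (F := F) (Bd.sumInl_in₁ A B)]
  · simp [map_op_congr (F := F) (Bd.sumInr_in₁ A B)]

theorem homComparison_right (A : Bd.Hom X Y) (B : Bd.Hom X' Y') :
    homComparison F A B ≫ prod.map (F.map A.in₂.op) (F.map B.in₂.op) =
      F.map (Bd.homSum A B).in₂.op ≫ comparisonMap F Y Y' := by
  apply prod.hom_ext
  · simp [map_op_congr (F := F) (Bd.sumInl_in₂ A B)]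
  · simp [map_op_congr (F := F) (Bd.sumInr_in₂ A B)]

/-- The span of a disjoint union of bordisms is the product of spans. -/
def comparisonNat (hF : SeifertVanKampen F) (A : Bd.Hom X Y) (B : Bd.Hom X' Y') :
    SpanCat.comp (SpanCat.prodSpan (fieldSpan F A) (fieldSpan F B))
        (SpanCat.ofLeft (comparisonMap F Y Y')) ≅
      SpanCat.comp (SpanCat.ofLeft (comparisonMap F X X')) (fieldSpan F (Bd.homSum A B)) :=
  -- Invertibility of `homComparison` provides the inverse map of apices. Invertibility of the
  -- comparison at the outgoing end is needed only to cancel it as a monomorphism.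
  haveI := hF.isIso_homSum A B
  haveI : IsIso (comparisonMap F Y Y') := hF.isIso_comparison Y Y'
  SpanCat.isoMk
    -- The apex of the target span is a copy of `F` of the disjoint union of `A` and `B`, through
    -- `pullback.snd`. Its elements, so to speak, are sent to their restrictions to `A`, to `B` and
    -- to the outgoing boundary.
    { hom := pullback.lift (pullback.snd _ _ ≫ homComparison F A B)
        (pullback.snd _ _ ≫ F.map (Bd.homSum A B).in₂.op)
        (by simp only [Category.assoc, homComparison_right])
      -- Conversely, the factor in `F A × F B` already determines an element over the disjoint
      -- union; its component over the incoming boundary is forced by the condition of the pullback.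
      inv := pullback.lift
        (pullback.fst _ _ ≫ inv (homComparison F A B) ≫ F.map (Bd.homSum A B).in₁.op)
        (pullback.fst _ _ ≫ inv (homComparison F A B)) (by simp)
      -- The rule `prod.comp_lift` would push the projection into the `prod.lift` abbreviated by
      -- `homComparison`, and so hide its composite with the inverse.
      hom_inv_id := by apply pullback.hom_ext <;> simp [-prod.comp_lift, SpanCat.fst_id_left]
      inv_hom_id := by
        apply pullback.hom_ext
        · simp [-prod.comp_lift]
        -- The component over the outgoing boundary is determined by its image in `F Y × F Y'`.
        -- After `homComparison_right` is used backwards, the inverse cancels and the condition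
        -- defining the pullback is left.
        · rw [← cancel_mono (comparisonMap F Y Y')]
          simp only [Category.assoc, pullback.lift_snd, pullback.lift_snd_assoc,
            ← homComparison_right, IsIso.inv_hom_id_assoc, Category.id_comp]
          exact pullback.condition }
    -- Compatibility with the left legs is `homComparison_left`, read through the second projection
    -- by `SpanCat.fst_id_left`.
    (by simp only [pullback.lift_fst_assoc, Category.assoc, homComparison_left,
          SpanCat.fst_id_left])
    (by simp)

/-- A disjoint union of 2-cells restricts to each of them on its summand and fixes the outgoing
collar. These three facts are the components of the equation, the underlying maps of which end in a
pullback of `F A × F B` and `F` of the outgoing boundary. -/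
theorem comparisonNat_nat (hF : SeifertVanKampen F) {A A' : Bd.Hom X Y} {B B' : Bd.Hom X' Y'}
    (σ : A ⟶ A') (τ : B ⟶ B') :
    SpanCat.hcomp (SpanCat.prodCell (fieldMap₂ F σ) (fieldMap₂ F τ))
        (𝟙 (SpanCat.ofLeft (comparisonMap F Y Y'))) ≫ (comparisonNat hF A' B').hom =
      (comparisonNat hF A B).hom ≫ SpanCat.hcomp (𝟙 (SpanCat.ofLeft (comparisonMap F X X')))
        (fieldMap₂ F (Bd.cellSum σ τ)) := by
  refine SpanCat.Cell.ext' (pullback.hom_ext (prod.hom_ext ?_ ?_) ?_)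
  · simp [comparisonNat, map_op_congr (F := F) (Bd.homInl_cellSum σ τ)]
  · simp [comparisonNat, map_op_congr (F := F) (Bd.homInr_cellSum σ τ)]
  · simp [comparisonNat, map_op_comp (F := F) (Bd.Cell.comm₂ (Bd.cellSum σ τ))]

/-- On each summand, the identification of a union of cylinders with the cylinder over the union is
the inclusion which defines `comparisonMap`; on the outgoing collar it is the identity. This and the
next lemma are spelled out in the form that the laws of a strong transformation take after
unfolding. -/
theorem comparisonNat_id (hF : SeifertVanKampen F) (X Y : Bd hS) :
    (comparisonNat hF (Bd.one X) (Bd.one Y)).hom ≫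
        SpanCat.hcomp (𝟙 (SpanCat.ofLeft (comparisonMap F X Y)))
          (fieldMap₂ F (Bd.sumOne X Y).hom ≫ (fieldOne F (Bd.sum X Y)).hom) =
      SpanCat.hcomp (SpanCat.prodCell (fieldOne F X).hom (fieldOne F Y).hom ≫
          (SpanCat.prodOne _ _).hom) (𝟙 (SpanCat.ofLeft (comparisonMap F X Y))) ≫
        (SpanCat.leftUnit _).hom ≫ (SpanCat.rightUnit _).inv := by
  refine SpanCat.Cell.ext' (pullback.hom_ext (prod.hom_ext ?_ ?_) ?_)
  · simp [comparisonNat, fieldOne, SpanCat.prodOne, SpanCat.leftUnit, SpanCat.rightUnit,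
      SpanCat.fst_id_left, map_op_comp (F := F) (Bd.homInl_sumOne X Y)]
  · simp [comparisonNat, fieldOne, SpanCat.prodOne, SpanCat.leftUnit, SpanCat.rightUnit,
      SpanCat.fst_id_left, map_op_comp (F := F) (Bd.homInr_sumOne X Y)]
  · simp [comparisonNat, fieldOne, SpanCat.prodOne, SpanCat.leftUnit, SpanCat.rightUnit,
      SpanCat.fst_id_left, in₂_one, map_op_comp (F := F) (Bd.Cell.comm₂ (Bd.sumOne X Y).hom)]

/-- The interchange of gluing and disjoint union of bordisms matches that of pullbacks and products.
The right side composes the constraints at the two stages, with rebracketings in between; since all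
its factors are built from projections and lifts, each component collapses to the restriction to one
piece. -/
theorem comparisonNat_comp (hF : SeifertVanKampen F) (A : Bd.Hom X Y) (A' : Bd.Hom X' Y')
    (B : Bd.Hom Y Z) (B' : Bd.Hom Y' Z') :
    (comparisonNat hF (Bd.comp A B) (Bd.comp A' B')).hom ≫
        SpanCat.hcomp (𝟙 (SpanCat.ofLeft (comparisonMap F X X')))
          (fieldMap₂ F (Bd.sumComp A B A' B').hom ≫
            (fieldComp hF (Bd.homSum A A') (Bd.homSum B B')).hom) =
      SpanCat.hcomp (SpanCat.prodCell (fieldComp hF A B).hom (fieldComp hF A' B').hom ≫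
          (SpanCat.prodComp _ _ _ _).hom) (𝟙 (SpanCat.ofLeft (comparisonMap F Z Z'))) ≫
        (SpanCat.assoc _ _ _).hom ≫
        SpanCat.hcomp (𝟙 (SpanCat.prodSpan (fieldSpan F A) (fieldSpan F A')))
          (comparisonNat hF B B').hom ≫
        (SpanCat.assoc _ _ _).inv ≫
        SpanCat.hcomp (comparisonNat hF A A').hom (𝟙 (fieldSpan F (Bd.homSum B B'))) ≫
        (SpanCat.assoc _ _ _).hom := by
  -- Five components: the restrictions to `A`, `B`, `A'` and `B'`, and the outgoing boundary over
  -- `Z` and `Z'`.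
  refine SpanCat.Cell.ext' (pullback.hom_ext (prod.hom_ext (hF.comp_hom_ext ?_ ?_)
    (hF.comp_hom_ext ?_ ?_)) ?_)
  · simp [comparisonNat, SpanCat.prodComp, SpanCat.assoc,
      map_op_congr₃ (F := F) (Bd.inL_homInl_sumComp A B A' B')]
  · simp [comparisonNat, SpanCat.prodComp, SpanCat.assoc,
      map_op_congr₃ (F := F) (Bd.inR_homInl_sumComp A B A' B')]
  · simp [comparisonNat, SpanCat.prodComp, SpanCat.assoc,
      map_op_congr₃ (F := F) (Bd.inL_homInr_sumComp A B A' B')]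
  · simp [comparisonNat, SpanCat.prodComp, SpanCat.assoc,
      map_op_congr₃ (F := F) (Bd.inR_homInr_sumComp A B A' B')]
  · simp [comparisonNat, SpanCat.prodComp, SpanCat.assoc, Bd.in₂_comp,
      map_op_comp (F := F) (Bd.Cell.comm₂ (Bd.sumComp A B A' B').hom)]

/-- The comparison maps, as a pseudonatural transformation. -/
def fieldMonoidal (hF : SeifertVanKampen F) (hS : IsSheaf S) :
    Pseudofunctor.StrongTrans
      ((prodPseudofunctor (field hF hS) (field hF hS)).comp (SpanCat.tensor C))
      ((Bd.tensor hS).comp (field hF hS)) where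
  app X := comparison F X.1 X.2
  naturality A := comparisonNat hF A.1 A.2
  naturality_naturality σ := comparisonNat_nat hF σ.1 σ.2
  naturality_id X := comparisonNat_id hF X.1 X.2
  naturality_comp A B := comparisonNat_comp hF A.1 A.2 B.1 B.2

end

end FieldTheory

/-! ### Assembly of the pseudofunctor and its monoidal structure. -/

theorem mainTheorem9 {m : ℕ} (S : (Emb m)ᵒᵖ ⥤ Cat) (hS : IsSheaf S)
    {C : Type*} [Category C] [HasTerminal C] [HasPullbacks C]
    (F : (EEmb S)ᵒᵖ ⥤ C) (hF : SeifertVanKampen F) :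
    ∃ 𝓕 : Pseudofunctor (Bd hS) (SpanCat C),
      𝓕.toPrelaxFunctorStruct = fieldAssignment hS F ∧
      Nonempty (Bicategory.Equivalence (SpanCat.unit C) (𝓕.obj (Bd.unit hS))) ∧
      ∃ μ : Pseudofunctor.StrongTrans ((prodPseudofunctor 𝓕 𝓕).comp (SpanCat.tensor C))
          ((Bd.tensor hS).comp 𝓕),
        ∀ M N : Bd hS, μ.app (M, N) ≍ comparison F M N ∧
          ∃ e : Bicategory.Equivalence _ _, e.hom = μ.app (M, N) := by
  -- The unit is the empty manifold; the cylinder over it is again empty, so its image under `F` is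
  -- terminal and hence isomorphic to the chosen terminal object.
  have : IsEmpty (Bd.unit hS).obj.mfd := inferInstanceAs (IsEmpty (ClosedMfd.empty m).cyl)
  obtain ⟨hT⟩ := hF.empty (Bd.unit hS).obj
  -- The type of a component depends on the pseudofunctor, hence the heterogeneous equality in the
  -- statement. For `field hF hS` the two types agree by definition, and the component is
  -- `comparison` itself.
  refine ⟨field hF hS, rfl, ⟨SpanCat.equivalenceOfIso (hT.uniqueUpToIso terminalIsTerminal)⟩,
    fieldMonoidal hF hS, fun M N => ⟨HEq.rfl, ?_⟩⟩
  -- The right leg of `comparison` is an identity, so it is by definition the span `SpanCat.ofLeft`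
  -- of the canonical map, which is the forward 1-cell of this equivalence.
  exact ⟨SpanCat.equivalenceOfIso (@asIso _ _ _ _ _ (hF.isIso_comparison M N)), rfl⟩
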